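/- Let $\mathcal G=(V,\mathcal I,\mathcal E,\partial)$ be a finite graph with internal edges $i\in\mathcal I$ (from $\partial^-(i)$ to $\partial^+(i)$, identified with $[0,a_i]$, $a_i>0$) and external edges $e\in\mathcal E$ (from $\partial(e)=\partial^-(e)$, identified with $[0,\infty)$), without tadpoles, i.e. $\partial^-(i)\ne\partial^+(i)$ for all $i\in\mathcal I$. Let $I_j$ be the interval of the edge $j$ and $\mathcal H=\bigoplus_{j\in\mathcal E\cup\mathcal I}L^2(I_j)$. Let $\mathcal K=\mathbb C^{\mathcal E}\oplus\mathbb C^{\mathcal I}\oplus\mathbb C^{\mathcal I}$ and, for $\psi$ with $\psi_j,\psi_j'$ (locally) absolutely continuous and $\psi_j,\psi_j''\in L^2(I_j)$, put $$\underline\psi=(\psi_e(0),\psi_i(0),\psi_i(a_i)),\qquad \underline\psi'=(\psi'_e(0),\psi'_i(0),-\psi'_i(a_i))\quad\text{in }\mathcal K.$$ Let $\mathcal M\subset\mathcal K\oplus\mathcal K$ be a maximal isotropic subspace for the form $\omega((\chi,\chi'),(\eta,\eta'))=\langle\chi,\eta'\rangle-\langle\chi',\eta\rangle$, and let $\Delta(\mathcal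 M,\underline a)$ be the operator $\psi\mapsto\psi''$ in $\mathcal H$ on the domain of those $\psi$ with $(\underline\psi,\underline\psi')\in\mathcal M$. For square matrices $A,B$ write $\mathcal M(A,B)=\{(\chi,\chi'):A\chi+B\chi'=0\}$ and $\mathfrak S(\mathsf k;A,B)=-(A+i\mathsf kB)^{-1}(A-i\mathsf kB)$. Let $\mathcal M=\mathcal M(A,B)$ and suppose that one of the following (equivalent) conditions holds: $\mathfrak S(\mathsf k;A,B)$ does not depend on $\mathsf k>0$; it is self-adjoint for some $\mathsf k>0$; it equals $\mathbb I-2P$ with an orthogonal projection $P$ for some $\mathsf k>0$; $AB^\dagger=0$. Suppose moreover that $\mathcal M$ is local: $\mathcal M=\bigoplus_{v\in V}\mathcal M(A(v),B(v))$, where $A(v),B(v)$ act on the subspace $\mathcal L_v\subset\mathcal K$ of the edge ends at $v$ and $\mathcal M(A(v),B(v))$ is maximal isotropic in $\mathcal L_v\oplus\mathcal L_v$. Write $\mathfrak S(A(v),B(v))$ for the matrix $\mathfrak S(\kappa;A(v),B(v))$, where any $\kappa>0$ may be used. A walk from the edge $j$ to the edge $j'$ is a sequence $\mathbf w=\{j,v_0,j_1,v_1,\dots,j_n,v_n,j'\}$,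 $n\ge0$, with $j_1,\dots,j_n\in\mathcal I$ such that, with $j_0:=j$ and $j_{n+1}:=j'$, each vertex $v_l$ is incident with $j_l$ and $j_{l+1}$, and $v_l\neq v_{l+1}$ for $0\le l<n$. Put $|\mathbf w|_{\rm comb}=n$, $|\mathbf w|=\sum_{l=1}^na_{j_l}$, $v_-(\mathbf w)=v_0$, $v_+(\mathbf w)=v_n$; the score of $\mathbf w$ is $\underline n(\mathbf w)\in\mathbb N_0^{\mathcal I}$, where $n_i(\mathbf w)$ is the number of $l\in\{1,\dots,n\}$ with $j_l=i$. For $x_j\in I_j$ let $\mathrm{dist}(x_j,v)=x_j$ if $v=\partial^-(j)$ and $a_j-x_j$ if $v=\partial^+(j)$. The weight of $\mathbf w$ is $$W_{\mathcal M}(\mathbf w)=\prod_{l=0}^{n}[\mathfrak S(A(v_l),B(v_l))]_{j_l,j_{l+1}}.$$ Then, for every $\mathsf k\in\mathbb C$ with $\operatorname{Im}\mathsf k>0$, the resolvent $(-\Delta(\mathcal M,\underline a)-\mathsf k^2)^{-1}$ exists as a bounded operator on $\mathcal H$ and has an integral kernel $[r_{\mathcal M}(x,y;\mathsf k,\underline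 a)]_{j,j'}$ that is continuous on every $I_j\times I_{j'}$ (the Green function), and every such kernel satisfies, for all edges $j,j'$ and all $x_j\in I_j$, $y_{j'}\in I_{j'}$, $$[r_{\mathcal M}(x,y;\mathsf k,\underline a)]_{j,j'}=\frac{i}{2\mathsf k}\delta_{j,j'}e^{i\mathsf k|x_j-y_j|}+\frac{i}{2\mathsf k}\sum_{\mathbf w}e^{i\mathsf k\,\mathrm{dist}(x_j,v_-(\mathbf w))}\,W_{\mathcal M}(\mathbf w)\,e^{i\mathsf k|\mathbf w|}\,e^{i\mathsf k\,\mathrm{dist}(y_{j'},v_+(\mathbf w))},$$ where the sum is over all walks $\mathbf w$ from $j$ to $j'$ and converges absolutely in the following sense. The set of walks from $j$ to $j'$ with a given score is finite, and so is the set of those with a given combinatorial length. The series of the finite sums over the walks of score $\underline n$, $\underline n\in\mathbb N_0^{\mathcal I}$, converges absolutely, and so does the series of the finite sums over the walks of combinatorial length $n$, $n\in\mathbb N_0$; the formula holds with either of these series. If $|\mathcal I|\,e^{-a_i\operatorname{Im}\mathsf k}<1$ for all $i\in\mathcal I$, then the series also converges absolutely walk by walk, and the formula holds for it. -/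

import Mathlib

open MeasureTheory

noncomputable section

namespace QuantumGraph

/-! ## Metric graphs -/

/-- A metric graph with vertices `V`, internal edges `I` and external edges `E`. The internal edge
`i` is the interval `[0, len i]`, with `0` at its initial and `len i` at its terminal vertex; an
external edge is the half line `[0, ∞)` with `0` at its only vertex. -/
structure MetricGraph (V I E : Type*) where
  initV : I → V
  termV : I → V
  extV : E → V
  len : I → ℝ
  len_pos : ∀ i, 0 < len i

/-- All edges of a graph, external and internal. -/
abbrev Edge (I E : Type*) := E ⊕ I

/-- The ends of the edges: one for each external edge, then the initial and then the terminal ends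
of the internal edges. Functions on this type form the boundary space `K = K_E ⊕ K_I⁻ ⊕ K_I⁺`. -/
abbrev EdgeEnd (I E : Type*) := E ⊕ (I ⊕ I)

/-- The space of pairs `K ⊕ K` for `K = ℂ^ι`. -/
abbrev Double (ι : Type*) := (ι → ℂ) × (ι → ℂ)

/-! ## Isotropic subspaces and the matrices `𝔖(k; A, B)` -/

section LinearAlgebra

variable {ι : Type*} [Fintype ι]

/-- The Hermitian symplectic form `ω(p, q) = ⟨p, J q⟩`, with `J (χ, χ') = (χ', -χ)`. -/
def symplForm (p q : Double ι) : ℂ := star p.1 ⬝ᵥ q.2 - star p.2 ⬝ᵥ q.1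

def IsIsotropic (M : Submodule ℂ (Double ι)) : Prop :=
  ∀ p ∈ M, ∀ q ∈ M, symplForm p q = 0

/-- An isotropic subspace that is not a proper subspace of an isotropic subspace. -/
def IsMaximalIsotropic (M : Submodule ℂ (Double ι)) : Prop :=
  IsIsotropic M ∧ ∀ N : Submodule ℂ (Double ι), IsIsotropic N → M ≤ N → N = M

/-- The subspace `M(A, B) = {(χ, χ') | A χ + B χ' = 0}`. -/
def pairKernel (A B : Matrix ι ι ℂ) : Submodule ℂ (Double ι) :=
  LinearMap.ker ((Matrix.mulVecLin A).coprod (Matrix.mulVecLin B))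

variable [DecidableEq ι]

/-- `𝔖(k; A, B) = -(A + i k B)⁻¹ (A - i k B)`. -/
def scatteringMatrix (k : ℂ) (A B : Matrix ι ι ℂ) : Matrix ι ι ℂ :=
  -((A + (Complex.I * k) • B)⁻¹ * (A - (Complex.I * k) • B))

/-- `𝔖(k; A, B)` is the same matrix for all `k > 0`. -/
def ScatteringConstant (A B : Matrix ι ι ℂ) : Prop :=
  ∀ k k' : ℝ, 0 < k → 0 < k' → scatteringMatrix (k : ℂ) A B = scatteringMatrix (k' : ℂ) A B

/-- `𝔖(k; A, B)` is self-adjoint for some `k > 0`. -/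
def ScatteringSelfAdjoint (A B : Matrix ι ι ℂ) : Prop :=
  ∃ k : ℝ, 0 < k ∧ (scatteringMatrix (k : ℂ) A B).IsHermitian

/-- `𝔖(k; A, B) = 1 - 2 P` for some `k > 0` and some orthogonal projection `P`. -/
def ScatteringReflection (A B : Matrix ι ι ℂ) : Prop :=
  ∃ k : ℝ, 0 < k ∧ ∃ P : Matrix ι ι ℂ, P.IsHermitian ∧ P * P = P ∧
    scatteringMatrix (k : ℂ) A B = 1 - (2 : ℂ) • P

end LinearAlgebra

/-! ## The differential expression on an interval -/

/-- `f` belongs to `L²(J)`, `f` and its derivative `f₁` are (locally) absolutely continuous on the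
closed interval `J ∋ 0` with left end `0`, and the a.e. derivative `f₂` of `f₁` is in `L²(J)`. -/
structure IsSobolevTwo (J : Set ℝ) (f f₁ f₂ : ℝ → ℂ) : Prop where
  memLp : MemLp f 2 (volume.restrict J)
  ac : ∀ b ∈ J, AbsolutelyContinuousOnInterval f 0 b
  hasDeriv : ∀ x ∈ J, HasDerivWithinAt f (f₁ x) J x
  ac_deriv : ∀ b ∈ J, AbsolutelyContinuousOnInterval f₁ 0 b
  hasDeriv₂ : ∀ᵐ x ∂(volume.restrict J), HasDerivAt f₁ (f₂ x) x
  memLp₂ : MemLp f₂ 2 (volume.restrict J)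

lemma isSobolevTwo_zero (J : Set ℝ) : IsSobolevTwo J 0 0 0 where
  memLp := MemLp.zero
  ac := fun b _ => by
    have h := (LipschitzWith.const (α := ℝ) (0 : ℂ)).lipschitzOnWith
      (s := Set.uIcc 0 b)
    exact h.absolutelyContinuousOnInterval
  hasDeriv := fun x _ => hasDerivWithinAt_const x J (0 : ℂ)
  ac_deriv := fun b _ => by
    have h := (LipschitzWith.const (α := ℝ) (0 : ℂ)).lipschitzOnWith
      (s := Set.uIcc 0 b)
    exact h.absolutelyContinuousOnInterval
  hasDeriv₂ := Filter.Eventually.of_forall fun x => hasDerivAt_const x (0 : ℂ)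
  memLp₂ := MemLp.zero

lemma IsSobolevTwo.add {J : Set ℝ} {f f₁ f₂ g g₁ g₂ : ℝ → ℂ} (hf : IsSobolevTwo J f f₁ f₂)
    (hg : IsSobolevTwo J g g₁ g₂) : IsSobolevTwo J (f + g) (f₁ + g₁) (f₂ + g₂) where
  memLp := hf.memLp.add hg.memLp
  ac := fun b hb => (hf.ac b hb).add (hg.ac b hb)
  hasDeriv := fun x hx => (hf.hasDeriv x hx).add (hg.hasDeriv x hx)
  ac_deriv := fun b hb => (hf.ac_deriv b hb).add (hg.ac_deriv b hb)
  hasDeriv₂ := by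
    filter_upwards [hf.hasDeriv₂, hg.hasDeriv₂] with x h1 h2 using h1.add h2
  memLp₂ := hf.memLp₂.add hg.memLp₂

lemma IsSobolevTwo.smul {J : Set ℝ} {f f₁ f₂ : ℝ → ℂ} (c : ℂ) (hf : IsSobolevTwo J f f₁ f₂) :
    IsSobolevTwo J (c • f) (c • f₁) (c • f₂) where
  memLp := hf.memLp.const_smul c
  ac := fun b hb => (hf.ac b hb).const_smul c
  hasDeriv := fun x hx => (hf.hasDeriv x hx).const_smul c
  ac_deriv := fun b hb => (hf.ac_deriv b hb).const_smul c
  hasDeriv₂ := by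
    filter_upwards [hf.hasDeriv₂] with x h1 using h1.const_smul c
  memLp₂ := hf.memLp₂.const_smul c

/-- If `f` vanishes a.e., so does its second derivative. -/
lemma IsSobolevTwo.ae_eq_zero {J : Set ℝ} {f f₁ f₂ : ℝ → ℂ} (hf : IsSobolevTwo J f f₁ f₂)
    (hJ : J ⊆ closure (interior J))
    (hi : ∀ᵐ x ∂(volume.restrict J), x ∈ interior J)
    (hz : f =ᵐ[volume.restrict J] fun _ => 0) : f₂ =ᵐ[volume.restrict J] fun _ => 0 := by
  have h0 : Set.EqOn f (fun _ => 0) J := Measure.eqOn_of_ae_eq hz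
    (fun x hx => (hf.hasDeriv x hx).continuousWithinAt) continuousOn_const hJ
  filter_upwards [hi, hf.hasDeriv₂] with x hx h2
  have h1 : ∀ y ∈ interior J, f₁ y = 0 := fun y hy => by
    have hn : J ∈ nhds y := mem_interior_iff_mem_nhds.mp hy
    have hd := (hf.hasDeriv y (interior_subset hy)).hasDerivAt hn
    refine hd.unique ((hasDerivAt_const y (0 : ℂ)).congr_of_eventuallyEq ?_)
    filter_upwards [hn] with t ht using h0 ht
  refine h2.unique ((hasDerivAt_const x (0 : ℂ)).congr_of_eventuallyEq ?_)
  filter_upwards [isOpen_interior.mem_nhds hx] with t ht using h1 t ht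

/-- `R` is the bounded inverse of `T - z`. -/
def IsResolventOf {H : Type*} [NormedAddCommGroup H] [NormedSpace ℂ H]
    (T : H →ₗ.[ℂ] H) (z : ℂ) (R : H →L[ℂ] H) : Prop :=
  (∀ ψ : T.domain, R (T ψ - z • (ψ : H)) = ψ) ∧
    ∀ φ : H, ∃ ψ : T.domain, (ψ : H) = R φ ∧ T ψ - z • (ψ : H) = φ

namespace MetricGraph

variable {V I E : Type*} (G : MetricGraph V I E)

/-- The interval of an edge. -/
def interval : Edge I E → Set ℝ
  | Sum.inl _ => Set.Ici 0
  | Sum.inr i => Set.Icc 0 (G.len i)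

lemma interval_subset (j : Edge I E) : G.interval j ⊆ closure (interior (G.interval j)) := by
  rcases j with e | i
  · simp [interval]
  · simp [interval, closure_Ioo (G.len_pos i).ne]

lemma interval_interior_ae (j : Edge I E) :
    ∀ᵐ x ∂(volume.restrict (G.interval j)), x ∈ interior (G.interval j) := by
  rcases j with e | i
  · simp only [interval, interior_Ici]
    rw [← restrict_Ioi_eq_restrict_Ici]
    exact ae_restrict_mem measurableSet_Ioi
  · simp only [interval, interior_Icc]
    rw [← restrict_Ioo_eq_restrict_Icc]
    exact ae_restrict_mem measurableSet_Ioo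

/-- The set of the vertices of an edge. -/
def ends : Edge I E → Set V
  | Sum.inl e => {G.extV e}
  | Sum.inr i => {G.initV i, G.termV i}

def IsTadpole (i : I) : Prop := G.initV i = G.termV i

/-- The vertex at an edge end. -/
def vertexOf : EdgeEnd I E → V
  | Sum.inl e => G.extV e
  | Sum.inr (Sum.inl i) => G.initV i
  | Sum.inr (Sum.inr i) => G.termV i

/-- The edge ends at the vertex `v`; they index the canonical basis of `L_v`. -/
abbrev EndsAt (v : V) := {h : EdgeEnd I E // G.vertexOf h = v}

/-- The end at `v` of an edge `j` that is incident with `v` (unique if `j` is not a tadpole). -/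
def endAt [DecidableEq V] (v : V) : (j : Edge I E) → v ∈ G.ends j → G.EndsAt v
  | Sum.inl e, h => ⟨Sum.inl e, (Set.mem_singleton_iff.mp h).symm⟩
  | Sum.inr i, h =>
      if h₀ : G.initV i = v then ⟨Sum.inr (Sum.inl i), h₀⟩
      else ⟨Sum.inr (Sum.inr i), (h.resolve_left fun h' => h₀ h'.symm).symm⟩

/-- Restriction of an element of `K ⊕ K` to the edge ends at `v`. -/
def restrictAt (v : V) : Double (EdgeEnd I E) →ₗ[ℂ] Double (G.EndsAt v) :=
  (LinearMap.funLeft ℂ ℂ (Subtype.val : G.EndsAt v → EdgeEnd I E)).prodMap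
    (LinearMap.funLeft ℂ ℂ (Subtype.val : G.EndsAt v → EdgeEnd I E))

/-- The orthogonal sum over all vertices of subspaces `N v` of `L_v ⊕ L_v`. -/
def vertexSum (N : ∀ v, Submodule ℂ (Double (G.EndsAt v))) :
    Submodule ℂ (Double (EdgeEnd I E)) :=
  ⨅ v, (N v).comap (G.restrictAt v)

/-! ## The Laplace operator and its Green function -/

/-- The Hilbert space `⨁_j L²(I_j)`. -/
abbrev HilbertSpace :=
  PiLp 2 fun j : Edge I E => Lp ℂ 2 (volume.restrict (G.interval j))

/-- The boundary values of a family of functions on the edges. -/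
def boundaryValue (f : Edge I E → ℝ → ℂ) : EdgeEnd I E → ℂ
  | Sum.inl e => f (Sum.inl e) 0
  | Sum.inr (Sum.inl i) => f (Sum.inr i) 0
  | Sum.inr (Sum.inr i) => f (Sum.inr i) (G.len i)

/-- The derivatives at the ends of the edges, in the direction away from the vertex; `f₁` is the
family of the derivatives. -/
def boundaryDeriv (f₁ : Edge I E → ℝ → ℂ) : EdgeEnd I E → ℂ
  | Sum.inl e => f₁ (Sum.inl e) 0
  | Sum.inr (Sum.inl i) => f₁ (Sum.inr i) 0
  | Sum.inr (Sum.inr i) => -f₁ (Sum.inr i) (G.len i)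

/-- The graph of the Laplace operator: the pairs `(ψ, ψ'')` where `ψ` is in the domain. -/
def laplacianGraph (M : Submodule ℂ (Double (EdgeEnd I E))) :
    Submodule ℂ (G.HilbertSpace × G.HilbertSpace) where
  carrier := {p | ∃ f f₁ f₂ : Edge I E → ℝ → ℂ,
    (∀ j, IsSobolevTwo (G.interval j) (f j) (f₁ j) (f₂ j)) ∧
    (∀ j, p.1 j =ᵐ[volume.restrict (G.interval j)] f j) ∧
    (∀ j, p.2 j =ᵐ[volume.restrict (G.interval j)] f₂ j) ∧
    (G.boundaryValue f, G.boundaryDeriv f₁) ∈ M}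
  zero_mem' := by
    refine ⟨0, 0, 0, fun j => isSobolevTwo_zero _, fun j => ?_, fun j => ?_, ?_⟩
    · exact Lp.coeFn_zero _ _ _
    · exact Lp.coeFn_zero _ _ _
    · convert M.zero_mem using 1
      ext h <;> rcases h with e | i | i <;> simp [boundaryValue, boundaryDeriv]
  add_mem' := by
    rintro p q ⟨f, f₁, f₂, hf, h1, h2, h3⟩ ⟨g, g₁, g₂, hg, k1, k2, k3⟩
    refine ⟨f + g, f₁ + g₁, f₂ + g₂, fun j => (hf j).add (hg j), fun j => ?_, fun j => ?_, ?_⟩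
    · exact (Lp.coeFn_add (p.1 j) (q.1 j)).trans ((h1 j).add (k1 j))
    · exact (Lp.coeFn_add (p.2 j) (q.2 j)).trans ((h2 j).add (k2 j))
    · convert M.add_mem h3 k3 using 1
      ext h <;> rcases h with e | i | i <;> simp [boundaryValue, boundaryDeriv, add_comm]
  smul_mem' := by
    rintro c p ⟨f, f₁, f₂, hf, h1, h2, h3⟩
    refine ⟨c • f, c • f₁, c • f₂, fun j => (hf j).smul c, fun j => ?_, fun j => ?_, ?_⟩
    · exact (Lp.coeFn_smul c (p.1 j)).trans ((h1 j).const_smul c)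
    · exact (Lp.coeFn_smul c (p.2 j)).trans ((h2 j).const_smul c)
    · convert M.smul_mem c h3 using 1
      ext h <;> rcases h with e | i | i <;> simp [boundaryValue, boundaryDeriv]

lemma laplacianGraph_functional (M : Submodule ℂ (Double (EdgeEnd I E)))
    (p : G.HilbertSpace × G.HilbertSpace) (hp : p ∈ G.laplacianGraph M) (h0 : p.1 = 0) :
    p.2 = 0 := by
  obtain ⟨f, f₁, f₂, hf, h1, h2, -⟩ := hp
  ext j : 1
  have hz : f j =ᵐ[volume.restrict (G.interval j)] fun _ => 0 := by
    refine (h1 j).symm.trans ?_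
    rw [h0]
    exact Lp.coeFn_zero _ _ _
  have := (h2 j).trans ((hf j).ae_eq_zero (G.interval_subset j)
    (G.interval_interior_ae j) hz)
  exact Lp.ext (this.trans (Lp.coeFn_zero _ _ _).symm)

/-- The operator `Δ(M, a)`: second derivative on each edge, on the domain of those functions whose
boundary values lie in `M`. -/
def laplacian (M : Submodule ℂ (Double (EdgeEnd I E))) :
    G.HilbertSpace →ₗ.[ℂ] G.HilbertSpace :=
  (G.laplacianGraph M).toLinearPMap

lemma laplacian_graph (M : Submodule ℂ (Double (EdgeEnd I E))) :
    (G.laplacian M).graph = G.laplacianGraph M :=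
  Submodule.toLinearPMap_graph_eq _ (G.laplacianGraph_functional M)

section Green

variable [Fintype I] [Fintype E]

/-- `K` is the operator with the integral kernel `r`, where `r j j' x y` is
the entry `(j, j')` at `x ∈ I_j`, `y ∈ I_j'`. -/
structure IsIntegralKernel (K : G.HilbertSpace →L[ℂ] G.HilbertSpace)
    (r : Edge I E → Edge I E → ℝ → ℝ → ℂ) : Prop where
  measurable : ∀ j j',
    Measurable ((G.interval j ×ˢ G.interval j').domRestrict (Function.uncurry (r j j')))
  integrable : ∀ (φ : G.HilbertSpace) (j j'), ∀ᵐ x ∂(volume.restrict (G.interval j)),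
    IntegrableOn (fun y => r j j' x y * φ j' y) (G.interval j')
  apply_eq : ∀ (φ : G.HilbertSpace) (j),
    K φ j =ᵐ[volume.restrict (G.interval j)]
      fun x => ∑ j', ∫ y in G.interval j', r j j' x y * φ j' y

/-- `r` is the Green function of `Δ(M, a)` at `k`: the continuous integral kernel of the resolvent
`(-Δ(M, a) - k²)⁻¹`. -/
def IsGreenFunction (M : Submodule ℂ (Double (EdgeEnd I E))) (k : ℂ)
    (r : Edge I E → Edge I E → ℝ → ℝ → ℂ) : Prop :=
  (∃ K : G.HilbertSpace →L[ℂ] G.HilbertSpace,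
    IsResolventOf (-G.laplacian M) (k ^ 2) K ∧ G.IsIntegralKernel K r) ∧
  ∀ j j', ContinuousOn (Function.uncurry (r j j')) (G.interval j ×ˢ G.interval j')

end Green

/-! ## Walks -/

/-- The sequence of edges `j, c 0, …, c (n - 1), j'`. -/
def walkEdges {n : ℕ} (j j' : Edge I E) (c : Fin n → I) : Fin (n + 2) → Edge I E :=
  Fin.cons (α := fun _ => Edge I E) j
    (Fin.snoc (α := fun _ => Edge I E) (fun l : Fin n => Sum.inr (c l)) j')

/-- A walk `{j, v₀, j₁, v₁, …, jₙ, vₙ, j'}` from `j` to `j'`, with `v_l = vert l` and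
`j_(l+1) = edge l`; here `n = length` is its combinatorial length, and `n = 0` gives the trivial
walks. Writing `j₀ = j` and `j_(n+1) = j'`, each `v_l` is incident with `j_l` and `j_(l+1)`. -/
structure Walk (j j' : Edge I E) where
  length : ℕ
  vert : Fin (length + 1) → V
  edge : Fin length → I
  mem_left : ∀ l : Fin (length + 1), vert l ∈ G.ends (walkEdges j j' edge l.castSucc)
  mem_right : ∀ l : Fin (length + 1), vert l ∈ G.ends (walkEdges j j' edge l.succ)
  eq_iff_tadpole : ∀ l : Fin length, vert l.castSucc = vert l.succ ↔ G.IsTadpole (edge l)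

namespace Walk

variable {G} {j j' : Edge I E}

/-- The vertex through which the walk leaves `j`. -/
def firstVertex (w : G.Walk j j') : V := w.vert 0

/-- The vertex through which the walk enters `j'`. -/
def lastVertex (w : G.Walk j j') : V := w.vert (Fin.last w.length)

/-- The metric length `|w|`. -/
def metricLength (w : G.Walk j j') : ℝ := ∑ l : Fin w.length, G.len (w.edge l)

/-- The score: how often the walk traverses each internal edge. -/
def score [DecidableEq I] (w : G.Walk j j') : I → ℕ :=
  fun i => (Finset.univ.filter fun l : Fin w.length => w.edge l = i).card

end Walk

/-- The distance of the point `x` of an edge (not a tadpole) from the incident vertex `v`. -/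
def dist [DecidableEq V] : Edge I E → ℝ → V → ℝ
  | Sum.inl _, x, _ => x
  | Sum.inr i, x, v => if v = G.initV i then x else G.len i - x

variable [Fintype I] [Fintype E] [DecidableEq V] [DecidableEq I] [DecidableEq E]

/-- The weight of a walk: the product over `l = 0, …, n` of the entries `(j_l, j_(l+1))` of
`𝔖(κ; A(v_l), B(v_l))`. -/
def weight (κ : ℂ) (A B : ∀ v, Matrix (G.EndsAt v) (G.EndsAt v) ℂ) {j j' : Edge I E}
    (w : G.Walk j j') : ℂ :=
  ∏ l : Fin (w.length + 1), scatteringMatrix κ (A (w.vert l)) (B (w.vert l))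
    (G.endAt (w.vert l) _ (w.mem_left l)) (G.endAt (w.vert l) _ (w.mem_right l))

/-- The contribution of a walk to the expansion of the Green function. -/
def walkTerm (κ : ℂ) (A B : ∀ v, Matrix (G.EndsAt v) (G.EndsAt v) ℂ) (k : ℂ) {j j' : Edge I E}
    (x y : ℝ) (w : G.Walk j j') : ℂ :=
  Complex.exp (Complex.I * k * (G.dist j x w.firstVertex : ℝ)) * G.weight κ A B w *
    Complex.exp (Complex.I * k * (w.metricLength : ℝ)) *
    Complex.exp (Complex.I * k * (G.dist j' y w.lastVertex : ℝ))

end MetricGraph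

end QuantumGraph

end

noncomputable section

namespace QuantumGraph

/-! Near an edge end a solution of `f'' = -k² f` is `α e^{-ikx} + β e^{ikx}`, where `x` is the
distance from the end; its boundary data are `(α + β, ik(β - α))`, with `α` arriving at the vertex
and `β` leaving it. In these coordinates `ω(p, p)` for real `κ > 0` is `2iκ(‖β‖² - ‖α‖²)`. Isotropy
therefore makes the scattering matrix an isometry and the boundary condition the equation `β = S α`.
Each of the four conditions in the hypothesis implies that `(χ, χ') ∈ M` entails `(χ, 0) ∈ M`; hence
`M` is invariant under scaling of `χ'`, and the same matrix `S`, computed at a real `κ`, describes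
the boundary condition at every complex `k ≠ 0` (`wave_mem_iff_of_scattering_condition`). By
locality `S` is block diagonal with the vertex matrices as blocks.

Let `Im k > 0`. A source `φ` on the edges produces the free wave `(i/2k) ∫ e^{ik|x-y|} φ(y) dy`,
which reaches the ends with some amplitudes `a`. To satisfy the boundary conditions, outgoing waves
with amplitudes `β` are added; these arrive at the opposite ends of the internal edges, multiplied
by the phases `e^{ik a_i}` (an operator `T`, `oppositeWave`). The condition becomes `β = S(a + Tβ)`.
It has at most one solution, because `S` is an isometry and the phases have modulus less than 1
(`eq_zero_of_eq_mulVec_oppositeWave`). A solution is `β = X a`, where `X` is the Neumann series `S +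
STS + …`, arranged by the score (`pathMatrix_eq`). An entry of a term of this series is a sum over
sequences of edge ends, and without tadpoles those with nonzero weight correspond to walks
(`finsum_score`).

The series has to converge for every `k` in the upper half plane although the number of walks may
grow exponentially. The point is `tsum_pathCoeff_sq_le`: since `S` is an isometry, the total weight
of all walks of one score between two given ends has modulus at most 1. The series over the scores
is then dominated by a product of geometric series. Grouping by length is a regrouping of this
series. Walk by walk only the individual weights are bounded by 1, and the edge sequences are
counted, whence the smallness condition on the phases.

It remains to see that the explicit kernel defines a bounded operator (Schur's test), that this
operator inverts `-Δ - k²`, and that a continuous kernel is determined by its operator. -/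

lemma double_eq_wave {ι : Type*} {κ : ℝ} (hκ : 0 < κ) (p : Double ι) : ∃ α β : ι → ℂ,
    p = (α + β, (Complex.I * (κ : ℂ)) • (β - α)) := by
  have hc : (κ : ℂ) ≠ 0 := by exact_mod_cast hκ.ne'
  refine ⟨(1 / 2 : ℂ) • (p.1 - (Complex.I * (κ : ℂ))⁻¹ • p.2),
    (1 / 2 : ℂ) • (p.1 + (Complex.I * (κ : ℂ))⁻¹ • p.2), ?_⟩
  ext h
  · simp; ring
  · simp only [Pi.smul_apply, Pi.sub_apply, Pi.add_apply, smul_eq_mul]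
    field_simp
    simp
    ring

/-! ### Isotropic subspaces in terms of incoming and outgoing amplitudes -/

section LinearAlgebra

variable {ι : Type*} [Fintype ι]

lemma star_dotProduct_self_eq (u : ι → ℂ) : star u ⬝ᵥ u = ((∑ h, ‖u h‖ ^ 2 : ℝ) : ℂ) := by
  simp [dotProduct, Complex.conj_mul']

/-- The form measures the net flux through the vertex: on the diagonal the cross terms between `α`
and `β` cancel. -/
lemma symplForm_wave (κ : ℝ) (α β : ι → ℂ) :
    symplForm (α + β, (Complex.I * κ) • (β - α)) (α + β, (Complex.I * κ) • (β - α)) =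
      2 * Complex.I * κ * ((∑ h, ‖β h‖ ^ 2 : ℝ) - (∑ h, ‖α h‖ ^ 2 : ℝ)) := by
  rw [← star_dotProduct_self_eq, ← star_dotProduct_self_eq]
  simp only [symplForm, star_add, star_smul, star_sub, add_dotProduct, sub_dotProduct,
    dotProduct_smul, smul_dotProduct, dotProduct_add, dotProduct_sub, smul_eq_mul, star_mul',
    Complex.star_def, Complex.conj_I, Complex.conj_ofReal]
  ring

lemma IsIsotropic.sum_sq_eq {N : Submodule ℂ (Double ι)} (hN : IsIsotropic N) {κ : ℝ}
    (hκ : 0 < κ) {α β : ι → ℂ} (h : (α + β, (Complex.I * κ) • (β - α)) ∈ N) :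
    ∑ h, ‖β h‖ ^ 2 = ∑ h, ‖α h‖ ^ 2 := by
  have h0 := hN _ h _ h
  rw [symplForm_wave] at h0
  have hc : (2 * Complex.I * κ : ℂ) ≠ 0 := by simp [hκ.ne']
  have := (mul_eq_zero.mp h0).resolve_left hc
  exact_mod_cast sub_eq_zero.mp this

lemma mem_pairKernel {A B : Matrix ι ι ℂ} {p : Double ι} :
    p ∈ pairKernel A B ↔ A.mulVec p.1 + B.mulVec p.2 = 0 := by
  simp [pairKernel]

variable [DecidableEq ι]

/-- A kernel vector `β` of `A + iκB` is a purely outgoing wave in the subspace; flux conservation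
forces `β = 0`. -/
lemma isUnit_det_of_isIsotropic {A B : Matrix ι ι ℂ} (hN : IsIsotropic (pairKernel A B)) {κ : ℝ}
    (hκ : 0 < κ) : IsUnit (A + (Complex.I * κ) • B).det := by
  rw [isUnit_iff_ne_zero]
  intro hdet
  obtain ⟨β, hβ, h0⟩ := Matrix.exists_mulVec_eq_zero_iff.mpr hdet
  apply hβ
  have hm : ((0 : ι → ℂ) + β, (Complex.I * (κ : ℂ)) • (β - 0)) ∈ pairKernel A B := by
    rw [mem_pairKernel]
    simpa [Matrix.add_mulVec, Matrix.smul_mulVec, Matrix.mulVec_smul] using h0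
  have := hN.sum_sq_eq hκ hm
  simp only [Pi.zero_apply, norm_zero, ne_eq, OfNat.ofNat_ne_zero, not_false_eq_true, zero_pow,
    Finset.sum_const_zero] at this
  rw [Finset.sum_eq_zero_iff_of_nonneg (fun _ _ => by positivity)] at this
  ext h
  simpa using this h (Finset.mem_univ h)

/-- The scattering matrix maps the incoming to the outgoing amplitudes. -/
lemma wave_mem_pairKernel_iff {A B : Matrix ι ι ℂ} (hN : IsIsotropic (pairKernel A B)) {κ : ℝ}
    (hκ : 0 < κ) (α β : ι → ℂ) :
    (α + β, (Complex.I * (κ : ℂ)) • (β - α)) ∈ pairKernel A B ↔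
      β = (scatteringMatrix κ A B).mulVec α := by
  have hu := isUnit_det_of_isIsotropic hN hκ
  have key : A.mulVec (α + β) + B.mulVec ((Complex.I * (κ : ℂ)) • (β - α)) =
      (A + (Complex.I * κ) • B).mulVec β + (A - (Complex.I * κ) • B).mulVec α := by
    simp only [Matrix.add_mulVec, Matrix.sub_mulVec, Matrix.smul_mulVec, Matrix.mulVec_smul,
      Matrix.mulVec_add, Matrix.mulVec_sub, smul_sub]
    abel
  rw [mem_pairKernel, key, scatteringMatrix]
  constructor
  · intro h
    have h1 := congrArg ((A + (Complex.I * κ) • B)⁻¹).mulVec h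
    rw [Matrix.mulVec_add, Matrix.mulVec_mulVec, Matrix.nonsing_inv_mul _ hu, Matrix.one_mulVec,
      Matrix.mulVec_zero, Matrix.mulVec_mulVec] at h1
    rw [Matrix.neg_mulVec]
    exact eq_neg_of_add_eq_zero_left h1
  · rintro rfl
    rw [Matrix.neg_mulVec, Matrix.mulVec_neg, Matrix.mulVec_mulVec, ← Matrix.mul_assoc,
      Matrix.mul_nonsing_inv _ hu, Matrix.one_mul]
    simp

/-- With `C = A + iκB`, the product `C S C†` equals `-(A A† - κ² B B†)` because the mixed terms
contain `A B†` or its adjoint. This is Hermitian, and the invertible factors `C` and `C†` cancel. -/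
lemma scatteringMatrix_isHermitian_of_mul_eq_zero {A B : Matrix ι ι ℂ}
    (hN : IsIsotropic (pairKernel A B)) (hAB : A * B.conjTranspose = 0) {κ : ℝ} (hκ : 0 < κ) :
    (scatteringMatrix κ A B).IsHermitian := by
  have hu := isUnit_det_of_isIsotropic hN hκ
  have hBA : B * A.conjTranspose = 0 := by
    have := congrArg Matrix.conjTranspose hAB
    simpa using this
  set C := A + (Complex.I * (κ : ℂ)) • B with hC
  have hCH : C.conjTranspose = A.conjTranspose - (Complex.I * (κ : ℂ)) • B.conjTranspose := by
    rw [hC, Matrix.conjTranspose_add, Matrix.conjTranspose_smul]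
    simp [sub_eq_add_neg]
  have h1 : C * scatteringMatrix κ A B * C.conjTranspose =
      -(A * A.conjTranspose - ((κ : ℂ) ^ 2) • (B * B.conjTranspose)) := by
    have : C * scatteringMatrix κ A B = -(A - (Complex.I * (κ : ℂ)) • B) := by
      rw [scatteringMatrix, ← hC, Matrix.mul_neg, ← Matrix.mul_assoc, Matrix.mul_nonsing_inv _ hu,
        Matrix.one_mul]
    rw [this, hCH]
    simp only [Matrix.neg_mul, Matrix.sub_mul, Matrix.mul_sub, Matrix.smul_mul, Matrix.mul_smul,
      hAB, hBA, smul_zero]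
    have : Complex.I * (κ : ℂ) * (Complex.I * κ) = -(κ : ℂ) ^ 2 := by
      linear_combination (κ : ℂ) ^ 2 * Complex.I_sq
    simp only [sub_zero, zero_sub, smul_smul, this, neg_smul, neg_neg]
    abel
  have h2 : C * (scatteringMatrix κ A B).conjTranspose * C.conjTranspose =
      C * scatteringMatrix κ A B * C.conjTranspose := by
    have := congrArg Matrix.conjTranspose h1
    rw [Matrix.conjTranspose_mul, Matrix.conjTranspose_mul, Matrix.conjTranspose_conjTranspose,
      ← Matrix.mul_assoc] at this
    rw [this, h1]
    simp
  have huH : IsUnit C.conjTranspose := (Matrix.isUnit_iff_isUnit_det _).mpr hu |>.star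
  have huC : IsUnit C := (Matrix.isUnit_iff_isUnit_det _).mpr hu
  exact huC.mul_left_cancel (huH.mul_right_cancel h2)

/-- If the matrix `𝔖(k; A, B)` is independent of `k`, in any of the four forms of this condition,
the subspace `M(A, B)` is the sum of its components. -/
lemma fst_mem_of_scattering_condition {A B : Matrix ι ι ℂ} (hN : IsIsotropic (pairKernel A B))
    (hindep : ScatteringConstant A B ∨ ScatteringSelfAdjoint A B ∨
      ScatteringReflection A B ∨ A * B.conjTranspose = 0)
    {p : Double ι} (hp : p ∈ pairKernel A B) : (p.1, (0 : ι → ℂ)) ∈ pairKernel A B := by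
  rcases hindep with hc | hs
  -- If `β = S α` with the same `S` at `κ = 1` and `κ = 2`, the subspace contains `(α + β, i(β -
  -- α))` and `(α + β, 2i(β - α))`; twice the first minus the second is `(α + β, 0)`.
  · obtain ⟨α, β, rfl⟩ := double_eq_wave one_pos p
    rw [wave_mem_pairKernel_iff hN one_pos, hc 1 2 one_pos two_pos] at hp
    have h2 := (wave_mem_pairKernel_iff hN two_pos α β).mpr hp
    rw [← hc 1 2 one_pos two_pos] at hp
    have h1 := (wave_mem_pairKernel_iff hN one_pos α β).mpr hp
    convert Submodule.sub_mem _ (Submodule.smul_mem _ (2 : ℂ) h1) h2 using 1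
    ext h
    · simp; ring
    · simp; ring
  · have hs : ScatteringSelfAdjoint A B := by
      rcases hs with hs | ⟨κ, hκ, P, hP, -, hS⟩ | h0
      · exact hs
      · refine ⟨κ, hκ, ?_⟩
        rw [hS]
        refine Matrix.isHermitian_one.sub ?_
        rw [Matrix.IsHermitian, Matrix.conjTranspose_smul, hP.eq]
        simp
      · exact ⟨1, one_pos, scatteringMatrix_isHermitian_of_mul_eq_zero hN h0 one_pos⟩
    obtain ⟨κ, hκ, hS⟩ := hs
    obtain ⟨α, β, rfl⟩ := double_eq_wave hκ p
    set S := scatteringMatrix κ A B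
    have hβ := (wave_mem_pairKernel_iff hN hκ _ _).mp hp
    have hnorm : ∀ u, star (S.mulVec u) ⬝ᵥ (S.mulVec u) = star u ⬝ᵥ u := fun u => by
      have h := (wave_mem_pairKernel_iff hN hκ u (S.mulVec u)).mpr rfl
      rw [star_dotProduct_self_eq, star_dotProduct_self_eq, hN.sum_sq_eq hκ h]
    -- A self-adjoint isometry is an involution: expand `‖S S α - α‖²`.
    have hSS : S.mulVec (S.mulVec α) = α := by
      have hsymm : ∀ u w, star (S.mulVec u) ⬝ᵥ w = star u ⬝ᵥ S.mulVec w := fun u w => by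
        rw [Matrix.star_mulVec, hS.eq, Matrix.dotProduct_mulVec]
      have h0 : star (S.mulVec (S.mulVec α) - α) ⬝ᵥ (S.mulVec (S.mulVec α) - α) = 0 := by
        rw [star_sub, sub_dotProduct, dotProduct_sub, dotProduct_sub, hnorm, hnorm,
          hsymm, hnorm, ← hsymm, hnorm]
        ring
      rw [star_dotProduct_self_eq] at h0
      have h0' := (Finset.sum_eq_zero_iff_of_nonneg (fun _ _ => by positivity)).mp
        (Complex.ofReal_eq_zero.mp h0)
      ext h
      simpa [sub_eq_zero] using h0' h (Finset.mem_univ h)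
    -- Since `S` is an involution, `α` and `β` may be interchanged. This reverses the sign of the
    -- second component, so the mean of the two pairs has second component 0.
    have h1 := (wave_mem_pairKernel_iff hN hκ β α).mpr (by rw [hβ, hSS])
    convert Submodule.smul_mem _ (1 / 2 : ℂ) (Submodule.add_mem _ hp h1) using 1
    ext h
    · simp; ring
    · simp; ring

end LinearAlgebra

/-! ### Assembling the vertex matrices into one scattering matrix -/

namespace MetricGraph

variable {V I E : Type*} (G : MetricGraph V I E)

lemma mem_vertexSum {N : ∀ v, Submodule ℂ (Double (G.EndsAt v))} {p : Double (EdgeEnd I E)} :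
    p ∈ G.vertexSum N ↔ ∀ v, G.restrictAt v p ∈ N v := by
  simp [vertexSum]

variable [Fintype I] [Fintype E] [DecidableEq V] [DecidableEq I] [DecidableEq E]

/-- The block matrix on the edge ends with the blocks `𝔖(κ; A(v), B(v))`. -/
def vertexScattering (κ : ℂ) (A B : ∀ v, Matrix (G.EndsAt v) (G.EndsAt v) ℂ) :
    Matrix (EdgeEnd I E) (EdgeEnd I E) ℂ := fun h h' =>
  if e : G.vertexOf h' = G.vertexOf h then
    scatteringMatrix κ (A (G.vertexOf h)) (B (G.vertexOf h)) ⟨h, rfl⟩ ⟨h', e⟩ else 0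

lemma vertexScattering_apply {κ : ℂ} {A B : ∀ v, Matrix (G.EndsAt v) (G.EndsAt v) ℂ} {v : V}
    (h h' : G.EndsAt v) :
    G.vertexScattering κ A B h h' = scatteringMatrix κ (A v) (B v) h h' := by
  obtain ⟨h, rfl⟩ := h
  obtain ⟨h', hh⟩ := h'
  simp [vertexScattering, hh]

lemma vertexScattering_of_ne {κ : ℂ} {A B : ∀ v, Matrix (G.EndsAt v) (G.EndsAt v) ℂ}
    {h h' : EdgeEnd I E} (hne : G.vertexOf h ≠ G.vertexOf h') :
    G.vertexScattering κ A B h h' = 0 := by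
  simp [vertexScattering, hne.symm]

lemma vertexScattering_mulVec {κ : ℂ} {A B : ∀ v, Matrix (G.EndsAt v) (G.EndsAt v) ℂ} {v : V}
    (α : EdgeEnd I E → ℂ) (h : G.EndsAt v) :
    (G.vertexScattering κ A B).mulVec α h =
      (scatteringMatrix κ (A v) (B v)).mulVec (fun g => α g) h := by
  simp only [Matrix.mulVec, dotProduct]
  rw [← Fintype.sum_subtype_add_sum_subtype (fun g => G.vertexOf g = v)]
  conv_rhs => rw [← add_zero (∑ i, _)]
  congr 1
  · exact Finset.sum_congr rfl fun g _ => by rw [vertexScattering_apply]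
  · refine Finset.sum_eq_zero fun g _ => ?_
    rw [vertexScattering_of_ne, zero_mul]
    rw [h.2]
    exact fun h' => g.2 h'.symm

lemma wave_mem_vertexSum_iff {A B : ∀ v, Matrix (G.EndsAt v) (G.EndsAt v) ℂ}
    (hN : ∀ v, IsIsotropic (pairKernel (A v) (B v))) {κ : ℝ} (hκ : 0 < κ)
    (α β : EdgeEnd I E → ℂ) :
    (α + β, (Complex.I * (κ : ℂ)) • (β - α)) ∈ G.vertexSum (fun v => pairKernel (A v) (B v)) ↔
      β = (G.vertexScattering κ A B).mulVec α := by
  rw [mem_vertexSum]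
  have : ∀ v, G.restrictAt v (α + β, (Complex.I * (κ : ℂ)) • (β - α)) =
      ((fun h : G.EndsAt v => α h) + (fun h : G.EndsAt v => β h), (Complex.I * (κ : ℂ)) •
        ((fun h : G.EndsAt v => β h) - (fun h : G.EndsAt v => α h))) := fun v => rfl
  simp_rw [this, wave_mem_pairKernel_iff (hN _) hκ]
  constructor
  · intro H
    ext h
    have := congrFun (H (G.vertexOf h)) ⟨h, rfl⟩
    rw [← vertexScattering_mulVec] at this
    exact this
  · rintro rfl v
    ext h
    exact G.vertexScattering_mulVec α h

/-- Boundary conditions that do not depend on the energy, in terms of amplitudes. -/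
lemma wave_mem_iff_of_scattering_condition {M : Submodule ℂ (Double (EdgeEnd I E))}
    (hM : IsIsotropic M)
    {A B : Matrix (EdgeEnd I E) (EdgeEnd I E) ℂ} (hAB : M = pairKernel A B)
    (hindep : ScatteringConstant A B ∨ ScatteringSelfAdjoint A B ∨
      ScatteringReflection A B ∨ A * B.conjTranspose = 0)
    {Av Bv : ∀ v, Matrix (G.EndsAt v) (G.EndsAt v) ℂ}
    (hvertex : ∀ v, IsIsotropic (pairKernel (Av v) (Bv v)))
    (hlocal : M = G.vertexSum fun v => pairKernel (Av v) (Bv v))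
    {κ : ℝ} (hκ : 0 < κ) {k : ℂ} (hk : k ≠ 0) (α β : EdgeEnd I E → ℂ) :
    (α + β, (Complex.I * k) • (β - α)) ∈ M ↔ β = (G.vertexScattering κ Av Bv).mulVec α := by
  rw [← G.wave_mem_vertexSum_iff hvertex hκ, ← hlocal]
  -- The subspace is the sum of its two components, so the second component may be rescaled freely.
  -- The factors `κ / k` and `k / κ` move the condition between the energy parameters `k` and `κ`.
  have key : ∀ (c : ℂ) (p : Double (EdgeEnd I E)), p ∈ M → (p.1, c • p.2) ∈ M := by
    intro c p h
    have h1 : (p.1, (0 : EdgeEnd I E → ℂ)) ∈ M := by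
      subst hAB
      exact fst_mem_of_scattering_condition hM hindep h
    have e : (p.1, c • p.2) = c • (p - (p.1, (0 : EdgeEnd I E → ℂ))) + (p.1, 0) := by
      ext <;> simp
    rw [e]
    exact M.add_mem (M.smul_mem c (M.sub_mem h h1)) h1
  have hκ' : (κ : ℂ) ≠ 0 := by exact_mod_cast hκ.ne'
  have e₁ : (κ / k : ℂ) * (Complex.I * k) = Complex.I * κ := by field_simp
  have e₂ : (k / κ : ℂ) * (Complex.I * κ) = Complex.I * k := by field_simp
  constructor <;> intro h
  · have := key (κ / k : ℂ) _ h
    rwa [smul_smul, e₁] at this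
  · have := key (k / κ : ℂ) _ h
    rwa [smul_smul, e₂] at this

end MetricGraph

/-! ### Sums over paths of a given score and their convergence -/

section PathCoefficients

open scoped ENNReal

variable {I E : Type*} [Fintype I] [Fintype E] [DecidableEq I]

/-- The internal edge to which an end belongs. -/
def endIdx {I : Type*} : I ⊕ I → I := Sum.elim id id

@[simp] lemma endIdx_swap {I : Type*} (g : I ⊕ I) : endIdx g.swap = endIdx g := by
  rcases g with i | i <;> rfl

/-- The sum of the products of entries of `S` over the paths of length `m` and score `n` between
two edge ends, computed recursively. -/
def pathCoeff (S : Matrix (EdgeEnd I E) (EdgeEnd I E) ℂ) :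
    ℕ → (I → ℕ) → EdgeEnd I E → EdgeEnd I E → ℂ
  | 0, n, h, h' => if n = 0 then S h h' else 0
  | m + 1, n, h, h' => ∑ g : I ⊕ I, S h (Sum.inr g) *
      (if 0 < n (endIdx g) then
        pathCoeff S m (n - Pi.single (endIdx g) 1) (Sum.inr g.swap) h' else 0)

lemma sum_enorm_sq_mulVec {ι : Type*} [Fintype ι] {S : Matrix ι ι ℂ}
    (hS : ∀ u, ∑ h, ‖S.mulVec u h‖ ^ 2 = ∑ h, ‖u h‖ ^ 2) (u : ι → ℂ) :
    ∑ h, ‖S.mulVec u h‖ₑ ^ 2 = ∑ h, ‖u h‖ₑ ^ 2 := by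
  have e : ∀ w : ι → ℂ, ∑ h, ‖w h‖ₑ ^ 2 = ENNReal.ofReal (∑ h, ‖w h‖ ^ 2) := fun w => by
    rw [ENNReal.ofReal_sum_of_nonneg fun _ _ => by positivity]
    refine Finset.sum_congr rfl fun h _ => ?_
    rw [ENNReal.ofReal_pow (norm_nonneg _), ofReal_norm]
  rw [e, e, hS]

lemma sub_single_add_single {I : Type*} [DecidableEq I] {n : I → ℕ} {i : I} (h : 0 < n i) :
    n - Pi.single i 1 + Pi.single i 1 = n := by
  ext a
  by_cases ha : a = i
  · subst ha; simp; omega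
  · simp [ha]

lemma tsum_shift_le {I : Type*} [DecidableEq I] (i : I) (F : (I → ℕ) → ℝ≥0∞) :
    ∑' n : I → ℕ, (if 0 < n i then F (n - Pi.single i 1) else 0) ≤ ∑' n, F n := by
  have hinj : Function.Injective fun n : I → ℕ => n + Pi.single i 1 := fun a b h => by
    simpa using h
  rw [← hinj.tsum_eq]
  · refine ENNReal.tsum_le_tsum fun n => ?_
    simp
  · intro n hn
    have h0 : 0 < n i := by
      by_contra h0
      simp [h0] at hn
    exact ⟨_, sub_single_add_single h0⟩

/-- For fixed `n`, the column of coefficients of length `m + 1` is `S` applied to a vector of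
coefficients of length `m` with the score lowered along the edge just crossed. The isometry `S`
preserves its norm, and summation over all `n` undoes the shifts of the score, so the total does not
grow with `m`. It is the simultaneous sum over all scores that makes the induction close. -/
lemma tsum_pathCoeff_sq_le [DecidableEq E] {S : Matrix (EdgeEnd I E) (EdgeEnd I E) ℂ}
    (hS : ∀ u, ∑ h, ‖S.mulVec u h‖ ^ 2 = ∑ h, ‖u h‖ ^ 2) (h' : EdgeEnd I E) (m : ℕ) :
    ∑' n, ∑ h, ‖pathCoeff S m n h h'‖ₑ ^ 2 ≤ 1 := by
  induction m with
  | zero =>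
    rw [tsum_eq_single 0]
    · have := sum_enorm_sq_mulVec hS (Pi.single h' 1)
      simp only [pathCoeff, if_true]
      simp only [Matrix.mulVec_single_one, Matrix.col_apply] at this
      rw [this, Finset.sum_eq_single h']
      · simp
      · intro b _ hb; simp [hb]
      · simp
    · intro n hn
      simp [pathCoeff, hn]
  | succ m ih =>
    refine le_trans ?_ ih
    have key : ∀ n, ∑ h, ‖pathCoeff S (m + 1) n h h'‖ₑ ^ 2 = ∑ g : I ⊕ I,
        (if 0 < n (endIdx g) then
          ‖pathCoeff S m (n - Pi.single (endIdx g) 1) (Sum.inr g.swap) h'‖ₑ ^ 2 else 0) := by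
      intro n
      -- The vector is extended by zero to the external ends: a wave that has left along an external
      -- edge does not return.
      have := sum_enorm_sq_mulVec hS (Sum.elim 0 fun g : I ⊕ I =>
        (if 0 < n (endIdx g) then
          pathCoeff S m (n - Pi.single (endIdx g) 1) (Sum.inr g.swap) h' else 0))
      rw [Fintype.sum_sum_type (f := fun h => ‖Sum.elim (0 : E → ℂ) _ h‖ₑ ^ 2)] at this
      simp only [Sum.elim_inl, Sum.elim_inr, Pi.zero_apply, enorm_zero, ne_eq, OfNat.ofNat_ne_zero,
        not_false_eq_true, zero_pow, Finset.sum_const_zero, zero_add] at this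
      convert this using 3 with h _ g
      · rw [Matrix.mulVec, dotProduct, Fintype.sum_sum_type]
        simp only [pathCoeff, Sum.elim_inl, Sum.elim_inr, Pi.zero_apply, mul_zero,
          Finset.sum_const_zero, zero_add]
      · split_ifs <;> simp
    simp_rw [key]
    rw [Summable.tsum_finsetSum fun _ _ => ENNReal.summable]
    calc _ ≤ ∑ g : I ⊕ I, ∑' n, ‖pathCoeff S m n (Sum.inr g.swap) h'‖ₑ ^ 2 :=
          Finset.sum_le_sum fun g _ => tsum_shift_le (endIdx g)
            fun n => ‖pathCoeff S m n (Sum.inr g.swap) h'‖ₑ ^ 2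
      _ = ∑' n, ∑ g : I ⊕ I, ‖pathCoeff S m n (Sum.inr g) h'‖ₑ ^ 2 := by
          rw [Summable.tsum_finsetSum fun _ _ => ENNReal.summable]
          exact Fintype.sum_equiv (Equiv.sumComm I I) _ _ fun g => rfl
      _ ≤ _ := by
          refine ENNReal.tsum_le_tsum fun n => ?_
          rw [Fintype.sum_sum_type (f := fun h => ‖pathCoeff S m n h h'‖ₑ ^ 2)]
          exact le_add_self

lemma norm_pathCoeff_le_one [DecidableEq E] {S : Matrix (EdgeEnd I E) (EdgeEnd I E) ℂ}
    (hS : ∀ u, ∑ h, ‖S.mulVec u h‖ ^ 2 = ∑ h, ‖u h‖ ^ 2) (m : ℕ) (n : I → ℕ)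
    (h h' : EdgeEnd I E) : ‖pathCoeff S m n h h'‖ ≤ 1 := by
  have h1 : ‖pathCoeff S m n h h'‖ₑ ^ 2 ≤ 1 :=
    ((Finset.single_le_sum (f := fun h => ‖pathCoeff S m n h h'‖ₑ ^ 2) (fun _ _ => zero_le)
      (Finset.mem_univ h)).trans (ENNReal.le_tsum n)).trans (tsum_pathCoeff_sq_le hS h' m)
  have h2 : ‖pathCoeff S m n h h'‖ₑ ≤ 1 := by
    by_contra hc
    exact absurd h1 (not_le.mpr (one_lt_pow₀ (not_le.mp hc) two_ne_zero))
  rw [← ofReal_norm] at h2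
  exact ENNReal.ofReal_le_one.mp h2

/-- A finite set of scores lies in a cube, and the sum over a cube factors into partial geometric
sums. -/
lemma summable_prod_pow {r : I → ℝ} (h0 : ∀ i, 0 ≤ r i) (h1 : ∀ i, r i < 1) :
    Summable fun n : I → ℕ => ∏ i, r i ^ n i := by
  refine summable_of_sum_le (c := ∏ i, (1 - r i)⁻¹)
    (fun n => Finset.prod_nonneg fun i _ => pow_nonneg (h0 i) _) fun s => ?_
  obtain ⟨N, hN⟩ : ∃ N : ℕ, ∀ n ∈ s, ∀ i, n i < N := by
    refine ⟨(s.sup fun n => ∑ i, n i) + 1, fun n hn i => Nat.lt_succ_of_le ?_⟩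
    exact (Finset.single_le_sum (fun _ _ => Nat.zero_le _) (Finset.mem_univ i)).trans
      (Finset.le_sup (f := fun n : I → ℕ => ∑ i, n i) hn)
  calc ∑ n ∈ s, ∏ i, r i ^ n i
      ≤ ∑ n ∈ Fintype.piFinset fun _ : I => Finset.range N, ∏ i, r i ^ n i :=
        Finset.sum_le_sum_of_subset_of_nonneg
          (fun n hn => Fintype.mem_piFinset.mpr fun i => Finset.mem_range.mpr (hN n hn i))
          fun n _ _ => Finset.prod_nonneg fun i _ => pow_nonneg (h0 i) _
    _ = ∏ i, ∑ m ∈ Finset.range N, r i ^ m := (Finset.prod_univ_sum _ _).symm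
    _ ≤ ∏ i, (1 - r i)⁻¹ := by
        refine Finset.prod_le_prod (fun i _ => Finset.sum_nonneg fun m _ => pow_nonneg (h0 i) _)
          fun i _ => ?_
        rw [← tsum_geometric_of_lt_one (h0 i) (h1 i)]
        exact (summable_geometric_of_lt_one (h0 i) (h1 i)).sum_le_tsum _
          fun m _ => pow_nonneg (h0 i) _

/-- The sum over all paths of a given score. -/
def scoreTerm (S : Matrix (EdgeEnd I E) (EdgeEnd I E) ℂ) (z : I → ℂ) (n : I → ℕ)
    (h h' : EdgeEnd I E) : ℂ :=
  pathCoeff S (∑ i, n i) n h h' * ∏ i, z i ^ n i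

lemma summable_norm_scoreTerm [DecidableEq E] {S : Matrix (EdgeEnd I E) (EdgeEnd I E) ℂ}
    (hS : ∀ u, ∑ h, ‖S.mulVec u h‖ ^ 2 = ∑ h, ‖u h‖ ^ 2) {z : I → ℂ} (hz : ∀ i, ‖z i‖ < 1)
    (h h' : EdgeEnd I E) : Summable fun n => ‖scoreTerm S z n h h'‖ := by
  refine Summable.of_nonneg_of_le (fun _ => norm_nonneg _) (fun n => ?_)
    (summable_prod_pow (fun i => norm_nonneg (z i)) hz)
  rw [scoreTerm, norm_mul, norm_prod]
  simp_rw [norm_pow]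
  exact mul_le_of_le_one_left (Finset.prod_nonneg fun i _ => by positivity)
    (norm_pathCoeff_le_one hS _ _ _ _)

/-- The sum over all paths between two edge ends. -/
def pathMatrix (S : Matrix (EdgeEnd I E) (EdgeEnd I E) ℂ) (z : I → ℂ) :
    Matrix (EdgeEnd I E) (EdgeEnd I E) ℂ := fun h h' => ∑' n, scoreTerm S z n h h'

/-- The equation `X = S + S T X` score by score. A nonempty path first crosses the edge of some `g`
and continues from the opposite end `g.swap` with the remaining score. -/
lemma scoreTerm_eq (S : Matrix (EdgeEnd I E) (EdgeEnd I E) ℂ) (z : I → ℂ) (n : I → ℕ)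
    (h h' : EdgeEnd I E) : scoreTerm S z n h h' = (if n = 0 then S h h' else 0) +
      ∑ g : I ⊕ I, S h (Sum.inr g) * (z (endIdx g) * (if 0 < n (endIdx g) then
        scoreTerm S z (n - Pi.single (endIdx g) 1) (Sum.inr g.swap) h' else 0)) := by
  by_cases hn : n = 0
  · subst hn
    simp [scoreTerm, pathCoeff]
  · obtain ⟨m, hm⟩ : ∃ m, ∑ i, n i = m + 1 := by
      refine Nat.exists_eq_succ_of_ne_zero fun h0 => hn ?_
      ext i
      simpa using (Finset.sum_eq_zero_iff.mp h0) i (Finset.mem_univ i)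
    rw [if_neg hn, zero_add, scoreTerm, hm, pathCoeff, Finset.sum_mul]
    refine Finset.sum_congr rfl fun g _ => ?_
    split_ifs with hg
    · have hs := sub_single_add_single hg
      have h1 : ∑ i, (n - Pi.single (endIdx g) 1 : I → ℕ) i = m := by
        have := congrArg (fun f : I → ℕ => ∑ i, f i) hs
        simp only [Pi.add_apply, Finset.sum_add_distrib, hm, Finset.sum_pi_single',
          Finset.mem_univ, if_true] at this
        simpa using this
      have h2 : ∏ i, z i ^ n i =
          (∏ i, z i ^ (n - Pi.single (endIdx g) 1 : I → ℕ) i) * z (endIdx g) := by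
        conv_lhs => rw [← hs]
        simp only [Pi.add_apply, pow_add, Finset.prod_mul_distrib]
        congr 1
        rw [Finset.prod_eq_single (endIdx g)]
        · simp
        · intro b _ hb; simp [hb]
        · simp
      rw [scoreTerm, h1, h2]
      ring
    · simp

/-- The sum over all paths solves the equation for the amplitudes. -/
lemma pathMatrix_eq [DecidableEq E] {S : Matrix (EdgeEnd I E) (EdgeEnd I E) ℂ}
    (hS : ∀ u, ∑ h, ‖S.mulVec u h‖ ^ 2 = ∑ h, ‖u h‖ ^ 2) {z : I → ℂ} (hz : ∀ i, ‖z i‖ < 1)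
    (h h' : EdgeEnd I E) : pathMatrix S z h h' = S h h' +
      ∑ g : I ⊕ I, S h (Sum.inr g) * (z (endIdx g) * pathMatrix S z (Sum.inr g.swap) h') := by
  have hsum : ∀ h, HasSum (fun n => scoreTerm S z n h h') (pathMatrix S z h h') := fun h =>
    (summable_norm_scoreTerm hS hz h h').of_norm.hasSum
  have hshift : ∀ g : I ⊕ I, HasSum (fun n : I → ℕ => if 0 < n (endIdx g) then
      scoreTerm S z (n - Pi.single (endIdx g) 1) (Sum.inr g.swap) h' else 0)
      (pathMatrix S z (Sum.inr g.swap) h') := fun g => by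
    have hinj : Function.Injective fun n : I → ℕ => n + Pi.single (endIdx g) 1 := fun a b h => by
      simpa using h
    rw [← hinj.hasSum_iff]
    · convert hsum (Sum.inr g.swap) using 1
      ext n
      simp
    · intro n hn
      rw [if_neg]
      exact fun h0 => hn ⟨_, sub_single_add_single h0⟩
  have h1 : HasSum (fun n : I → ℕ => if n = 0 then S h h' else 0) (S h h') := by
    convert hasSum_ite_eq (0 : I → ℕ) (S h h')
  have h2 := h1.add (hasSum_sum fun g (_ : g ∈ Finset.univ) =>
    ((hshift g).mul_left (z (endIdx g))).mul_left (S h (Sum.inr g)))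
  refine (hsum h).unique ?_
  convert h2 using 1
  ext n
  exact scoreTerm_eq S z n h h'

end PathCoefficients

/-! ### Paths as explicit sequences of edge ends -/

/-- The edge to which an edge end belongs. -/
def edgeOf {I E : Type*} : EdgeEnd I E → Edge I E
  | Sum.inl e => Sum.inl e
  | Sum.inr g => Sum.inr (endIdx g)

@[simp] lemma edgeOf_inr {I E : Type*} (g : I ⊕ I) :
    edgeOf (Sum.inr g : EdgeEnd I E) = Sum.inr (endIdx g) := rfl

/-- The ends from which a path leaves the vertices it visits, backwards in time. -/
def pathLeft {I E : Type*} {m : ℕ} (h : EdgeEnd I E) (g : Fin m → I ⊕ I) :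
    Fin (m + 1) → EdgeEnd I E :=
  Fin.cons (α := fun _ => EdgeEnd I E) h fun l => Sum.inr (g l).swap

/-- The ends by which a path enters the vertices it visits, backwards in time. -/
def pathRight {I E : Type*} {m : ℕ} (g : Fin m → I ⊕ I) (h' : EdgeEnd I E) :
    Fin (m + 1) → EdgeEnd I E :=
  Fin.snoc (α := fun _ => EdgeEnd I E) (fun l => Sum.inr (g l)) h'

/-- The product of the entries of `S` along a path. -/
def pathProd {I E : Type*} (S : Matrix (EdgeEnd I E) (EdgeEnd I E) ℂ) {m : ℕ} (h : EdgeEnd I E)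
    (g : Fin m → I ⊕ I) (h' : EdgeEnd I E) : ℂ :=
  ∏ l : Fin (m + 1), S (pathLeft h g l) (pathRight g h' l)

/-- How often each internal edge occurs in a path. -/
def pathScore {I : Type*} [DecidableEq I] {m : ℕ} (g : Fin m → I ⊕ I) : I → ℕ :=
  fun i => (Finset.univ.filter fun l => endIdx (g l) = i).card

section

variable {I E : Type*} [DecidableEq I]

lemma pathScore_cons {m : ℕ} (g₀ : I ⊕ I) (g : Fin m → I ⊕ I) :
    pathScore (Fin.cons (α := fun _ => I ⊕ I) g₀ g) = pathScore g + Pi.single (endIdx g₀) 1 := by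
  ext i
  simp only [pathScore, Finset.card_filter, Fin.sum_univ_succ, Fin.cons_zero, Fin.cons_succ,
    Pi.add_apply, Pi.single_apply]
  rw [add_comm]
  congr 1
  simp [eq_comm]

lemma pathProd_cons {I E : Type*} (S : Matrix (EdgeEnd I E) (EdgeEnd I E) ℂ) {m : ℕ}
    (h : EdgeEnd I E) (g₀ : I ⊕ I) (g : Fin m → I ⊕ I) (h' : EdgeEnd I E) :
    pathProd S h (Fin.cons (α := fun _ => I ⊕ I) g₀ g) h' =
      S h (Sum.inr g₀) * pathProd S (Sum.inr g₀.swap) g h' := by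
  have hr : pathRight (E := E) (Fin.cons (α := fun _ => I ⊕ I) g₀ g) h' =
      Fin.cons (α := fun _ => EdgeEnd I E) (Sum.inr g₀) (pathRight g h') := by
    rw [pathRight, pathRight, Fin.cons_snoc_eq_snoc_cons]
    congr 1
    ext l
    refine Fin.cases ?_ (fun l => ?_) l <;> simp
  rw [pathProd, Fin.prod_univ_succ, hr]
  congr 1
  refine Finset.prod_congr rfl fun l _ => ?_
  rw [Fin.cons_succ, pathLeft, Fin.cons_succ]
  congr 1
  refine Fin.cases ?_ (fun l => ?_) l <;> simp [pathLeft]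

variable [Fintype I]

/-- The recursion unrolled by splitting off the first end of a sequence; this links the analytic
coefficients with the combinatorics of walks. -/
lemma pathCoeff_eq_sum (S : Matrix (EdgeEnd I E) (EdgeEnd I E) ℂ) (h' : EdgeEnd I E) (m : ℕ)
    (n : I → ℕ) (h : EdgeEnd I E) : pathCoeff S m n h h' =
      ∑ g : Fin m → I ⊕ I, if pathScore g = n then pathProd S h g h' else 0 := by
  induction m generalizing n h with
  | zero =>
    rw [Fintype.sum_unique]
    have : pathScore (default : Fin 0 → I ⊕ I) = 0 := by ext i; simp [pathScore]
    simp [pathCoeff, pathProd, this, pathLeft, pathRight, Fin.snoc, eq_comm]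
  | succ m ih =>
    rw [← (Fin.consEquiv fun _ => I ⊕ I).sum_comp, Fintype.sum_prod_type, pathCoeff]
    refine Finset.sum_congr rfl fun g₀ _ => ?_
    have e : ∀ p : (I ⊕ I) × (Fin m → I ⊕ I), (Fin.consEquiv fun _ => I ⊕ I) p =
        Fin.cons (α := fun _ => I ⊕ I) p.1 p.2 := fun _ => rfl
    simp only [e, pathScore_cons, pathProd_cons]
    rw [ih]
    split_ifs with hn
    · rw [Finset.mul_sum]
      refine Finset.sum_congr rfl fun g _ => ?_
      have : pathScore g = n - Pi.single (endIdx g₀) 1 ↔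
          pathScore g + Pi.single (endIdx g₀) 1 = n := by
        constructor
        · intro h; rw [h, sub_single_add_single hn]
        · rintro rfl; simp
      simp only [this, mul_ite, mul_zero]
    · rw [mul_zero, eq_comm]
      refine Finset.sum_eq_zero fun g _ => if_neg ?_
      rintro rfl
      simp at hn

lemma sum_pathScore {m : ℕ} (g : Fin m → I ⊕ I) : ∑ i, pathScore g i = m := by
  have := Finset.card_eq_sum_card_fiberwise (f := fun l => endIdx (g l))
    (s := (Finset.univ : Finset (Fin m))) (t := Finset.univ) (by simp)
  simpa [pathScore] using this.symm

end

/-! ### The correspondence between paths and walks -/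

namespace MetricGraph

variable {V I E : Type*} (G : MetricGraph V I E)

/-- The distance from an edge end. -/
def endDist : EdgeEnd I E → ℝ → ℝ
  | Sum.inl _, x => x
  | Sum.inr (Sum.inl _), x => x
  | Sum.inr (Sum.inr i), x => G.len i - x

lemma vertexOf_mem_ends (h : EdgeEnd I E) : G.vertexOf h ∈ G.ends (edgeOf h) := by
  rcases h with e | i | i <;> simp [vertexOf, ends, edgeOf, endIdx]

section

variable {G}

/-- The place where the absence of tadpoles lets a walk, recorded by vertices and edges, be encoded
by edge ends. -/
lemma end_ext (htadpole : ∀ i, ¬ G.IsTadpole i) {h h' : EdgeEnd I E} (he : edgeOf h = edgeOf h')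
    (hv : G.vertexOf h = G.vertexOf h') : h = h' := by
  rcases h with e | i | i <;> rcases h' with e' | i' | i' <;>
    simp only [edgeOf, endIdx, Sum.elim_inl, Sum.elim_inr, id, Sum.inl.injEq, Sum.inr.injEq,
      reduceCtorEq] at he
  · rw [he]
  · rw [he]
  · subst he; exact absurd hv (htadpole _)
  · subst he; exact absurd hv.symm (htadpole _)
  · rw [he]

lemma vertexOf_swap_ne (htadpole : ∀ i, ¬ G.IsTadpole i) (g : I ⊕ I) :
    G.vertexOf (Sum.inr g.swap : EdgeEnd I E) ≠ G.vertexOf (Sum.inr g : EdgeEnd I E) := by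
  rcases g with i | i
  · exact fun h => htadpole i h.symm
  · exact fun h => htadpole i h

lemma exists_end {v : V} {j : Edge I E} (hv : v ∈ G.ends j) :
    ∃ h : EdgeEnd I E, edgeOf h = j ∧ G.vertexOf h = v := by
  rcases j with e | i
  · exact ⟨Sum.inl e, rfl, (Set.mem_singleton_iff.mp hv).symm⟩
  · rcases hv with rfl | rfl
    · exact ⟨Sum.inr (Sum.inl i), rfl, rfl⟩
    · exact ⟨Sum.inr (Sum.inr i), rfl, rfl⟩

variable [DecidableEq V]

lemma edgeOf_endAt {v : V} {j : Edge I E} (hv : v ∈ G.ends j) : edgeOf (G.endAt v j hv).1 = j := by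
  rcases j with e | i
  · rfl
  · rw [endAt]
    split_ifs <;> rfl

lemma endAt_eq (htadpole : ∀ i, ¬ G.IsTadpole i) {v : V} {j : Edge I E} (hv : v ∈ G.ends j)
    {h : EdgeEnd I E} (he : edgeOf h = j) (hh : G.vertexOf h = v) : (G.endAt v j hv).1 = h :=
  end_ext htadpole ((edgeOf_endAt hv).trans he.symm) ((G.endAt v j hv).2.trans hh.symm)

lemma dist_vertexOf (htadpole : ∀ i, ¬ G.IsTadpole i) (h : EdgeEnd I E) (x : ℝ) :
    G.dist (edgeOf h) x (G.vertexOf h) = G.endDist h x := by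
  rcases h with e | i | i
  · rfl
  · simp [dist, edgeOf, endIdx, vertexOf, endDist]
  · have : G.termV i ≠ G.initV i := fun h => htadpole i h.symm
    simp [dist, edgeOf, endIdx, vertexOf, endDist, this]

end

section

variable {m : ℕ} {h h' : EdgeEnd I E} {g : Fin m → I ⊕ I}

lemma edgeOf_pathLeft (l : Fin (m + 1)) : edgeOf (pathLeft h g l) =
    walkEdges (edgeOf h) (edgeOf h') (fun l => endIdx (g l)) l.castSucc := by
  refine Fin.cases ?_ (fun l => ?_) l
  · simp [pathLeft, walkEdges]
  · rw [← Fin.succ_castSucc]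
    simp [pathLeft, walkEdges]

lemma edgeOf_pathRight (l : Fin (m + 1)) : edgeOf (pathRight g h' l) =
    walkEdges (edgeOf h) (edgeOf h') (fun l => endIdx (g l)) l.succ := by
  refine Fin.lastCases ?_ (fun l => ?_) l <;> simp [pathRight, walkEdges]

/-- Each vertex of the path is the same when entered and when left. -/
def IsPath (h : EdgeEnd I E) (g : Fin m → I ⊕ I) (h' : EdgeEnd I E) : Prop :=
  ∀ l, G.vertexOf (pathLeft h g l) = G.vertexOf (pathRight g h' l)

variable {G}

/-- The walk that corresponds to a path. -/
def pathWalk (htadpole : ∀ i, ¬ G.IsTadpole i) {j j' : Edge I E} (hj : edgeOf h = j)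
    (hj' : edgeOf h' = j') (hp : G.IsPath h g h') : G.Walk j j' where
  length := m
  vert l := G.vertexOf (pathLeft h g l)
  edge l := endIdx (g l)
  mem_left l := by
    subst hj hj'
    rw [← edgeOf_pathLeft]
    exact G.vertexOf_mem_ends _
  mem_right l := by
    subst hj hj'
    rw [hp, ← edgeOf_pathRight]
    exact G.vertexOf_mem_ends _
  eq_iff_tadpole l := by
    refine iff_of_false (fun hv => ?_) (htadpole _)
    rw [hp] at hv
    simp only [pathRight, pathLeft, Fin.snoc_castSucc, Fin.cons_succ] at hv
    exact vertexOf_swap_ne htadpole _ hv.symm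

/-- Every walk corresponds to a path. -/
lemma exists_pathWalk (htadpole : ∀ i, ¬ G.IsTadpole i) {j j' : Edge I E} (w : G.Walk j j') :
    ∃ (m : ℕ) (h h' : EdgeEnd I E) (g : Fin m → I ⊕ I) (hj : edgeOf h = j)
      (hj' : edgeOf h' = j') (hp : G.IsPath h g h'), pathWalk htadpole hj hj' hp = w := by
  obtain ⟨m, vert, edge, hl, hr, ht⟩ := w
  obtain ⟨h, hhj, hhv⟩ := exists_end (hl 0)
  obtain ⟨h', hhj', hhv'⟩ := exists_end (hr (Fin.last m))
  have hj : edgeOf h = j := by simpa [walkEdges] using hhj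
  have hj' : edgeOf h' = j' := by simpa [walkEdges] using hhj'
  have hg : ∀ l : Fin m, ∃ g : I ⊕ I, endIdx g = edge l ∧
      G.vertexOf (Sum.inr g : EdgeEnd I E) = vert l.castSucc := fun l => by
    obtain ⟨a, ha, hv⟩ := exists_end (hr l.castSucc)
    simp only [walkEdges, Fin.cons_succ, Fin.snoc_castSucc] at ha
    rcases a with e | g
    · simp [edgeOf] at ha
    · exact ⟨g, by simpa using ha, hv⟩
  choose g hge hgv using hg
  have hleft : ∀ l, G.vertexOf (pathLeft h g l) = vert l := fun l => by
    refine Fin.cases ?_ (fun l => ?_) l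
    · exact hhv
    · simp only [pathLeft, Fin.cons_succ]
      have hmem := hl l.succ
      rw [← Fin.succ_castSucc] at hmem
      simp only [walkEdges, Fin.cons_succ, Fin.snoc_castSucc] at hmem
      -- Consecutive vertices of the walk differ, so the next vertex is the other vertex of the
      -- edge, that is, the one at the swapped end.
      have hne : vert l.succ ≠ G.vertexOf (Sum.inr (g l) : EdgeEnd I E) := fun h0 =>
        htadpole _ ((ht l).mp (by rw [← hgv l, ← h0]))
      rw [← hge l] at hmem
      rcases hgl : g l with i | i <;> rw [hgl] at hmem hne <;>
        simp only [endIdx, Sum.elim_inl, Sum.elim_inr, id, ends, Set.mem_insert_iff,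
          Set.mem_singleton_iff] at hmem
      · exact (hmem.resolve_left hne).symm
      · exact (hmem.resolve_right hne).symm
  have hp : G.IsPath h g h' := fun l => by
    rw [hleft]
    refine Fin.lastCases ?_ (fun l => ?_) l
    · simp [pathRight, hhv']
    · simp [pathRight, hgv]
  refine ⟨m, h, h', g, hj, hj', hp, ?_⟩
  have h1 : (fun l => G.vertexOf (pathLeft h g l)) = vert := funext hleft
  have h2 : (fun l => endIdx (g l)) = edge := funext hge
  subst h1 h2
  rfl

lemma pathWalk_injective (htadpole : ∀ i, ¬ G.IsTadpole i) {j j' : Edge I E}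
    (hj : edgeOf h = j) (hj' : edgeOf h' = j') (hp : G.IsPath h g h')
    {h₂ h₂' : EdgeEnd I E} {g₂ : Fin m → I ⊕ I} (hj₂ : edgeOf h₂ = j) (hj₂' : edgeOf h₂' = j')
    (hp₂ : G.IsPath h₂ g₂ h₂')
    (heq : pathWalk htadpole hj hj' hp = pathWalk htadpole hj₂ hj₂' hp₂) :
    h = h₂ ∧ g = g₂ ∧ h' = h₂' := by
  simp only [pathWalk, Walk.mk.injEq, heq_eq_eq, true_and] at heq
  obtain ⟨hv, he⟩ := heq
  have hv : ∀ l, G.vertexOf (pathLeft h g l) = G.vertexOf (pathLeft h₂ g₂ l) := congrFun hv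
  have hv' : ∀ l, G.vertexOf (pathRight g h' l) = G.vertexOf (pathRight g₂ h₂' l) := fun l => by
    rw [← hp, ← hp₂, hv]
  refine ⟨end_ext htadpole (hj.trans hj₂.symm) (hv 0), ?_,
    end_ext htadpole (hj'.trans hj₂'.symm) (by simpa [pathRight] using hv' (Fin.last m))⟩
  ext1 l
  have := end_ext (h := (Sum.inr (g l) : EdgeEnd I E)) (h' := Sum.inr (g₂ l)) htadpole
    (by simpa using congrFun he l) (by simpa [pathRight] using hv' l.castSucc)
  simpa using this

end

section Walks

variable {G} {j j' : Edge I E}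

lemma Walk.finite_length [Finite V] [Finite I] (n : ℕ) :
    {w : G.Walk j j' | w.length = n}.Finite := by
  have hfin : {p : Σ m, (Fin (m + 1) → V) × (Fin m → I) | p.1 = n}.Finite := by
    refine (Set.finite_range fun q : (Fin (n + 1) → V) × (Fin n → I) =>
      (⟨n, q⟩ : Σ m, (Fin (m + 1) → V) × (Fin m → I))).subset ?_
    rintro ⟨m, q⟩ rfl
    exact ⟨q, rfl⟩
  refine (hfin.preimage (f := fun w : G.Walk j j' =>
    (⟨w.length, w.vert, w.edge⟩ : Σ m, (Fin (m + 1) → V) × (Fin m → I)))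
      (Function.Injective.injOn ?_)).subset fun w hw => hw
  rintro ⟨m, v, e, _, _, _⟩ ⟨m', v', e', _, _, _⟩ h
  simp only [Sigma.mk.injEq] at h
  obtain ⟨rfl, h⟩ := h
  simp only [heq_eq_eq, Prod.mk.injEq] at h
  obtain ⟨rfl, rfl⟩ := h
  rfl

lemma Walk.sum_score [Fintype I] [DecidableEq I] (w : G.Walk j j') :
    ∑ i, w.score i = w.length := by
  have := Finset.card_eq_sum_card_fiberwise (f := w.edge)
    (s := (Finset.univ : Finset (Fin w.length))) (t := Finset.univ) (by simp)
  simpa [score] using this.symm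

lemma Walk.finite_score [Finite V] [Fintype I] [DecidableEq I] (n : I → ℕ) :
    {w : G.Walk j j' | w.score = n}.Finite :=
  (Walk.finite_length (∑ i, n i)).subset fun w hw => by
    have hw : w.score = n := hw
    simp [← hw, w.sum_score]

end Walks

end MetricGraph

/-! ### Phases, weights and the sum over the walks of one score -/

namespace MetricGraph

variable {V I E : Type*} {G : MetricGraph V I E}

lemma endDist_nonneg (h : EdgeEnd I E) {x : ℝ} (hx : x ∈ G.interval (edgeOf h)) :
    0 ≤ G.endDist h x := by
  rcases h with e | i | i
  · exact hx
  · exact hx.1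
  · exact sub_nonneg.mpr hx.2

lemma dist_nonneg [DecidableEq V] {j : Edge I E} {x : ℝ} (hx : x ∈ G.interval j) (v : V) :
    0 ≤ G.dist j x v := by
  rcases j with e | i
  · exact hx
  · rw [dist]
    split_ifs
    · exact hx.1
    · exact sub_nonneg.mpr hx.2

lemma norm_exp_I_mul (k : ℂ) (d : ℝ) :
    ‖Complex.exp (Complex.I * k * d)‖ = Real.exp (-(k.im * d)) := by
  rw [Complex.norm_exp]
  simp

lemma norm_exp_I_mul_le_one {k : ℂ} (hk : 0 < k.im) {d : ℝ} (hd : 0 ≤ d) :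
    ‖Complex.exp (Complex.I * k * d)‖ ≤ 1 := by
  rw [norm_exp_I_mul, Real.exp_le_one_iff]
  have := mul_nonneg hk.le hd
  linarith

variable (G) in
/-- The factor that a wave gains while it traverses an internal edge. -/
def edgePhase (k : ℂ) (i : I) : ℂ := Complex.exp (Complex.I * k * (G.len i : ℝ))

lemma norm_edgePhase_lt_one {k : ℂ} (hk : 0 < k.im) (i : I) : ‖G.edgePhase k i‖ < 1 := by
  rw [edgePhase, norm_exp_I_mul, Real.exp_lt_one_iff]
  have := mul_pos hk (G.len_pos i)
  linarith

lemma exp_sum_len (k : ℂ) {m : ℕ} (c : Fin m → I) :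
    Complex.exp (Complex.I * k * ((∑ l, G.len (c l) : ℝ) : ℂ)) = ∏ l, G.edgePhase k (c l) := by
  simp only [edgePhase]
  rw [← Complex.exp_sum, Complex.ofReal_sum, Finset.mul_sum]

variable [Fintype I] [Fintype E] [DecidableEq V] [DecidableEq I] [DecidableEq E]

variable (G) in
/-- The contribution of a kernel on the edge ends to an integral kernel on the edges. -/
def endKernel (k : ℂ) (X : Matrix (EdgeEnd I E) (EdgeEnd I E) ℂ) (j j' : Edge I E)
    (x y : ℝ) : ℂ :=
  ∑ h, ∑ h', if edgeOf h = j ∧ edgeOf h' = j' then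
    Complex.exp (Complex.I * k * (G.endDist h x : ℝ)) * X h h' *
      Complex.exp (Complex.I * k * (G.endDist h' y : ℝ)) else 0

lemma weight_eq_prod {κ : ℂ} {A B : ∀ v, Matrix (G.EndsAt v) (G.EndsAt v) ℂ} {j j' : Edge I E}
    (w : G.Walk j j') : G.weight κ A B w = ∏ l, G.vertexScattering κ A B
      (G.endAt (w.vert l) _ (w.mem_left l)).1 (G.endAt (w.vert l) _ (w.mem_right l)).1 :=
  Finset.prod_congr rfl fun _ _ => (G.vertexScattering_apply _ _).symm

lemma walkTerm_pathWalk (htadpole : ∀ i, ¬ G.IsTadpole i) (κ : ℂ)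
    (A B : ∀ v, Matrix (G.EndsAt v) (G.EndsAt v) ℂ) (k : ℂ) {j j' : Edge I E} (x y : ℝ)
    {m : ℕ} {h h' : EdgeEnd I E} {g : Fin m → I ⊕ I} (hj : edgeOf h = j) (hj' : edgeOf h' = j')
    (hp : G.IsPath h g h') : G.walkTerm κ A B k x y (pathWalk htadpole hj hj' hp) =
      Complex.exp (Complex.I * k * (G.endDist h x : ℝ)) *
        (pathProd (G.vertexScattering κ A B) h g h' * ∏ i, G.edgePhase k i ^ pathScore g i) *
        Complex.exp (Complex.I * k * (G.endDist h' y : ℝ)) := by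
  subst hj hj'
  have h1 : G.weight κ A B (pathWalk htadpole rfl rfl hp) =
      pathProd (G.vertexScattering κ A B) h g h' := by
    rw [weight_eq_prod]
    refine Finset.prod_congr rfl fun l _ => ?_
    exact congrArg₂ (G.vertexScattering κ A B) (endAt_eq htadpole _ (edgeOf_pathLeft l) rfl)
      (endAt_eq htadpole _ (edgeOf_pathRight l) (hp l).symm)
  have h2 : (pathWalk htadpole rfl rfl hp).firstVertex = G.vertexOf h := rfl
  have h3 : (pathWalk htadpole rfl rfl hp).lastVertex = G.vertexOf h' := by
    change G.vertexOf (pathLeft h g (Fin.last m)) = _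
    rw [hp]
    simp [pathRight]
  have h4 : Complex.exp (Complex.I * k * ((pathWalk htadpole rfl rfl hp).metricLength : ℝ)) =
      ∏ i, G.edgePhase k i ^ pathScore g i := by
    change Complex.exp (Complex.I * k * ((∑ l, G.len (endIdx (g l)) : ℝ) : ℂ)) = _
    rw [exp_sum_len, ← Finset.prod_fiberwise' (s := Finset.univ) (g := fun l => endIdx (g l))]
    refine Finset.prod_congr rfl fun i _ => ?_
    rw [Finset.prod_const, pathScore]
  rw [walkTerm, h1, h2, h3, h4, dist_vertexOf htadpole, dist_vertexOf htadpole]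
  ring

/-- A sequence of ends that jumps between vertices picks up an off-diagonal zero block of `S`. The
unrestricted sum over sequences of ends is therefore a sum over walks. -/
lemma pathProd_eq_zero {κ : ℂ} {A B : ∀ v, Matrix (G.EndsAt v) (G.EndsAt v) ℂ}
    {m : ℕ} {h h' : EdgeEnd I E} {g : Fin m → I ⊕ I} (hp : ¬ G.IsPath h g h') :
    pathProd (G.vertexScattering κ A B) h g h' = 0 := by
  obtain ⟨l, hl⟩ := not_forall.mp hp
  exact Finset.prod_eq_zero (Finset.mem_univ l) (G.vertexScattering_of_ne hl)

/-- The score fixes the length, so the walks correspond bijectively to the sequences of `∑ i, n i`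
ends that are paths of this score between ends of `j` and `j'`; the phase depends on the score
alone. -/
lemma finsum_score [Finite V] (htadpole : ∀ i, ¬ G.IsTadpole i) (κ : ℂ)
    (A B : ∀ v, Matrix (G.EndsAt v) (G.EndsAt v) ℂ) (k : ℂ) (j j' : Edge I E) (x y : ℝ)
    (n : I → ℕ) :
    ∑ᶠ w ∈ {w : G.Walk j j' | w.score = n}, G.walkTerm κ A B k x y w =
      G.endKernel k (scoreTerm (G.vertexScattering κ A B) (G.edgePhase k) n) j j' x y := by
  classical
  set S := G.vertexScattering κ A B with hSdef
  let P : Finset (EdgeEnd I E × EdgeEnd I E × (Fin (∑ i, n i) → I ⊕ I)) :=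
    Finset.univ.filter fun p => (edgeOf p.1 = j ∧ edgeOf p.2.1 = j') ∧
      pathScore p.2.2 = n ∧ G.IsPath p.1 p.2.2 p.2.1
  have hsum : ∑ p ∈ P, Complex.exp (Complex.I * k * (G.endDist p.1 x : ℝ)) *
        (pathProd S p.1 p.2.2 p.2.1 * ∏ i, G.edgePhase k i ^ n i) *
        Complex.exp (Complex.I * k * (G.endDist p.2.1 y : ℝ)) =
      G.endKernel k (scoreTerm S (G.edgePhase k) n) j j' x y := by
    rw [Finset.sum_filter, Fintype.sum_prod_type]
    unfold endKernel
    refine Finset.sum_congr rfl fun h _ => ?_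
    rw [Fintype.sum_prod_type]
    refine Finset.sum_congr rfl fun h' _ => ?_
    split_ifs with hjj
    · rw [scoreTerm, pathCoeff_eq_sum, Finset.sum_mul, Finset.mul_sum, Finset.sum_mul]
      refine Finset.sum_congr rfl fun g _ => ?_
      by_cases hn : pathScore g = n
      · by_cases hp : G.IsPath h g h'
        · simp only [hjj, hn, hp, and_self, if_true]
        · rw [if_neg fun hc => hp hc.2.2, if_pos hn, hSdef, pathProd_eq_zero hp]
          simp
      · rw [if_neg fun hc => hn hc.2.1, if_neg hn]
        simp
    · exact Finset.sum_eq_zero fun g _ => if_neg fun hc => hjj hc.1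
  rw [← hsum, finsum_mem_eq_finite_toFinset_sum _ (Walk.finite_score n)]
  symm
  refine Finset.sum_bij (fun p hp => pathWalk htadpole (Finset.mem_filter.mp hp).2.1.1
    (Finset.mem_filter.mp hp).2.1.2 (Finset.mem_filter.mp hp).2.2.2) ?_ ?_ ?_ ?_
  · intro p hp
    rw [Set.Finite.mem_toFinset]
    exact (Finset.mem_filter.mp hp).2.2.1
  · rintro ⟨a, b, c⟩ hp ⟨a', b', c'⟩ hp' heq
    obtain ⟨h1, h2, h3⟩ := pathWalk_injective htadpole _ _ _ _ _ _ heq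
    dsimp only at h1 h2 h3
    rw [h1, h2, h3]
  · intro w hw
    rw [Set.Finite.mem_toFinset] at hw
    have hw : w.score = n := hw
    obtain ⟨m, h, h', g, hj, hj', hp, rfl⟩ := exists_pathWalk htadpole w
    have hw : pathScore g = n := hw
    obtain rfl : ∑ i, n i = m := by rw [← hw, sum_pathScore]
    exact ⟨(h, h', g), Finset.mem_filter.mpr ⟨Finset.mem_univ _, ⟨hj, hj'⟩, hw, hp⟩, rfl⟩
  · intro p hp
    rw [walkTerm_pathWalk, (Finset.mem_filter.mp hp).2.2.1]

end MetricGraph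

/-! ### Convergence of the three series over walks -/

namespace MetricGraph

section Walks

variable {V I E : Type*} {G : MetricGraph V I E} {j j' : Edge I E}

/-- Once the first vertex is known, each edge leads to its other vertex. Hence there are at most
`|V|` walks for each sequence of edges, which suffices for counting. -/
lemma Walk.eq_of_edge_eq (htadpole : ∀ i, ¬ G.IsTadpole i) {w w' : G.Walk j j'}
    (h0 : w.firstVertex = w'.firstVertex)
    (he : (⟨w.length, w.edge⟩ : Σ m, Fin m → I) = ⟨w'.length, w'.edge⟩) : w = w' := by
  obtain ⟨m, v, e, hl, hr, ht⟩ := w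
  obtain ⟨m', v', e', hl', hr', ht'⟩ := w'
  simp only [Sigma.mk.injEq] at he
  obtain ⟨rfl, he⟩ := he
  obtain rfl := eq_of_heq he
  have hv : v = v' := by
    ext l
    induction l using Fin.induction with
    | zero => exact h0
    | succ l ih =>
      have key : ∀ u : Fin (m + 1) → V,
          (∀ l, u l ∈ G.ends (walkEdges j j' e l.castSucc)) →
          (∀ l, u l ∈ G.ends (walkEdges j j' e l.succ)) →
          u l.castSucc ∈ G.ends (Sum.inr (e l)) ∧ u l.succ ∈ G.ends (Sum.inr (e l)) := by
        intro u h1 h2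
        have h1 := h1 l.succ
        have h2 := h2 l.castSucc
        rw [← Fin.succ_castSucc] at h1
        simp only [walkEdges, Fin.cons_succ, Fin.snoc_castSucc] at h1 h2
        exact ⟨h2, h1⟩
      obtain ⟨h1, h2⟩ := key v hl hr
      obtain ⟨h1', h2'⟩ := key v' hl' hr'
      have hne := fun h => htadpole _ ((ht l).mp h)
      have hne' := fun h => htadpole _ ((ht' l).mp h)
      simp only [ends, Set.mem_insert_iff, Set.mem_singleton_iff] at h1 h2 h1' h2'
      -- An edge has only two vertices. Both walks are at the same one before crossing it and at a
      -- different one afterwards.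
      grind
  subst hv
  rfl

/-- The sequences of length `m` contribute `(∑ i, r i) ^ m`, and the hypothesis makes `∑ i, r i`
less than 1. -/
lemma summable_edge_sequences [Fintype I] {r : I → ℝ} (h0 : ∀ i, 0 ≤ r i)
    (h1 : ∀ i, Fintype.card I * r i < 1) :
    Summable fun c : Σ m, Fin m → I => ∏ l, r (c.2 l) := by
  rw [summable_sigma_of_nonneg fun c => Finset.prod_nonneg fun _ _ => h0 _]
  refine ⟨fun m => (hasSum_fintype _).summable, ?_⟩
  have e : ∀ m : ℕ, ∑' c : Fin m → I, ∏ l, r (c l) = (∑ i, r i) ^ m := fun m => by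
    rw [tsum_fintype, Finset.sum_pow', Fintype.piFinset_univ]
  simp only [e]
  refine summable_geometric_of_lt_one (Finset.sum_nonneg fun i _ => h0 i) ?_
  rcases isEmpty_or_nonempty I with hI | hI
  · simp
  · have hc : (0 : ℝ) < Fintype.card I := by exact_mod_cast Fintype.card_pos
    calc ∑ i, r i < ∑ _i : I, (Fintype.card I : ℝ)⁻¹ :=
          Finset.sum_lt_sum_of_nonempty Finset.univ_nonempty fun i _ => by
            rw [inv_eq_one_div, lt_div_iff₀' hc]; exact h1 i
      _ = 1 := by simp [hc.ne']

end Walks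

variable {V I E : Type*} {G : MetricGraph V I E}
variable [Fintype I] [Fintype E] [DecidableEq V] [DecidableEq I] [DecidableEq E]
variable {κ : ℂ} {A B : ∀ v, Matrix (G.EndsAt v) (G.EndsAt v) ℂ} {k : ℂ}

/-- The series of the walks, collected according to their score. -/
lemma hasSum_score [Finite V] (htadpole : ∀ i, ¬ G.IsTadpole i)
    (hS : ∀ u, ∑ h, ‖(G.vertexScattering κ A B).mulVec u h‖ ^ 2 = ∑ h, ‖u h‖ ^ 2)
    (hk : 0 < k.im) (j j' : Edge I E) (x y : ℝ) :
    Summable (fun n : I → ℕ =>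
      ‖∑ᶠ w ∈ {w : G.Walk j j' | w.score = n}, G.walkTerm κ A B k x y w‖) ∧
    HasSum (fun n : I → ℕ =>
      ∑ᶠ w ∈ {w : G.Walk j j' | w.score = n}, G.walkTerm κ A B k x y w)
      (G.endKernel k (pathMatrix (G.vertexScattering κ A B) (G.edgePhase k)) j j' x y) := by
  have hz := fun i => norm_edgePhase_lt_one (G := G) hk i
  have hsum := fun h h' => summable_norm_scoreTerm hS hz h h'
  simp only [finsum_score htadpole]
  unfold endKernel
  constructor
  · refine Summable.of_nonneg_of_le (fun _ => norm_nonneg _)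
      (fun n => (norm_sum_le _ _).trans (Finset.sum_le_sum fun h _ => norm_sum_le _ _))
      (summable_sum fun h _ => summable_sum fun h' _ => ?_)
    split_ifs
    · simp only [norm_mul]
      exact ((hsum h h').mul_left _).mul_right _
    · simp
  · refine hasSum_sum fun h _ => hasSum_sum fun h' _ => ?_
    split_ifs
    · exact ((hsum h h').of_norm.hasSum.mul_left _).mul_right _
    · exact hasSum_zero

lemma finsum_length [Finite V] (j j' : Edge I E) (x y : ℝ) (m : ℕ) :
    ∑ᶠ w ∈ {w : G.Walk j j' | w.length = m}, G.walkTerm κ A B k x y w =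
      ∑ n ∈ Finset.piAntidiag Finset.univ m,
        ∑ᶠ w ∈ {w : G.Walk j j' | w.score = n}, G.walkTerm κ A B k x y w := by
  have e : {w : G.Walk j j' | w.length = m} =
      ⋃ n ∈ ((Finset.piAntidiag Finset.univ m : Finset (I → ℕ)) : Set (I → ℕ)),
        {w : G.Walk j j' | w.score = n} := by
    ext w
    simp [← w.sum_score]
  -- The walks of length `m` split into the finitely many disjoint classes of the scores with total
  -- `m`.
  rw [e, finsum_mem_biUnion _ (Finset.finite_toSet _) fun n _ => Walk.finite_score n,
    finsum_mem_coe_finset]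
  intro n _ n' _ hne
  exact Set.disjoint_left.mpr fun w hw hw' => hne (hw.symm.trans hw')

lemma hasSum_fiberwise_finsum {α β : Type*} {f : α → ℂ} (hf : Summable f) (g : α → β)
    (hg : ∀ m, {a | g a = m}.Finite) :
    HasSum (fun m => ∑ᶠ a ∈ {a | g a = m}, f a) (∑' a, f a) := by
  have e : ∀ m, ∑' a : ↑(g ⁻¹' {m}), f a = ∑ᶠ a ∈ {a | g a = m}, f a := fun m => by
    have hf : Finite ↑(g ⁻¹' {m}) := (hg m).to_subtype
    rw [tsum_eq_finsum (Set.toFinite _)]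
    exact finsum_set_coe_eq_finsum_mem (f := f) _
  exact (funext e) ▸ hf.hasSum.tsum_fiberwise g

lemma tsum_preimage_sum {I F : Type*} [Fintype I] [DecidableEq I] [AddCommMonoid F]
    [TopologicalSpace F] (f : (I → ℕ) → F) (m : ℕ) :
    ∑' n : ↑((fun n : I → ℕ => ∑ i, n i) ⁻¹' {m}), f n =
      ∑ n ∈ Finset.piAntidiag Finset.univ m, f n := by
  have e : (fun n : I → ℕ => ∑ i, n i) ⁻¹' {m} =
      ((Finset.piAntidiag Finset.univ m : Finset (I → ℕ)) : Set (I → ℕ)) := by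
    ext n
    simp
  rw [e]
  exact Finset.tsum_subtype' _ f

/-- The series of the walks, collected according to their combinatorial length. -/
lemma hasSum_length [Finite V] (htadpole : ∀ i, ¬ G.IsTadpole i)
    (hS : ∀ u, ∑ h, ‖(G.vertexScattering κ A B).mulVec u h‖ ^ 2 = ∑ h, ‖u h‖ ^ 2)
    (hk : 0 < k.im) (j j' : Edge I E) (x y : ℝ) :
    Summable (fun n : ℕ =>
      ‖∑ᶠ w ∈ {w : G.Walk j j' | w.length = n}, G.walkTerm κ A B k x y w‖) ∧
    HasSum (fun n : ℕ =>
      ∑ᶠ w ∈ {w : G.Walk j j' | w.length = n}, G.walkTerm κ A B k x y w)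
      (G.endKernel k (pathMatrix (G.vertexScattering κ A B) (G.edgePhase k)) j j' x y) := by
  obtain ⟨h1, h2⟩ := hasSum_score htadpole hS hk j j' x y
  have h3 := h1.hasSum.tsum_fiberwise fun n : I → ℕ => ∑ i, n i
  have h4 := h2.tsum_fiberwise fun n : I → ℕ => ∑ i, n i
  simp only [finsum_length]
  refine ⟨Summable.of_nonneg_of_le (fun _ => norm_nonneg _) (fun n => norm_sum_le _ _)
    (h3.summable.congr fun m => tsum_preimage_sum
      (fun n => ‖∑ᶠ w ∈ {w : G.Walk j j' | w.score = n}, G.walkTerm κ A B k x y w‖) m), ?_⟩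
  exact (funext fun m => tsum_preimage_sum
    (fun n => ∑ᶠ w ∈ {w : G.Walk j j' | w.score = n}, G.walkTerm κ A B k x y w) m) ▸ h4

/-- Each entry of an isometry has modulus at most 1, and so have the two boundary exponentials, as
distances within an edge are nonnegative. Only the phases of the crossed edges remain. -/
lemma norm_walkTerm_le
    (hS : ∀ u, ∑ h, ‖(G.vertexScattering κ A B).mulVec u h‖ ^ 2 = ∑ h, ‖u h‖ ^ 2)
    (hk : 0 < k.im) {j j' : Edge I E} {x y : ℝ} (hx : x ∈ G.interval j) (hy : y ∈ G.interval j')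
    (w : G.Walk j j') :
    ‖G.walkTerm κ A B k x y w‖ ≤ ∏ l, ‖G.edgePhase k (w.edge l)‖ := by
  have hw : ‖G.weight κ A B w‖ ≤ 1 := by
    rw [weight_eq_prod, norm_prod]
    refine Finset.prod_le_one (fun _ _ => norm_nonneg _) fun l _ => ?_
    simpa [pathCoeff] using norm_pathCoeff_le_one hS 0 0 _ _
  rw [walkTerm, Walk.metricLength, exp_sum_len, norm_mul, norm_mul, norm_mul, norm_prod]
  have hp : 0 ≤ ∏ l, ‖G.edgePhase k (w.edge l)‖ := Finset.prod_nonneg fun _ _ => norm_nonneg _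
  have h1 := norm_exp_I_mul_le_one hk (dist_nonneg hx w.firstVertex)
  have h2 := norm_exp_I_mul_le_one hk (dist_nonneg hy w.lastVertex)
  have h3 := mul_le_one₀ h1 (norm_nonneg _) hw
  exact (mul_le_of_le_one_right (by positivity) h2).trans (mul_le_of_le_one_left hp h3)

/-- The series of the walks. -/
lemma hasSum_walkTerm [Finite V] (htadpole : ∀ i, ¬ G.IsTadpole i)
    (hS : ∀ u, ∑ h, ‖(G.vertexScattering κ A B).mulVec u h‖ ^ 2 = ∑ h, ‖u h‖ ^ 2)
    (hk : 0 < k.im) {j j' : Edge I E} {x y : ℝ} (hx : x ∈ G.interval j) (hy : y ∈ G.interval j')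
    (hlen : ∀ i, (Fintype.card I : ℝ) * Real.exp (-(k.im * G.len i)) < 1) :
    Summable (fun w : G.Walk j j' => ‖G.walkTerm κ A B k x y w‖) ∧
    HasSum (fun w : G.Walk j j' => G.walkTerm κ A B k x y w)
      (G.endKernel k (pathMatrix (G.vertexScattering κ A B) (G.edgePhase k)) j j' x y) := by
  have hsum : Summable (fun w : G.Walk j j' => ‖G.walkTerm κ A B k x y w‖) := by
    have hV : Summable fun _ : V => (1 : ℝ) := Summable.of_finite
    have hc := summable_edge_sequences (r := fun i => ‖G.edgePhase k i‖) (fun _ => norm_nonneg _)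
      (by simpa [edgePhase, norm_exp_I_mul] using hlen)
    have hVc := hV.mul_of_nonneg hc (fun _ => zero_le_one)
      (fun c => Finset.prod_nonneg fun _ _ => norm_nonneg _)
    have hinj : Function.Injective fun w : G.Walk j j' =>
        ((w.firstVertex, ⟨w.length, w.edge⟩) : V × Σ m, Fin m → I) := fun w w' h =>
      Walk.eq_of_edge_eq htadpole (congrArg Prod.fst h) (congrArg Prod.snd h)
    have hcomp := hVc.comp_injective hinj
    simp only [Function.comp_def, one_mul] at hcomp
    exact Summable.of_nonneg_of_le (fun _ => norm_nonneg _)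
      (fun w => norm_walkTerm_le hS hk hx hy w) hcomp
  -- The value of the absolutely convergent series is found by grouping it by length and comparing
  -- with the series already summed.
  have h1 := hasSum_fiberwise_finsum hsum.of_norm (fun w => w.length)
    (fun m => Walk.finite_length (G := G) (j := j) (j' := j') m)
  have h2 := (hasSum_length htadpole hS hk j j' x y).2.unique h1
  exact ⟨hsum, h2 ▸ hsum.of_norm.hasSum⟩

end MetricGraph

/-! ### Schur's test for continuous kernels -/

section Schur

open scoped ENNReal

variable {μ ν : Measure ℝ} [SFinite μ] [SFinite ν] {r : ℝ → ℝ → ℂ} {C : ℝ≥0∞}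

/-- The Cauchy–Schwarz inequality for the factorization `u w = √u · (√u w)`. -/
lemma sq_lintegral_mul_le {α : Type*} [MeasurableSpace α] {μ : Measure α} {u w : α → ℝ≥0∞}
    (hu : AEMeasurable u μ) (hw : AEMeasurable w μ) :
    (∫⁻ y, u y * w y ∂μ) ^ 2 ≤ (∫⁻ y, u y ∂μ) * ∫⁻ y, u y * w y ^ 2 ∂μ := by
  have h := ENNReal.lintegral_mul_le_Lp_mul_Lq μ Real.HolderConjugate.two_two
    (hu.pow_const (1 / 2 : ℝ)) ((hu.pow_const (1 / 2 : ℝ)).mul hw)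
  have e1 : ∀ y, u y ^ (1 / 2 : ℝ) * (u y ^ (1 / 2 : ℝ) * w y) = u y * w y := fun y => by
    rw [← mul_assoc, ← ENNReal.rpow_add_of_nonneg _ _ (by norm_num) (by norm_num)]
    norm_num
  have e2 : ∀ y, (u y ^ (1 / 2 : ℝ)) ^ (2 : ℝ) = u y := fun y => by
    rw [← ENNReal.rpow_mul]; norm_num
  have e3 : ∀ y, (u y ^ (1 / 2 : ℝ) * w y) ^ (2 : ℝ) = u y * w y ^ 2 := fun y => by
    rw [ENNReal.mul_rpow_of_nonneg _ _ (by norm_num), e2, ENNReal.rpow_two]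
  simp only [Pi.mul_apply, e1, e2, e3] at h
  calc (∫⁻ y, u y * w y ∂μ) ^ 2 ≤ ((∫⁻ y, u y ∂μ) ^ (1 / 2 : ℝ) *
        (∫⁻ y, u y * w y ^ 2 ∂μ) ^ (1 / 2 : ℝ)) ^ 2 := by gcongr
    _ = _ := by
        rw [mul_pow, ← ENNReal.rpow_natCast, ← ENNReal.rpow_natCast, ← ENNReal.rpow_mul,
          ← ENNReal.rpow_mul]
        norm_num

lemma eLpNorm_two_sq {α : Type*} [MeasurableSpace α] {μ : Measure α} (f : α → ℂ) :
    eLpNorm f 2 μ ^ 2 = ∫⁻ x, ‖f x‖ₑ ^ 2 ∂μ := by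
  have := eLpNorm_nnreal_pow_eq_lintegral (μ := μ) (f := f) (p := 2) two_ne_zero
  simpa using this

/-- Weighted Cauchy–Schwarz in `y` costs one factor `C`; after Tonelli the integral over `x` costs
the other. The kernel enters with absolute values, so the estimate also yields integrability of `r x
y * φ y` for almost every `x`. -/
lemma lintegral_sq_kernel_le (hr : Continuous (Function.uncurry r))
    (h1 : ∀ᵐ x ∂μ, ∫⁻ y, ‖r x y‖ₑ ∂ν ≤ C) (h2 : ∀ᵐ y ∂ν, ∫⁻ x, ‖r x y‖ₑ ∂μ ≤ C)
    {φ : ℝ → ℂ} (hφ : AEStronglyMeasurable φ ν) :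
    ∫⁻ x, (∫⁻ y, ‖r x y‖ₑ * ‖φ y‖ₑ ∂ν) ^ 2 ∂μ ≤ C ^ 2 * ∫⁻ y, ‖φ y‖ₑ ^ 2 ∂ν := by
  have hrx : ∀ x, Measurable fun y => ‖r x y‖ₑ := fun x =>
    (hr.comp (Continuous.prodMk_right x)).measurable.enorm
  have hry : ∀ y, Measurable fun x => ‖r x y‖ₑ := fun y =>
    (hr.comp (Continuous.prodMk_left y)).measurable.enorm
  calc ∫⁻ x, (∫⁻ y, ‖r x y‖ₑ * ‖φ y‖ₑ ∂ν) ^ 2 ∂μ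
      ≤ ∫⁻ x, C * ∫⁻ y, ‖r x y‖ₑ * ‖φ y‖ₑ ^ 2 ∂ν ∂μ := by
        refine lintegral_mono_ae ?_
        filter_upwards [h1] with x hx
        exact (sq_lintegral_mul_le (hrx x).aemeasurable hφ.enorm).trans (by gcongr)
    _ ≤ C * ∫⁻ x, ∫⁻ y, ‖r x y‖ₑ * ‖φ y‖ₑ ^ 2 ∂ν ∂μ := by
        rw [lintegral_const_mul'']
        have : AEMeasurable (fun p : ℝ × ℝ => ‖r p.1 p.2‖ₑ * ‖φ p.2‖ₑ ^ 2) (μ.prod ν) :=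
          hr.measurable.enorm.aemeasurable.mul ((hφ.comp_snd.enorm).pow_const 2)
        exact this.lintegral_prod_right'
    _ = C * ∫⁻ y, ∫⁻ x, ‖r x y‖ₑ * ‖φ y‖ₑ ^ 2 ∂μ ∂ν := by
        rw [lintegral_lintegral_swap]
        exact hr.measurable.enorm.aemeasurable.mul ((hφ.comp_snd.enorm).pow_const 2)
    _ ≤ C * ∫⁻ y, C * ‖φ y‖ₑ ^ 2 ∂ν := by
        gcongr 1
        refine lintegral_mono_ae ?_
        filter_upwards [h2] with y hy
        rw [lintegral_mul_const _ (hry y)]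
        gcongr
    _ = C ^ 2 * ∫⁻ y, ‖φ y‖ₑ ^ 2 ∂ν := by
        rw [lintegral_const_mul'' _ (hφ.enorm.pow_const 2), ← mul_assoc, sq]

lemma ae_integrable_kernel (hr : Continuous (Function.uncurry r)) (hC : C ≠ ∞)
    (h1 : ∀ᵐ x ∂μ, ∫⁻ y, ‖r x y‖ₑ ∂ν ≤ C) (h2 : ∀ᵐ y ∂ν, ∫⁻ x, ‖r x y‖ₑ ∂μ ≤ C)
    {φ : ℝ → ℂ} (hφ : MemLp φ 2 ν) :
    ∀ᵐ x ∂μ, Integrable (fun y => r x y * φ y) ν := by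
  have hle := lintegral_sq_kernel_le hr h1 h2 hφ.1
  have hfin : ∫⁻ x, (∫⁻ y, ‖r x y‖ₑ * ‖φ y‖ₑ ∂ν) ^ 2 ∂μ ≠ ∞ := by
    refine (hle.trans_lt ?_).ne
    rw [← eLpNorm_two_sq]
    exact ENNReal.mul_lt_top (ENNReal.pow_lt_top hC.lt_top) (ENNReal.pow_lt_top hφ.2)
  have hm : AEMeasurable (fun p : ℝ × ℝ => ‖r p.1 p.2‖ₑ * ‖φ p.2‖ₑ) (μ.prod ν) :=
    hr.measurable.enorm.aemeasurable.mul hφ.1.comp_snd.enorm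
  filter_upwards [ae_lt_top' (hm.lintegral_prod_right'.pow_const 2) hfin] with x hx
  refine ⟨(hr.comp (Continuous.prodMk_right x)).aestronglyMeasurable.mul hφ.1, ?_⟩
  rw [HasFiniteIntegral]
  simp only [enorm_mul]
  by_contra hc
  rw [not_lt, top_le_iff] at hc
  rw [hc] at hx
  simp at hx

lemma eLpNorm_kernel_le (hr : Continuous (Function.uncurry r))
    (h1 : ∀ᵐ x ∂μ, ∫⁻ y, ‖r x y‖ₑ ∂ν ≤ C) (h2 : ∀ᵐ y ∂ν, ∫⁻ x, ‖r x y‖ₑ ∂μ ≤ C)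
    {φ : ℝ → ℂ} (hφ : AEStronglyMeasurable φ ν) :
    eLpNorm (fun x => ∫ y, r x y * φ y ∂ν) 2 μ ≤ C * eLpNorm φ 2 ν := by
  rw [← ENNReal.pow_le_pow_left_iff two_ne_zero, mul_pow, eLpNorm_two_sq, eLpNorm_two_sq]
  refine le_trans (lintegral_mono fun x => ?_) (lintegral_sq_kernel_le hr h1 h2 hφ)
  gcongr
  refine (enorm_integral_le_lintegral_enorm _).trans ?_
  simp only [enorm_mul]
  exact le_rfl

/-- Schur's test. -/
lemma exists_kernel_operator (hr : Continuous (Function.uncurry r)) (hC : C ≠ ∞)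
    (h1 : ∀ᵐ x ∂μ, ∫⁻ y, ‖r x y‖ₑ ∂ν ≤ C) (h2 : ∀ᵐ y ∂ν, ∫⁻ x, ‖r x y‖ₑ ∂μ ≤ C) :
    ∃ T : Lp ℂ 2 ν →L[ℂ] Lp ℂ 2 μ, ∀ φ : Lp ℂ 2 ν,
      (∀ᵐ x ∂μ, Integrable (fun y => r x y * φ y) ν) ∧
      T φ =ᵐ[μ] fun x => ∫ y, r x y * φ y ∂ν := by
  have hmem : ∀ φ : Lp ℂ 2 ν, MemLp (fun x => ∫ y, r x y * φ y ∂ν) 2 μ := fun φ => by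
    refine ⟨?_, (eLpNorm_kernel_le hr h1 h2 (Lp.memLp φ).1).trans_lt
      (ENNReal.mul_lt_top hC.lt_top (Lp.memLp φ).2)⟩
    exact AEStronglyMeasurable.integral_prod_right' (f := fun p : ℝ × ℝ => r p.1 p.2 * φ p.2)
      (hr.aestronglyMeasurable.mul (Lp.memLp φ).1.comp_snd)
  have hint := fun φ : Lp ℂ 2 ν => ae_integrable_kernel hr hC h1 h2 (Lp.memLp φ)
  let T₀ : Lp ℂ 2 ν →ₗ[ℂ] Lp ℂ 2 μ :=
    { toFun := fun φ => (hmem φ).toLp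
      map_add' := fun φ ψ => by
        rw [← MemLp.toLp_add, MemLp.toLp_eq_toLp_iff]
        filter_upwards [hint φ, hint ψ] with x hx hx'
        rw [Pi.add_apply, ← integral_add hx hx']
        refine integral_congr_ae ?_
        filter_upwards [Lp.coeFn_add φ ψ] with y hy
        rw [hy, Pi.add_apply, mul_add]
      map_smul' := fun c φ => by
        rw [RingHom.id_apply, ← MemLp.toLp_const_smul, MemLp.toLp_eq_toLp_iff]
        refine Filter.Eventually.of_forall fun x => ?_
        dsimp only
        rw [Pi.smul_apply, ← integral_smul]
        refine integral_congr_ae ?_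
        filter_upwards [Lp.coeFn_smul c φ] with y hy
        rw [hy, Pi.smul_apply, smul_eq_mul, smul_eq_mul]
        ring }
  refine ⟨T₀.mkContinuous C.toReal fun φ => ?_, fun φ => ⟨hint φ, ?_⟩⟩
  · change ‖(hmem φ).toLp‖ ≤ _
    rw [Lp.norm_toLp, Lp.norm_def, ← ENNReal.toReal_mul]
    exact ENNReal.toReal_mono (ENNReal.mul_ne_top hC (Lp.memLp φ).2.ne)
      (eLpNorm_kernel_le hr h1 h2 (Lp.memLp φ).1)
  · exact (hmem φ).coeFn_toLp

end Schur

/-! ### The equation on one edge: variation of constants and uniqueness -/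

section OrdinaryDifferentialEquation

lemma exp_mul_exp_neg (c : ℂ) : Complex.exp c * Complex.exp (-c) = 1 := by
  rw [← Complex.exp_add, add_neg_cancel, Complex.exp_zero]

lemma hasDerivAt_exp_mul (c : ℂ) (x : ℝ) :
    HasDerivAt (fun x : ℝ => Complex.exp (c * x)) (Complex.exp (c * x) * c) x := by
  have h : HasDerivAt (fun x : ℝ => c * (x : ℂ)) (c * 1) x :=
    (Complex.ofRealCLM.hasDerivAt (x := x)).const_mul c
  simpa using h.cexp

lemma ac_exp_mul (c : ℂ) (a b : ℝ) :
    AbsolutelyContinuousOnInterval (fun x : ℝ => Complex.exp (c * x)) a b := by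
  refine ContDiffOn.absolutelyContinuousOnInterval (ContDiff.contDiffOn ?_)
  exact (contDiff_const.mul Complex.ofRealCLM.contDiff).cexp

lemma ac_const (c : ℂ) (a b : ℝ) : AbsolutelyContinuousOnInterval (fun _ : ℝ => c) a b :=
  ContDiffOn.absolutelyContinuousOnInterval contDiffOn_const

lemma ac_integral {f : ℝ → ℂ} (hf : LocallyIntegrable f) (c a b : ℝ) :
    AbsolutelyContinuousOnInterval (fun x => ∫ y in c..x, f y) a b := by
  have hi : ∀ a b, IntervalIntegrable f volume a b := fun a b =>
    (hf.integrableOn_isCompact isCompact_uIcc).intervalIntegrable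
  have hre : ∀ a b, IntervalIntegrable (fun y => (f y).re) volume a b := fun a b =>
    ⟨(hi a b).1.re, (hi a b).2.re⟩
  have him : ∀ a b, IntervalIntegrable (fun y => (f y).im) volume a b := fun a b =>
    ⟨(hi a b).1.im, (hi a b).2.im⟩
  have e : (fun x => ∫ y in c..x, f y) = fun x =>
      (∫ y in c..x, (f y).re) • (1 : ℂ) + (∫ y in c..x, (f y).im) • Complex.I := by
    ext x
    rw [← intervalIntegral.integral_smul_const, ← intervalIntegral.integral_smul_const,
      ← intervalIntegral.integral_add ⟨(hre c x).1.smul_const _, (hre c x).2.smul_const _⟩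
        ⟨(him c x).1.smul_const _, (him c x).2.smul_const _⟩]
    congr 1
    ext y
    simp
  -- Absolute continuity is obtained on an interval that contains the base point `c` besides `a` and
  -- `b`, and then restricted.
  have key : ∀ g : ℝ → ℝ, (∀ a b, IntervalIntegrable g volume a b) →
      AbsolutelyContinuousOnInterval (fun x => ∫ y in c..x, g y) a b := fun g hg => by
    refine ((hg (min a (min b c)) (max a (max b c))
      ).absolutelyContinuousOnInterval_intervalIntegral (c := c) ?_).mono ?_
    · rw [Set.uIcc_of_le ((min_le_left _ _).trans (le_max_left _ _))]
      exact ⟨(min_le_right _ _).trans (min_le_right _ _),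
        (le_max_right _ _).trans (le_max_right _ _)⟩
    · rw [Set.uIcc_of_le (a := min a (min b c)) ((min_le_left _ _).trans (le_max_left _ _))]
      exact Set.Icc_subset_Icc
        (le_min (min_le_left _ _) ((min_le_right _ _).trans (min_le_left _ _)))
        (max_le (le_max_left _ _) ((le_max_left _ _).trans (le_max_right _ _)))
  rw [e]
  exact ((key _ hre).fun_smul (ac_const 1 a b)).fun_add ((key _ him).fun_smul (ac_const _ a b))

lemma eq_of_ac_of_ae_deriv_zero {f : ℝ → ℂ} {a b : ℝ} (hf : AbsolutelyContinuousOnInterval f a b)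
    (h0 : ∀ᵐ x, x ∈ Set.uIcc a b → HasDerivAt f 0 x) : f b = f a := by
  obtain ⟨C, hC⟩ := hf.const_of_ae_hasDerivAt_zero h0
  rw [hC a Set.left_mem_uIcc, hC b Set.right_mem_uIcc]

/-- Such a function is the integral of its a.e. derivative up to a constant, and the integral of a
continuous function is differentiable everywhere. -/
lemma hasDerivAt_of_ac {f f₁ : ℝ → ℂ} (hf : ∀ a b, AbsolutelyContinuousOnInterval f a b)
    (hf₁ : Continuous f₁) (h : ∀ᵐ x, HasDerivAt f (f₁ x) x) (x : ℝ) :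
    HasDerivAt f (f₁ x) x := by
  have hd : ∀ x, HasDerivAt (fun x => ∫ y in (0 : ℝ)..x, f₁ y) (f₁ x) x := fun x =>
    intervalIntegral.integral_hasDerivAt_right (hf₁.intervalIntegrable _ _)
      hf₁.stronglyMeasurable.stronglyMeasurableAtFilter hf₁.continuousAt
  have e : ∀ x, f x = f 0 + ∫ y in (0 : ℝ)..x, f₁ y := fun x => by
    have := eq_of_ac_of_ae_deriv_zero (f := fun x => f x - ∫ y in (0 : ℝ)..x, f₁ y)
      ((hf 0 x).fun_sub (ac_integral hf₁.locallyIntegrable 0 0 x)) (by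
        filter_upwards [h] with t ht _
        exact (ht.sub (hd t)).congr_deriv (sub_self _))
    simp only [intervalIntegral.integral_same, sub_zero] at this
    rw [← this]
    ring
  rw [funext e]
  exact (hd x).const_add _

/-- The solution of `-f'' - k² f = -2 i k φ` on the line, with `φ` supported on `[0, ∞)`, that
is outgoing at `0`. -/
def freeWave (k W : ℂ) (φ : ℝ → ℂ) (x : ℝ) : ℂ :=
  Complex.exp (Complex.I * k * x) * (∫ y in (0 : ℝ)..x, Complex.exp (-(Complex.I * k) * y) * φ y) +
    Complex.exp (-(Complex.I * k) * x) *
      (W - ∫ y in (0 : ℝ)..x, Complex.exp (Complex.I * k * y) * φ y)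

/-- The derivative of `freeWave`. -/
def freeWaveDeriv (k W : ℂ) (φ : ℝ → ℂ) (x : ℝ) : ℂ :=
  Complex.I * k * (Complex.exp (Complex.I * k * x) *
    (∫ y in (0 : ℝ)..x, Complex.exp (-(Complex.I * k) * y) * φ y) -
    Complex.exp (-(Complex.I * k) * x) *
      (W - ∫ y in (0 : ℝ)..x, Complex.exp (Complex.I * k * y) * φ y))

section

variable {k W : ℂ} {φ : ℝ → ℂ}

lemma locallyIntegrable_exp_mul (hφ : LocallyIntegrable φ) (c : ℂ) :
    LocallyIntegrable fun y : ℝ => Complex.exp (c * y) * φ y := by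
  have hc : Continuous fun y : ℝ => Complex.exp (c * y) := by fun_prop
  exact hφ.continuous_mul hc

lemma ac_freeWave (hφ : LocallyIntegrable φ) (a b : ℝ) :
    AbsolutelyContinuousOnInterval (freeWave k W φ) a b :=
  ((ac_exp_mul _ a b).fun_smul (ac_integral (locallyIntegrable_exp_mul hφ _) 0 a b)).fun_add
    ((ac_exp_mul _ a b).fun_smul
      ((ac_const W a b).fun_sub (ac_integral (locallyIntegrable_exp_mul hφ _) 0 a b)))

lemma ac_freeWaveDeriv (hφ : LocallyIntegrable φ) (a b : ℝ) :
    AbsolutelyContinuousOnInterval (freeWaveDeriv k W φ) a b :=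
  (((ac_exp_mul _ a b).fun_smul (ac_integral (locallyIntegrable_exp_mul hφ _) 0 a b)).fun_sub
    ((ac_exp_mul _ a b).fun_smul
      ((ac_const W a b).fun_sub (ac_integral (locallyIntegrable_exp_mul hφ _) 0 a b)))).const_smul
      (Complex.I * k)

/-- Almost everywhere the two terms with `φ(x)` in the product rule cancel. What is left is
continuous, so the formula extends to every point. -/
lemma hasDerivAt_freeWave (hφ : LocallyIntegrable φ) (x : ℝ) :
    HasDerivAt (freeWave k W φ) (freeWaveDeriv k W φ x) x := by
  have hcont : Continuous (freeWaveDeriv k W φ) := by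
    rw [continuous_iff_continuousAt]
    intro x
    refine ((ac_freeWaveDeriv hφ (x - 1) (x + 1)).continuousOn).continuousAt ?_
    rw [Set.uIcc_of_le (by linarith)]
    exact Icc_mem_nhds (by linarith) (by linarith)
  refine hasDerivAt_of_ac (ac_freeWave hφ) hcont ?_ x
  filter_upwards [
    LocallyIntegrable.ae_hasDerivAt_integral (locallyIntegrable_exp_mul hφ (Complex.I * k)),
    LocallyIntegrable.ae_hasDerivAt_integral (locallyIntegrable_exp_mul hφ (-(Complex.I * k)))]
    with t h1 h2
  have h := ((hasDerivAt_exp_mul (Complex.I * k) t).mul (h2 0)).add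
    ((hasDerivAt_exp_mul (-(Complex.I * k)) t).mul ((h1 0).const_sub W))
  refine h.congr_deriv ?_
  rw [freeWaveDeriv]
  ring

lemma ae_hasDerivAt_freeWaveDeriv (hφ : LocallyIntegrable φ) :
    ∀ᵐ x, HasDerivAt (freeWaveDeriv k W φ)
    (-k ^ 2 * freeWave k W φ x + 2 * Complex.I * k * φ x) x := by
  filter_upwards [
    LocallyIntegrable.ae_hasDerivAt_integral (locallyIntegrable_exp_mul hφ (Complex.I * k)),
    LocallyIntegrable.ae_hasDerivAt_integral (locallyIntegrable_exp_mul hφ (-(Complex.I * k)))]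
    with t h1 h2
  have h := (((hasDerivAt_exp_mul (Complex.I * k) t).mul (h2 0)).sub
    ((hasDerivAt_exp_mul (-(Complex.I * k)) t).mul ((h1 0).const_sub W))).const_mul (Complex.I * k)
  refine h.congr_deriv ?_
  rw [freeWave]
  have e := exp_mul_exp_neg (Complex.I * k * t)
  rw [← neg_mul] at e
  generalize Complex.exp (Complex.I * k * t) = u at *
  generalize Complex.exp (-(Complex.I * k) * t) = v at *
  linear_combination (2 * Complex.I * k * φ t) * e + (k ^ 2 * (u *
    (∫ y in (0 : ℝ)..t, Complex.exp (-(Complex.I * k) * y) * φ y) + v *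
    (W - ∫ y in (0 : ℝ)..t, Complex.exp (Complex.I * k * y) * φ y))) * Complex.I_sq

end

/-- A solution of `f'' = -k² f` on an interval with left end `0` is a combination of
exponentials. -/
lemma IsSobolevTwo.exists_exp {J : Set ℝ} (hJ0 : ∀ b ∈ J, 0 ≤ b)
    (hJ : ∀ b ∈ J, Set.Icc 0 b ⊆ J) {k : ℂ} (hk : k ≠ 0) {f f₁ f₂ : ℝ → ℂ}
    (hf : IsSobolevTwo J f f₁ f₂) (heq : ∀ᵐ x ∂(volume.restrict J), f₂ x = -k ^ 2 * f x) :
    ∃ c c' : ℂ, ∀ x ∈ J,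
      f x = c * Complex.exp (Complex.I * k * x) + c' * Complex.exp (-(Complex.I * k) * x) ∧
      f₁ x = Complex.I * k *
        (c * Complex.exp (Complex.I * k * x) - c' * Complex.exp (-(Complex.I * k) * x)) := by
  have hIk : Complex.I * k ≠ 0 := mul_ne_zero Complex.I_ne_zero hk
  -- The factorization `D² - s² = (D - s)(D + s)`: the function `(f₁ + s f) e^{-sx}` has derivative
  -- `e^{-sx}(f₂ - s² f)`, which vanishes a.e.
  have key : ∀ s : ℂ, s ^ 2 = -k ^ 2 → ∀ b ∈ J,
      (f₁ b + s * f b) * Complex.exp (-s * b) = f₁ 0 + s * f 0 := by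
    intro s hs b hb
    have hac : AbsolutelyContinuousOnInterval
        (fun x => Complex.exp (-s * x) * (f₁ x + s * f x)) 0 b :=
      (ac_exp_mul (-s) 0 b).fun_smul ((hf.ac_deriv b hb).fun_add ((hf.ac b hb).const_smul s))
    have h := eq_of_ac_of_ae_deriv_zero hac ?_
    · simp only [Complex.ofReal_zero, mul_zero, Complex.exp_zero, one_mul] at h
      rw [mul_comm]
      exact h
    · have hsub : ∀ᵐ x ∂(volume.restrict (Set.Icc 0 b)),
          HasDerivAt f₁ (f₂ x) x ∧ f₂ x = -k ^ 2 * f x :=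
        ae_mono (Measure.restrict_mono (hJ b hb) le_rfl) (hf.hasDeriv₂.and heq)
      rw [← Measure.restrict_congr_set Ioo_ae_eq_Icc,
        ae_restrict_iff' measurableSet_Ioo] at hsub
      have hne0 : ∀ᵐ x : ℝ, x ≠ 0 := by simp [ae_iff]
      have hneb : ∀ᵐ x : ℝ, x ≠ b := by simp [ae_iff]
      filter_upwards [hsub, hne0, hneb] with x hx hx0 hxb hxm
      rw [Set.uIcc_of_le (hJ0 b hb)] at hxm
      have hIoo : x ∈ Set.Ioo 0 b := ⟨lt_of_le_of_ne hxm.1 (Ne.symm hx0), lt_of_le_of_ne hxm.2 hxb⟩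
      obtain ⟨h1, h2⟩ := hx hIoo
      have hfx := (hf.hasDeriv x (hJ b hb hxm)).hasDerivAt
        (Filter.mem_of_superset (Icc_mem_nhds hIoo.1 hIoo.2) (hJ b hb))
      refine ((hasDerivAt_exp_mul (-s) x).mul (h1.add (hfx.const_mul s))).congr_deriv ?_
      rw [h2, Pi.add_apply]
      linear_combination (-Complex.exp (-s * x) * f x) * hs
  have hsq : (Complex.I * k) ^ 2 = -k ^ 2 := by rw [mul_pow, Complex.I_sq]; ring
  have h1 := key (Complex.I * k) hsq
  have h2 := key (-(Complex.I * k)) (by rw [neg_sq, hsq])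
  -- The coefficients solve the linear system given by the two first integrals `s = ik` and `s =
  -- -ik`.
  refine ⟨(f₁ 0 + Complex.I * k * f 0) / (2 * (Complex.I * k)),
    -(f₁ 0 + -(Complex.I * k) * f 0) / (2 * (Complex.I * k)), fun x hx => ?_⟩
  rw [← h1 x hx, ← h2 x hx]
  have e := exp_mul_exp_neg (Complex.I * k * (x : ℂ))
  rw [← neg_mul] at e
  rw [neg_neg]
  generalize Complex.exp (Complex.I * k * x) = u at *
  generalize Complex.exp (-(Complex.I * k) * x) = v at *
  generalize Complex.I * k = s at *
  constructor
  · field_simp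
    linear_combination (-2 * s * f x) * e
  · field_simp
    linear_combination (-2 * f₁ x) * e

end OrdinaryDifferentialEquation

/-! ### The explicit kernel as a bounded operator -/

namespace MetricGraph

open scoped ENNReal

variable {V I E : Type*} (G : MetricGraph V I E)

lemma measurableSet_interval (j : Edge I E) : MeasurableSet (G.interval j) := by
  rcases j with e | i
  · exact measurableSet_Ici
  · exact measurableSet_Icc

lemma continuous_endDist (h : EdgeEnd I E) : Continuous (G.endDist h) := by
  rcases h with e | i | i
  · exact continuous_id
  · exact continuous_id
  · exact continuous_const.sub continuous_id

lemma lintegral_enorm_exp_Ici_lt_top {k : ℂ} (hk : 0 < k.im) :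
    ∫⁻ t in Set.Ici (0 : ℝ), ‖Complex.exp (Complex.I * k * (t : ℝ))‖ₑ < ∞ := by
  have h := integrableOn_exp_mul_complex_Ioi (a := Complex.I * k) (by simpa using hk) 0
  rw [restrict_Ioi_eq_restrict_Ici.symm]
  exact h.2

lemma lintegral_enorm_exp_abs_lt_top {k : ℂ} (hk : 0 < k.im) :
    ∫⁻ t : ℝ, ‖Complex.exp (Complex.I * k * (|t| : ℝ))‖ₑ < ∞ := by
  have h := lintegral_enorm_exp_Ici_lt_top hk
  have h1 : ∫⁻ t in Set.Ici (0 : ℝ), ‖Complex.exp (Complex.I * k * (|t| : ℝ))‖ₑ < ∞ := by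
    rw [setLIntegral_congr_fun measurableSet_Ici fun t ht => by rw [abs_of_nonneg ht]]
    exact h
  have h2 : ∫⁻ t in Set.Iic (0 : ℝ), ‖Complex.exp (Complex.I * k * (|t| : ℝ))‖ₑ < ∞ := by
    have hm := (Measure.measurePreserving_neg (volume : Measure ℝ)).setLIntegral_comp_preimage
      (s := Set.Ici 0) measurableSet_Ici
      (f := fun t => ‖Complex.exp (Complex.I * k * (|t| : ℝ))‖ₑ) (by fun_prop)
    simp only [abs_neg, Set.neg_preimage, Set.neg_Ici, neg_zero] at hm
    rw [hm]
    exact h1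
  rw [← setLIntegral_univ, ← Set.Iic_union_Ici (a := (0 : ℝ))]
  exact (lintegral_union_le _ _ _).trans_lt (ENNReal.add_lt_top.mpr ⟨h2, h1⟩)

lemma lintegral_enorm_exp_endDist_lt_top {k : ℂ} (hk : 0 < k.im) (h : EdgeEnd I E) :
    ∫⁻ y in G.interval (edgeOf h), ‖Complex.exp (Complex.I * k * (G.endDist h y : ℝ))‖ₑ < ∞ := by
  have hfin : ∀ i, ∀ g : ℝ → ℝ, (∀ y ∈ Set.Icc 0 (G.len i), 0 ≤ g y) →
      ∫⁻ y in Set.Icc 0 (G.len i), ‖Complex.exp (Complex.I * k * (g y : ℝ))‖ₑ < ∞ := by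
    intro i g hg
    calc _ ≤ ∫⁻ _y in Set.Icc 0 (G.len i), 1 := by
          refine setLIntegral_mono measurable_const fun y hy => ?_
          rw [← ofReal_norm, ← ENNReal.ofReal_one]
          exact ENNReal.ofReal_le_ofReal (norm_exp_I_mul_le_one hk (hg y hy))
      _ < ∞ := by simp
  rcases h with e | i | i
  · exact lintegral_enorm_exp_Ici_lt_top hk
  · exact hfin i _ fun y hy => hy.1
  · exact hfin i _ fun y hy => sub_nonneg.mpr hy.2

variable [Fintype I] [Fintype E] [DecidableEq I] [DecidableEq E]

/-- The kernel of the resolvent, in terms of the amplitudes `X`. -/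
def greenKernel (k : ℂ) (X : Matrix (EdgeEnd I E) (EdgeEnd I E) ℂ) (j j' : Edge I E)
    (x y : ℝ) : ℂ :=
  Complex.I / (2 * k) * (if j = j' then Complex.exp (Complex.I * k * (|x - y| : ℝ)) else 0) +
    Complex.I / (2 * k) * G.endKernel k X j j' x y

variable {k : ℂ} {X : Matrix (EdgeEnd I E) (EdgeEnd I E) ℂ}

lemma continuous_endKernel (j j' : Edge I E) :
    Continuous (Function.uncurry (G.endKernel k X j j')) := by
  unfold Function.uncurry endKernel
  refine continuous_finsetSum _ fun h _ => continuous_finsetSum _ fun h' _ => ?_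
  have h1 := G.continuous_endDist h
  have h2 := G.continuous_endDist h'
  split_ifs
  · fun_prop
  · exact continuous_const

lemma continuous_greenKernel (j j' : Edge I E) :
    Continuous (Function.uncurry (G.greenKernel k X j j')) := by
  refine Continuous.add ?_ (continuous_const.mul (G.continuous_endKernel j j'))
  refine continuous_const.mul ?_
  split_ifs
  · fun_prop
  · exact continuous_const

/-- A bound for the integrals of `greenKernel` with respect to either variable. -/
def greenBound (k : ℂ) (X : Matrix (EdgeEnd I E) (EdgeEnd I E) ℂ) : ℝ≥0∞ :=
  ‖Complex.I / (2 * k)‖ₑ * ((∫⁻ t : ℝ, ‖Complex.exp (Complex.I * k * (|t| : ℝ))‖ₑ) +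
    ∑ h, ∑ h', ‖X h h'‖ₑ *
      ((∫⁻ y in G.interval (edgeOf h), ‖Complex.exp (Complex.I * k * (G.endDist h y : ℝ))‖ₑ) +
      ∫⁻ y in G.interval (edgeOf h'), ‖Complex.exp (Complex.I * k * (G.endDist h' y : ℝ))‖ₑ))

lemma greenBound_ne_top (hk : 0 < k.im) : G.greenBound k X ≠ ∞ := by
  refine ENNReal.mul_ne_top (by simp) (ENNReal.add_ne_top.mpr
    ⟨(lintegral_enorm_exp_abs_lt_top hk).ne, ?_⟩)
  refine (ENNReal.sum_lt_top.mpr fun h _ => ENNReal.sum_lt_top.mpr fun h' _ => ?_).ne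
  exact ENNReal.mul_lt_top (by simp) (ENNReal.add_lt_top.mpr
    ⟨G.lintegral_enorm_exp_endDist_lt_top hk h, G.lintegral_enorm_exp_endDist_lt_top hk h'⟩)

lemma enorm_greenKernel_le (j j' : Edge I E) (x y : ℝ) :
    ‖G.greenKernel k X j j' x y‖ₑ ≤ ‖Complex.I / (2 * k)‖ₑ *
      (‖Complex.exp (Complex.I * k * (|x - y| : ℝ))‖ₑ + ∑ h, ∑ h',
        if edgeOf h = j ∧ edgeOf h' = j' then
          ‖Complex.exp (Complex.I * k * (G.endDist h x : ℝ))‖ₑ * ‖X h h'‖ₑ *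
            ‖Complex.exp (Complex.I * k * (G.endDist h' y : ℝ))‖ₑ else 0) := by
  rw [greenKernel, ← mul_add, enorm_mul]
  gcongr
  refine (enorm_add_le _ _).trans (add_le_add ?_ ?_)
  · split_ifs <;> simp
  · refine (enorm_sum_le _ _).trans (Finset.sum_le_sum fun h _ =>
      (enorm_sum_le _ _).trans (Finset.sum_le_sum fun h' _ => ?_))
    split_ifs
    · rw [enorm_mul, enorm_mul]
    · simp

lemma enorm_exp_endDist_le_one (hk : 0 < k.im) (h : EdgeEnd I E) {x : ℝ}
    (hx : x ∈ G.interval (edgeOf h)) :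
    ‖Complex.exp (Complex.I * k * (G.endDist h x : ℝ))‖ₑ ≤ 1 := by
  rw [← ofReal_norm, ← ENNReal.ofReal_one]
  exact ENNReal.ofReal_le_ofReal (norm_exp_I_mul_le_one hk (endDist_nonneg h hx))

/-- The free part is a convolution kernel, integrable over the line. In the other part the
exponential in `x` is at most 1 on the edge and the exponential in `y` is integrable. -/
lemma lintegral_greenKernel_right_le (hk : 0 < k.im) (j j' : Edge I E) {x : ℝ}
    (hx : x ∈ G.interval j) :
    ∫⁻ y in G.interval j', ‖G.greenKernel k X j j' x y‖ₑ ≤ G.greenBound k X := by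
  have hd := fun h => G.continuous_endDist (E := E) h
  refine (lintegral_mono fun y => G.enorm_greenKernel_le j j' x y).trans ?_
  rw [lintegral_const_mul' _ _ (by simp), greenBound, lintegral_add_left (by fun_prop),
    lintegral_finsetSum]
  · refine mul_le_mul' le_rfl (add_le_add ?_ (Finset.sum_le_sum fun h _ => ?_))
    · calc _ ≤ ∫⁻ y : ℝ, ‖Complex.exp (Complex.I * k * (|x - y| : ℝ))‖ₑ :=
            setLIntegral_le_lintegral _ _
        _ = _ := lintegral_sub_left_eq_self
            (fun t => ‖Complex.exp (Complex.I * k * (|t| : ℝ))‖ₑ) x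
    · rw [lintegral_finsetSum]
      · gcongr with h'
        split_ifs with hh
        · obtain ⟨rfl, rfl⟩ := hh
          rw [lintegral_const_mul _ (by have := hd h'; fun_prop)]
          gcongr
          · exact mul_le_of_le_one_left' (G.enorm_exp_endDist_le_one hk h hx)
          · exact le_add_self
        · simp
      · intro h' _
        have := hd h'
        split_ifs <;> fun_prop
  · intro h _
    refine Finset.measurable_sum _ fun h' _ => ?_
    have := hd h'
    split_ifs <;> fun_prop

lemma lintegral_greenKernel_left_le (hk : 0 < k.im) (j j' : Edge I E) {y : ℝ}
    (hy : y ∈ G.interval j') :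
    ∫⁻ x in G.interval j, ‖G.greenKernel k X j j' x y‖ₑ ≤ G.greenBound k X := by
  have hd := fun h => G.continuous_endDist (E := E) h
  refine (lintegral_mono fun x => G.enorm_greenKernel_le j j' x y).trans ?_
  rw [lintegral_const_mul' _ _ (by simp), greenBound, lintegral_add_left (by fun_prop),
    lintegral_finsetSum]
  · refine mul_le_mul' le_rfl (add_le_add ?_ (Finset.sum_le_sum fun h _ => ?_))
    · calc _ ≤ ∫⁻ x : ℝ, ‖Complex.exp (Complex.I * k * (|x - y| : ℝ))‖ₑ :=
            setLIntegral_le_lintegral _ _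
        _ = _ := lintegral_sub_right_eq_self
            (fun t => ‖Complex.exp (Complex.I * k * (|t| : ℝ))‖ₑ) y
    · rw [lintegral_finsetSum]
      · gcongr with h'
        split_ifs with hh
        · obtain ⟨rfl, rfl⟩ := hh
          rw [lintegral_congr fun x => mul_assoc _ _ _]
          rw [lintegral_mul_const _ (by have := hd h; fun_prop), mul_comm, mul_assoc]
          gcongr
          refine (mul_le_of_le_one_left' (G.enorm_exp_endDist_le_one hk h' hy)).trans ?_
          exact le_self_add
        · simp
      · intro h' _
        have := hd h
        split_ifs <;> fun_prop
  · intro h _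
    refine Finset.measurable_sum _ fun h' _ => ?_
    have := hd h
    split_ifs <;> fun_prop

/-- The integral operator with the kernel `greenKernel`. -/
lemma exists_greenOperator (hk : 0 < k.im) (X : Matrix (EdgeEnd I E) (EdgeEnd I E) ℂ) :
    ∃ K : G.HilbertSpace →L[ℂ] G.HilbertSpace, G.IsIntegralKernel K (G.greenKernel k X) := by
  have h := fun j j' : Edge I E => exists_kernel_operator
    (μ := volume.restrict (G.interval j)) (ν := volume.restrict (G.interval j'))
    (G.continuous_greenKernel (k := k) (X := X) j j') (G.greenBound_ne_top hk)
    ((ae_restrict_iff' (G.measurableSet_interval j)).mpr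
      (Filter.Eventually.of_forall fun x hx => G.lintegral_greenKernel_right_le hk j j' hx))
    ((ae_restrict_iff' (G.measurableSet_interval j')).mpr
      (Filter.Eventually.of_forall fun x hx => G.lintegral_greenKernel_left_le hk j j' hx))
  choose T hT using h
  let e := PiLp.continuousLinearEquiv 2 ℂ
    fun j : Edge I E => Lp ℂ 2 (volume.restrict (G.interval j))
  refine ⟨e.symm.toContinuousLinearMap ∘L ContinuousLinearMap.pi fun j =>
    ∑ j', T j j' ∘L ContinuousLinearMap.proj j' ∘L e.toContinuousLinearMap, ?_, ?_, ?_⟩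
  · exact fun j j' => (G.continuous_greenKernel j j').measurable.comp measurable_subtype_coe
  · exact fun φ j j' => (hT j j' (φ j')).1
  · intro φ j
    have hK : (e.symm.toContinuousLinearMap ∘L ContinuousLinearMap.pi fun j =>
        ∑ j', T j j' ∘L ContinuousLinearMap.proj j' ∘L e.toContinuousLinearMap) φ j =
        ∑ j', T j j' (φ j') := by
      simp [e]
    rw [hK]
    refine (Lp.coeFn_finsetSum _ _).trans ?_
    have := Filter.eventually_all.mpr fun j' => (hT j j' (φ j')).2
    filter_upwards [this] with x hx
    simp [hx]

end MetricGraph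

/-! ### Outgoing waves and waves generated by sources -/

namespace MetricGraph

open scoped ENNReal

section

variable {V I E : Type*} (G : MetricGraph V I E)

/-- The amplitudes that arrive at the edge ends from the opposite ends. -/
def oppositeWave (k : ℂ) (β : EdgeEnd I E → ℂ) : EdgeEnd I E → ℂ
  | Sum.inl _ => 0
  | Sum.inr g => G.edgePhase k (endIdx g) * β (Sum.inr g.swap)

/-- The solution with the outgoing amplitudes `β`. -/
def outWave (k : ℂ) (β : EdgeEnd I E → ℂ) : Edge I E → ℝ → ℂ
  | Sum.inl e, x => β (Sum.inl e) * Complex.exp (Complex.I * k * x)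
  | Sum.inr i, x => β (Sum.inr (Sum.inl i)) * Complex.exp (Complex.I * k * x) +
      β (Sum.inr (Sum.inr i)) * G.edgePhase k i * Complex.exp (-(Complex.I * k) * x)

/-- The derivative of `outWave`. -/
def outWaveDeriv (k : ℂ) (β : EdgeEnd I E → ℂ) : Edge I E → ℝ → ℂ
  | Sum.inl e, x => Complex.I * k * (β (Sum.inl e) * Complex.exp (Complex.I * k * x))
  | Sum.inr i, x => Complex.I * k * (β (Sum.inr (Sum.inl i)) * Complex.exp (Complex.I * k * x) -
      β (Sum.inr (Sum.inr i)) * G.edgePhase k i * Complex.exp (-(Complex.I * k) * x))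

variable {k : ℂ} {β : EdgeEnd I E → ℂ}

lemma edgePhase_mul_exp_neg (i : I) :
    G.edgePhase k i * Complex.exp (-(Complex.I * k) * (G.len i : ℝ)) = 1 := by
  rw [edgePhase, neg_mul, exp_mul_exp_neg]

/-- With the companion formula for the derivative, this says that the wave arrives at the ends with
the amplitudes `oppositeWave k β` and leaves them with `β`. -/
lemma boundaryValue_outWave :
    G.boundaryValue (G.outWave k β) = G.oppositeWave k β + β := by
  ext h
  rcases h with e | i | i
  · simp [boundaryValue, outWave, oppositeWave]
  · simp only [boundaryValue, outWave, oppositeWave, endIdx, Pi.add_apply, Sum.elim_inl, id,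
      Sum.swap_inl, Complex.ofReal_zero, mul_zero, Complex.exp_zero]
    ring
  · simp only [boundaryValue, outWave, oppositeWave, endIdx, Pi.add_apply, Sum.elim_inr, id,
      Sum.swap_inr, mul_assoc, edgePhase_mul_exp_neg, mul_one]
    rw [edgePhase, mul_comm (Complex.exp _), mul_assoc Complex.I]

lemma boundaryDeriv_outWaveDeriv :
    G.boundaryDeriv (G.outWaveDeriv k β) = (Complex.I * k) • (β - G.oppositeWave k β) := by
  ext h
  rcases h with e | i | i
  · simp [boundaryDeriv, outWaveDeriv, oppositeWave]
  · simp only [boundaryDeriv, outWaveDeriv, oppositeWave, endIdx, Pi.sub_apply, Pi.smul_apply,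
      Sum.elim_inl, id, Sum.swap_inl, smul_eq_mul, Complex.ofReal_zero, mul_zero, Complex.exp_zero]
    ring
  · simp only [boundaryDeriv, outWaveDeriv, oppositeWave, endIdx, Pi.sub_apply, Pi.smul_apply,
      Sum.elim_inr, id, Sum.swap_inr, mul_assoc, edgePhase_mul_exp_neg, mul_one, smul_eq_mul]
    rw [edgePhase]
    simp only [mul_assoc]
    ring

lemma ac_outWave (j : Edge I E) (a b : ℝ) :
    AbsolutelyContinuousOnInterval (G.outWave k β j) a b := by
  rcases j with e | i
  · exact (ac_exp_mul _ a b).const_smul (β (Sum.inl e))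
  · have h1 := (ac_exp_mul (Complex.I * k) a b).const_smul (β (Sum.inr (Sum.inl i)))
    have h2 := (ac_exp_mul (-(Complex.I * k)) a b).const_smul
      (β (Sum.inr (Sum.inr i)) * G.edgePhase k i)
    exact h1.fun_add h2

lemma ac_outWaveDeriv (j : Edge I E) (a b : ℝ) :
    AbsolutelyContinuousOnInterval (G.outWaveDeriv k β j) a b := by
  rcases j with e | i
  · exact ((ac_exp_mul _ a b).const_smul (β (Sum.inl e))).const_smul (Complex.I * k)
  · have h1 := (ac_exp_mul (Complex.I * k) a b).const_smul (β (Sum.inr (Sum.inl i)))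
    have h2 := (ac_exp_mul (-(Complex.I * k)) a b).const_smul
      (β (Sum.inr (Sum.inr i)) * G.edgePhase k i)
    exact (h1.fun_sub h2).const_smul (Complex.I * k)

lemma hasDerivAt_outWave (j : Edge I E) (x : ℝ) :
    HasDerivAt (G.outWave k β j) (G.outWaveDeriv k β j x) x := by
  have h1 := hasDerivAt_exp_mul (Complex.I * k) x
  have h2 := hasDerivAt_exp_mul (-(Complex.I * k)) x
  rcases j with e | i
  · refine (h1.const_mul (β (Sum.inl e))).congr_deriv ?_
    simp only [outWaveDeriv]
    ring
  · refine ((h1.const_mul (β (Sum.inr (Sum.inl i)))).add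
      (h2.const_mul (β (Sum.inr (Sum.inr i)) * G.edgePhase k i))).congr_deriv ?_
    simp only [outWaveDeriv]
    ring

lemma hasDerivAt_outWaveDeriv (j : Edge I E) (x : ℝ) :
    HasDerivAt (G.outWaveDeriv k β j) (-k ^ 2 * G.outWave k β j x) x := by
  have h1 := hasDerivAt_exp_mul (Complex.I * k) x
  have h2 := hasDerivAt_exp_mul (-(Complex.I * k)) x
  rcases j with e | i
  · refine ((h1.const_mul (β (Sum.inl e))).const_mul (Complex.I * k)).congr_deriv ?_
    simp only [outWave]
    linear_combination (k ^ 2 * (β (Sum.inl e) * Complex.exp (Complex.I * k * x))) * Complex.I_sq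
  · refine (((h1.const_mul (β (Sum.inr (Sum.inl i)))).sub
      (h2.const_mul (β (Sum.inr (Sum.inr i)) * G.edgePhase k i))).const_mul
      (Complex.I * k)).congr_deriv ?_
    simp only [outWave]
    linear_combination (k ^ 2 * (β (Sum.inr (Sum.inl i)) * Complex.exp (Complex.I * k * x) +
      β (Sum.inr (Sum.inr i)) * G.edgePhase k i * Complex.exp (-(Complex.I * k) * x))) *
      Complex.I_sq

lemma outWave_eq_sum [Fintype I] [Fintype E] [DecidableEq I] [DecidableEq E] (j : Edge I E)
    (x : ℝ) : G.outWave k β j x = ∑ h, if edgeOf h = j then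
      Complex.exp (Complex.I * k * (G.endDist h x : ℝ)) * β h else 0 := by
  rw [Fintype.sum_sum_type, Fintype.sum_sum_type]
  rcases j with e | i
  · simp [outWave, edgeOf, endDist, mul_comm]
  · simp only [outWave, edgeOf, endDist, endIdx, Sum.elim_inl, Sum.elim_inr, id, reduceCtorEq,
      if_false, Finset.sum_const_zero, zero_add, Sum.inr.injEq, Finset.sum_ite_eq',
      Finset.mem_univ, if_true]
    have e : Complex.exp (Complex.I * k * ((G.len i - x : ℝ) : ℂ)) =
        G.edgePhase k i * Complex.exp (-(Complex.I * k) * x) := by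
      rw [edgePhase, ← Complex.exp_add]
      congr 1
      push_cast
      ring
    rw [e]
    ring

lemma interval_nonneg {j : Edge I E} {x : ℝ} (hx : x ∈ G.interval j) : 0 ≤ x := by
  rcases j with e | i
  · exact hx
  · exact hx.1

lemma Icc_subset_interval {j : Edge I E} {x : ℝ} (hx : x ∈ G.interval j) :
    Set.Icc 0 x ⊆ G.interval j := by
  rcases j with e | i
  · exact fun y hy => hy.1
  · exact Set.Icc_subset_Icc_right hx.2

end

/-- Where `‖g‖ ≤ 1`, the square is dominated by `‖g‖` itself. -/
lemma memLp_two_of_norm_le_one {s : Set ℝ} (hs : MeasurableSet s) {g : ℝ → ℂ} (hg : Continuous g)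
    (h1 : ∀ y ∈ s, ‖g y‖ ≤ 1) (hfin : ∫⁻ y in s, ‖g y‖ₑ < ∞) :
    MemLp g 2 (volume.restrict s) := by
  refine ⟨hg.aestronglyMeasurable, ?_⟩
  by_contra hc
  rw [not_lt, top_le_iff] at hc
  have h2 := eLpNorm_two_sq (μ := volume.restrict s) g
  rw [hc] at h2
  refine (lt_irrefl (∞ : ℝ≥0∞)) (lt_of_le_of_lt ?_ hfin)
  calc (∞ : ℝ≥0∞) = ∫⁻ y in s, ‖g y‖ₑ ^ 2 := by rw [← h2]; simp
    _ ≤ _ := by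
      refine setLIntegral_mono' hs fun y hy => ?_
      have : ‖g y‖ₑ ≤ 1 := by
        rw [← ofReal_norm, ← ENNReal.ofReal_one]
        exact ENNReal.ofReal_le_ofReal (h1 y hy)
      rw [sq]
      exact mul_le_of_le_one_left' this

variable {V I E : Type*} (G : MetricGraph V I E) {k : ℂ}

lemma integrableOn_exp_endDist_mul (hk : 0 < k.im) (h : EdgeEnd I E) {φ : ℝ → ℂ}
    (hφ : MemLp φ 2 (volume.restrict (G.interval (edgeOf h)))) :
    IntegrableOn (fun y => Complex.exp (Complex.I * k * (G.endDist h y : ℝ)) * φ y)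
      (G.interval (edgeOf h)) := by
  have := G.continuous_endDist h
  exact MemLp.integrable_mul (memLp_two_of_norm_le_one (G.measurableSet_interval _)
    (by fun_prop) (fun y hy => norm_exp_I_mul_le_one hk (endDist_nonneg h hy))
    (G.lintegral_enorm_exp_endDist_lt_top hk h)) hφ

lemma integrableOn_exp_abs_mul (hk : 0 < k.im) (j : Edge I E) (x : ℝ) {φ : ℝ → ℂ}
    (hφ : MemLp φ 2 (volume.restrict (G.interval j))) :
    IntegrableOn (fun y => Complex.exp (Complex.I * k * (|x - y| : ℝ)) * φ y) (G.interval j) := by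
  refine MemLp.integrable_mul (memLp_two_of_norm_le_one (G.measurableSet_interval _)
    (by fun_prop) (fun y hy => norm_exp_I_mul_le_one hk (abs_nonneg _)) ?_) hφ
  refine (setLIntegral_le_lintegral _ _).trans_lt ?_
  rw [lintegral_sub_left_eq_self (fun t => ‖Complex.exp (Complex.I * k * (|t| : ℝ))‖ₑ) x]
  exact lintegral_enorm_exp_abs_lt_top hk

lemma integrableOn_exp_mul (hk : 0 < k.im) (j : Edge I E) {φ : ℝ → ℂ}
    (hφ : MemLp φ 2 (volume.restrict (G.interval j))) :
    IntegrableOn (fun y : ℝ => Complex.exp (Complex.I * k * y) * φ y) (G.interval j) := by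
  rcases j with e | i
  · exact G.integrableOn_exp_endDist_mul hk (Sum.inl e) hφ
  · exact G.integrableOn_exp_endDist_mul hk (Sum.inr (Sum.inl i)) hφ

lemma locallyIntegrable_indicator {j : Edge I E} {φ : ℝ → ℂ}
    (hφ : MemLp φ 2 (volume.restrict (G.interval j))) :
    LocallyIntegrable ((G.interval j).indicator φ) :=
  ((memLp_indicator_iff_restrict (G.measurableSet_interval j)).mpr hφ).locallyIntegrable
    one_le_two

lemma integral_indicator_eq {j : Edge I E} {x : ℝ} (hx : x ∈ G.interval j) (g φ : ℝ → ℂ) :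
    ∫ y in (0 : ℝ)..x, g y * (G.interval j).indicator φ y = ∫ y in Set.Icc 0 x, g y * φ y := by
  rw [intervalIntegral.integral_of_le (G.interval_nonneg hx), ← integral_Icc_eq_integral_Ioc]
  refine setIntegral_congr_fun measurableSet_Icc fun y hy => ?_
  simp only [Set.indicator_of_mem (G.Icc_subset_interval hx hy)]

/-- The free wave that is generated by a source on an edge. -/
def sourceWave (k : ℂ) (j : Edge I E) (φ : ℝ → ℂ) : ℝ → ℂ :=
  freeWave k (∫ y : ℝ in G.interval j, Complex.exp (Complex.I * k * y) * φ y)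
    ((G.interval j).indicator φ)

/-- The derivative of `sourceWave`. -/
def sourceWaveDeriv (k : ℂ) (j : Edge I E) (φ : ℝ → ℂ) : ℝ → ℂ :=
  freeWaveDeriv k (∫ y : ℝ in G.interval j, Complex.exp (Complex.I * k * y) * φ y)
    ((G.interval j).indicator φ)

/-- The constant in the free wave is the integral over the whole edge, so its second integral runs
over the points beyond `x`. On the two sides of `x` the exponents combine to `ik|x - y|`. -/
lemma sourceWave_eq (hk : 0 < k.im) {j : Edge I E} {φ : ℝ → ℂ}
    (hφ : MemLp φ 2 (volume.restrict (G.interval j))) {x : ℝ} (hx : x ∈ G.interval j) :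
    G.sourceWave k j φ x =
      ∫ y in G.interval j, Complex.exp (Complex.I * k * (|x - y| : ℝ)) * φ y := by
  have hsub := G.Icc_subset_interval hx
  rw [sourceWave, freeWave, G.integral_indicator_eq hx, G.integral_indicator_eq hx,
    ← setIntegral_sdiff measurableSet_Icc (G.integrableOn_exp_mul hk j hφ) hsub,
    ← integral_const_mul, ← integral_const_mul]
  have h1 : ∫ y in Set.Icc 0 x, Complex.exp (Complex.I * k * x) *
      (Complex.exp (-(Complex.I * k) * y) * φ y) =
      ∫ y in Set.Icc 0 x, Complex.exp (Complex.I * k * (|x - y| : ℝ)) * φ y := by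
    refine setIntegral_congr_fun measurableSet_Icc fun y hy => ?_
    rw [abs_of_nonneg (sub_nonneg.mpr hy.2), ← mul_assoc, ← Complex.exp_add]
    congr 2
    push_cast
    ring
  have h2 : ∫ y in G.interval j \ Set.Icc 0 x, Complex.exp (-(Complex.I * k) * x) *
      (Complex.exp (Complex.I * k * y) * φ y) =
      ∫ y in G.interval j \ Set.Icc 0 x, Complex.exp (Complex.I * k * (|x - y| : ℝ)) * φ y := by
    refine setIntegral_congr_fun ((G.measurableSet_interval j).diff measurableSet_Icc)
      fun y hy => ?_
    have hxy : x < y := lt_of_not_ge fun h => hy.2 ⟨G.interval_nonneg hy.1, h⟩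
    rw [abs_of_neg (sub_neg.mpr hxy), ← mul_assoc, ← Complex.exp_add]
    congr 2
    push_cast
    ring
  rw [h1, h2, setIntegral_sdiff measurableSet_Icc (G.integrableOn_exp_abs_mul hk j x hφ) hsub]
  exact add_sub_cancel _ _

/-- The amplitudes at the edge ends of the waves generated by sources on the edges. -/
def sourceAmplitude (k : ℂ) (φ : Edge I E → ℝ → ℂ) (h : EdgeEnd I E) : ℂ :=
  ∫ y in G.interval (edgeOf h), Complex.exp (Complex.I * k * (G.endDist h y : ℝ)) *
    φ (edgeOf h) y

lemma sourceWave_zero {j : Edge I E} {φ : ℝ → ℂ} : G.sourceWave k j φ 0 =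
    ∫ y : ℝ in G.interval j, Complex.exp (Complex.I * k * y) * φ y := by
  simp [sourceWave, freeWave]

lemma sourceWaveDeriv_zero {j : Edge I E} {φ : ℝ → ℂ} :
    G.sourceWaveDeriv k j φ 0 = -(Complex.I * k * G.sourceWave k j φ 0) := by
  simp [sourceWave, freeWave, sourceWaveDeriv, freeWaveDeriv]

lemma sourceWave_len (hk : 0 < k.im) {i : I} {φ : Edge I E → ℝ → ℂ}
    (hφ : MemLp (φ (Sum.inr i)) 2 (volume.restrict (G.interval (Sum.inr i : Edge I E)))) :
    G.sourceWave k (Sum.inr i) (φ (Sum.inr i)) (G.len i) =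
      G.sourceAmplitude k φ (Sum.inr (Sum.inr i)) := by
  rw [G.sourceWave_eq hk hφ (x := G.len i) ⟨(G.len_pos i).le, le_rfl⟩]
  refine setIntegral_congr_fun (G.measurableSet_interval _) fun y hy => ?_
  rw [abs_of_nonneg (sub_nonneg.mpr hy.2)]
  rfl

lemma sourceWaveDeriv_len {i : I} {φ : ℝ → ℂ} :
    G.sourceWaveDeriv k (Sum.inr i : Edge I E) φ (G.len i) =
      Complex.I * k * G.sourceWave k (Sum.inr i : Edge I E) φ (G.len i) := by
  have hx : G.len i ∈ G.interval (Sum.inr i : Edge I E) := ⟨(G.len_pos i).le, le_rfl⟩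
  have h0 : (∫ y : ℝ in G.interval (Sum.inr i : Edge I E), Complex.exp (Complex.I * k * y) * φ y) -
      ∫ y in (0 : ℝ)..G.len i, Complex.exp (Complex.I * k * y) *
        (G.interval (Sum.inr i : Edge I E)).indicator φ y = 0 := by
    rw [G.integral_indicator_eq hx, interval, sub_self]
  rw [sourceWaveDeriv, freeWaveDeriv, sourceWave, freeWave, h0]
  simp

lemma boundaryValue_sourceWave (hk : 0 < k.im) {φ : Edge I E → ℝ → ℂ}
    (hφ : ∀ j, MemLp (φ j) 2 (volume.restrict (G.interval j))) :
    G.boundaryValue (fun j => G.sourceWave k j (φ j)) = G.sourceAmplitude k φ := by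
  ext h
  rcases h with e | i | i
  · exact G.sourceWave_zero
  · exact G.sourceWave_zero
  · exact G.sourceWave_len hk (hφ _)

/-- The proportionality factor `-ik` between value and derivative means that the source waves are
purely incoming at every end. -/
lemma boundaryDeriv_sourceWaveDeriv (hk : 0 < k.im) {φ : Edge I E → ℝ → ℂ}
    (hφ : ∀ j, MemLp (φ j) 2 (volume.restrict (G.interval j))) :
    G.boundaryDeriv (fun j => G.sourceWaveDeriv k j (φ j)) =
      -((Complex.I * k) • G.sourceAmplitude k φ) := by
  rw [← G.boundaryValue_sourceWave hk hφ]
  ext h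
  rcases h with e | i | i
  · exact G.sourceWaveDeriv_zero
  · exact G.sourceWaveDeriv_zero
  · exact congrArg Neg.neg G.sourceWaveDeriv_len

end MetricGraph

/-! ### The resolvent equation -/

namespace MetricGraph

variable {V I E : Type*} (G : MetricGraph V I E) {k : ℂ}

lemma IsSobolevTwo_of_hasDerivAt {j : Edge I E} {f f₁ f₂ : ℝ → ℂ}
    (hf : ∀ a b, AbsolutelyContinuousOnInterval f a b)
    (hf₁ : ∀ a b, AbsolutelyContinuousOnInterval f₁ a b) (hd : ∀ x, HasDerivAt f (f₁ x) x)
    (hd₂ : ∀ᵐ x ∂(volume.restrict (G.interval j)), HasDerivAt f₁ (f₂ x) x)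
    (hL : MemLp f 2 (volume.restrict (G.interval j)))
    (hL₂ : MemLp f₂ 2 (volume.restrict (G.interval j))) :
    IsSobolevTwo (G.interval j) f f₁ f₂ where
  memLp := hL
  ac b _ := hf 0 b
  hasDeriv x _ := (hd x).hasDerivWithinAt
  ac_deriv b _ := hf₁ 0 b
  hasDeriv₂ := hd₂
  memLp₂ := hL₂

lemma boundaryValue_add (f g : Edge I E → ℝ → ℂ) :
    G.boundaryValue (f + g) = G.boundaryValue f + G.boundaryValue g := by
  ext h; rcases h with e | i | i <;> simp [boundaryValue]

lemma boundaryValue_smul (c : ℂ) (f : Edge I E → ℝ → ℂ) :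
    G.boundaryValue (c • f) = c • G.boundaryValue f := by
  ext h; rcases h with e | i | i <;> simp [boundaryValue]

lemma boundaryDeriv_add (f g : Edge I E → ℝ → ℂ) :
    G.boundaryDeriv (f + g) = G.boundaryDeriv f + G.boundaryDeriv g := by
  ext h; rcases h with e | i | i <;> simp [boundaryDeriv, add_comm]

lemma boundaryDeriv_smul (c : ℂ) (f : Edge I E → ℝ → ℂ) :
    G.boundaryDeriv (c • f) = c • G.boundaryDeriv f := by
  ext h; rcases h with e | i | i <;> simp [boundaryDeriv]

variable [Fintype I] [Fintype E] [DecidableEq I] [DecidableEq E]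

/-- The fixed point equation `X = S + S T X` applied to a vector: the amplitudes `β = X α` satisfy
`β = S(α + Tβ)`, which is the boundary condition. -/
lemma pathMatrix_mulVec {S : Matrix (EdgeEnd I E) (EdgeEnd I E) ℂ}
    (hS : ∀ u, ∑ h, ‖S.mulVec u h‖ ^ 2 = ∑ h, ‖u h‖ ^ 2) (hk : 0 < k.im)
    (α : EdgeEnd I E → ℂ) : (pathMatrix S (G.edgePhase k)).mulVec α =
      S.mulVec (α + G.oppositeWave k ((pathMatrix S (G.edgePhase k)).mulVec α)) := by
  ext h
  rw [Matrix.mulVec_add, Pi.add_apply]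
  have e : S.mulVec (G.oppositeWave k ((pathMatrix S (G.edgePhase k)).mulVec α)) h =
      ∑ g : I ⊕ I, S h (Sum.inr g) * (G.edgePhase k (endIdx g) *
        (pathMatrix S (G.edgePhase k)).mulVec α (Sum.inr g.swap)) := by
    rw [Matrix.mulVec, dotProduct, Fintype.sum_sum_type]
    simp only [oppositeWave, mul_zero, Finset.sum_const_zero, zero_add]
  rw [e]
  simp only [Matrix.mulVec, dotProduct]
  simp_rw [pathMatrix_eq hS (fun i => norm_edgePhase_lt_one (G := G) hk i) h]
  simp only [add_mul, Finset.sum_add_distrib, Finset.sum_mul, Finset.mul_sum]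
  congr 1
  rw [Finset.sum_comm]
  simp only [mul_assoc]

/-- The isometry `S` gives `‖β‖ = ‖Tβ‖`, whereas `T` drops the external amplitudes and strictly
damps nonzero internal ones. So the internal amplitudes vanish, then `Tβ = 0`, and `β = S 0 = 0`. -/
lemma eq_zero_of_eq_mulVec_oppositeWave {S : Matrix (EdgeEnd I E) (EdgeEnd I E) ℂ}
    (hS : ∀ u, ∑ h, ‖S.mulVec u h‖ ^ 2 = ∑ h, ‖u h‖ ^ 2) (hk : 0 < k.im)
    {β : EdgeEnd I E → ℂ} (hβ : β = S.mulVec (G.oppositeWave k β)) : β = 0 := by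
  have h1 := hS (G.oppositeWave k β)
  rw [← hβ, Fintype.sum_sum_type, Fintype.sum_sum_type
    (f := fun h => ‖G.oppositeWave k β h‖ ^ 2)] at h1
  have h2 : ∑ g : I ⊕ I, ‖β (Sum.inr g)‖ ^ 2 = ∑ g : I ⊕ I, ‖β (Sum.inr g.swap)‖ ^ 2 :=
    (Fintype.sum_equiv (Equiv.sumComm I I) _ _ fun g => rfl).symm
  rw [h2] at h1
  simp only [oppositeWave, norm_zero, ne_eq, OfNat.ofNat_ne_zero, not_false_eq_true, zero_pow,
    Finset.sum_const_zero, zero_add, norm_mul, mul_pow] at h1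
  have h3 : ∑ g : I ⊕ I, (1 - ‖G.edgePhase k (endIdx g)‖ ^ 2) * ‖β (Sum.inr g.swap)‖ ^ 2 ≤ 0 := by
    simp only [sub_mul, one_mul, Finset.sum_sub_distrib]
    have : 0 ≤ ∑ e : E, ‖β (Sum.inl e)‖ ^ 2 := Finset.sum_nonneg fun _ _ => by positivity
    linarith
  have hpos : ∀ g : I ⊕ I, 0 < 1 - ‖G.edgePhase k (endIdx g)‖ ^ 2 := fun g => by
    have := norm_edgePhase_lt_one (G := G) hk (endIdx g)
    have h0 := norm_nonneg (G.edgePhase k (endIdx g))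
    nlinarith
  have h4 : ∀ g : I ⊕ I, β (Sum.inr g.swap) = 0 := fun g => by
    have h5 := (Finset.sum_eq_zero_iff_of_nonneg fun g _ =>
      mul_nonneg (hpos g).le (by positivity)).mp (le_antisymm h3 (Finset.sum_nonneg fun g _ =>
        mul_nonneg (hpos g).le (by positivity))) g (Finset.mem_univ g)
    simpa using (mul_eq_zero.mp h5).resolve_left (hpos g).ne'
  have h6 : G.oppositeWave k β = 0 := by
    ext h
    rcases h with e | g
    · rfl
    · simp [oppositeWave, h4 g]
  rw [hβ, h6, Matrix.mulVec_zero]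

/-- The solution of the resolvent equation with the source `φ`. -/
def resolventWave (k : ℂ) (X : Matrix (EdgeEnd I E) (EdgeEnd I E) ℂ) (φ : Edge I E → ℝ → ℂ) :
    Edge I E → ℝ → ℂ :=
  (Complex.I / (2 * k)) • (fun j => G.sourceWave k j (φ j)) +
    G.outWave k (X.mulVec
      ((Complex.I / (2 * k)) • G.sourceAmplitude k φ))

/-- The derivative of `resolventWave`. -/
def resolventWaveDeriv (k : ℂ) (X : Matrix (EdgeEnd I E) (EdgeEnd I E) ℂ)
    (φ : Edge I E → ℝ → ℂ) : Edge I E → ℝ → ℂ :=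
  (Complex.I / (2 * k)) • (fun j => G.sourceWaveDeriv k j (φ j)) +
    G.outWaveDeriv k (X.mulVec
      ((Complex.I / (2 * k)) • G.sourceAmplitude k φ))

/-- The free part of the kernel produces the source waves. In the rest, the integrals over `y` are
the source amplitudes, which `X` turns into the amplitudes of an outgoing wave. -/
lemma sum_integral_greenKernel (hk : 0 < k.im) (X : Matrix (EdgeEnd I E) (EdgeEnd I E) ℂ)
    {φ : Edge I E → ℝ → ℂ} (hφ : ∀ j, MemLp (φ j) 2 (volume.restrict (G.interval j)))
    {j : Edge I E} {x : ℝ} (hx : x ∈ G.interval j) :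
    ∑ j', ∫ y in G.interval j', G.greenKernel k X j j' x y * φ j' y =
      G.resolventWave k X φ j x := by
  set c := Complex.I / (2 * k)
  have hterm : ∀ j' h h', IntegrableOn (fun y => if edgeOf h = j ∧ edgeOf h' = j' then
      Complex.exp (Complex.I * k * (G.endDist h x : ℝ)) * X h h' *
        (Complex.exp (Complex.I * k * (G.endDist h' y : ℝ)) * φ j' y) else 0)
      (G.interval j') := by
    intro j' h h'
    split_ifs with hh
    · obtain ⟨rfl, rfl⟩ := hh
      exact (G.integrableOn_exp_endDist_mul hk h' (hφ _)).const_mul _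
    · exact integrable_zero _ _ _
  have hfree : ∀ j', IntegrableOn (fun y => if j = j' then
      Complex.exp (Complex.I * k * (|x - y| : ℝ)) * φ j' y else 0) (G.interval j') := by
    intro j'
    split_ifs with hh
    · exact G.integrableOn_exp_abs_mul hk j' x (hφ j')
    · exact integrable_zero _ _ _
  have hker : ∀ j' y, G.greenKernel k X j j' x y * φ j' y =
      c * (if j = j' then Complex.exp (Complex.I * k * (|x - y| : ℝ)) * φ j' y else 0) +
      c * ∑ h, ∑ h', if edgeOf h = j ∧ edgeOf h' = j' then
        Complex.exp (Complex.I * k * (G.endDist h x : ℝ)) * X h h' *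
          (Complex.exp (Complex.I * k * (G.endDist h' y : ℝ)) * φ j' y) else 0 := by
    intro j' y
    simp only [greenKernel, endKernel, add_mul, Finset.sum_mul, ite_mul, zero_mul, mul_assoc, c]
  have hint : ∀ j', ∫ y in G.interval j', G.greenKernel k X j j' x y * φ j' y =
      c * (if j = j' then G.sourceWave k j (φ j) x else 0) +
      c * ∑ h, ∑ h', if edgeOf h = j ∧ edgeOf h' = j' then
        Complex.exp (Complex.I * k * (G.endDist h x : ℝ)) * X h h' * G.sourceAmplitude k φ h'
          else 0 := by
    intro j'
    simp_rw [hker]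
    rw [integral_add ((hfree j').const_mul c) (Integrable.const_mul
      (integrable_finsetSum _ fun h _ => integrable_finsetSum _ fun h' _ => hterm j' h h') c),
      integral_const_mul, integral_const_mul, integral_finsetSum _ fun h _ =>
        integrable_finsetSum _ fun h' _ => hterm j' h h']
    congr 2
    · split_ifs with hh
      · subst hh
        rw [G.sourceWave_eq hk (hφ j) hx]
      · simp
    · refine Finset.sum_congr rfl fun h _ => ?_
      rw [integral_finsetSum _ fun h' _ => hterm j' h h']
      refine Finset.sum_congr rfl fun h' _ => ?_
      split_ifs with hh
      · obtain ⟨rfl, rfl⟩ := hh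
        rw [integral_const_mul, sourceAmplitude]
      · simp
  simp_rw [hint]
  rw [Finset.sum_add_distrib, ← Finset.mul_sum, ← Finset.mul_sum, Finset.sum_ite_eq,
    if_pos (Finset.mem_univ _), resolventWave, Pi.add_apply, Pi.add_apply, outWave_eq_sum]
  congr 1
  rw [Finset.sum_comm, Finset.mul_sum]
  refine Finset.sum_congr rfl fun h _ => ?_
  rw [Finset.sum_comm]
  by_cases hh : edgeOf h = j
  · simp only [hh, true_and, Finset.sum_ite_eq, Finset.mem_univ, if_true]
    rw [Matrix.mulVec_smul, Pi.smul_apply, smul_eq_mul, Matrix.mulVec, dotProduct,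
      Finset.mul_sum, Finset.mul_sum, Finset.mul_sum]
    refine Finset.sum_congr rfl fun h' _ => ?_
    ring
  · simp only [hh, false_and, if_false, Finset.sum_const_zero, mul_zero]

end MetricGraph

open scoped ENNReal

/-- A combination of exponentials on a half line is square integrable only if it decays. -/
lemma coeff_eq_zero_of_memLp {k : ℂ} (hk : 0 < k.im) {c c' : ℂ} {f : ℝ → ℂ}
    (hf : MemLp f 2 (volume.restrict (Set.Ici 0))) (heq : ∀ x ∈ Set.Ici (0 : ℝ),
      f x = c * Complex.exp (Complex.I * k * x) + c' * Complex.exp (-(Complex.I * k) * x)) :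
    c' = 0 := by
  have h1 : MemLp (fun x : ℝ => Complex.exp (Complex.I * k * x)) 2
      (volume.restrict (Set.Ici 0)) :=
    MetricGraph.memLp_two_of_norm_le_one measurableSet_Ici (by fun_prop)
      (fun y hy => MetricGraph.norm_exp_I_mul_le_one hk hy)
      (MetricGraph.lintegral_enorm_exp_Ici_lt_top hk)
  have h2 := hf.sub (h1.const_mul c)
  -- Without its decaying part the function is `c' e^{-ikx}`, of modulus at least `‖c'‖`; a constant
  -- is square integrable on a half line only if it is 0.
  have h3 : MemLp (fun _ : ℝ => c') 2 (volume.restrict (Set.Ici 0)) := by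
    refine h2.mono aestronglyMeasurable_const ?_
    refine (ae_restrict_iff' measurableSet_Ici).mpr (Filter.Eventually.of_forall fun x hx => ?_)
    rw [Pi.sub_apply, heq x hx, add_sub_cancel_left, norm_mul]
    refine le_mul_of_one_le_right (norm_nonneg _) ?_
    rw [Complex.norm_exp, Real.one_le_exp_iff]
    simpa using mul_nonneg hk.le hx
  rcases (memLp_const_iff two_ne_zero ENNReal.ofNat_ne_top).mp h3 with h | h
  · exact h
  · simp at h

namespace MetricGraph

variable {V I E : Type*} (G : MetricGraph V I E) {k : ℂ}

lemma zero_mem_interval (j : Edge I E) : (0 : ℝ) ∈ G.interval j := by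
  rcases j with e | i
  · exact Set.self_mem_Ici
  · exact ⟨le_rfl, (G.len_pos i).le⟩

lemma boundaryValue_congr {f g : Edge I E → ℝ → ℂ} (h : ∀ j, ∀ x ∈ G.interval j, f j x = g j x) :
    G.boundaryValue f = G.boundaryValue g := by
  ext a
  rcases a with e | i | i
  · exact h _ _ (G.zero_mem_interval (Sum.inl e))
  · exact h _ _ (G.zero_mem_interval (Sum.inr i))
  · exact h (Sum.inr i) _ ⟨(G.len_pos i).le, le_rfl⟩

lemma boundaryDeriv_congr {f g : Edge I E → ℝ → ℂ} (h : ∀ j, ∀ x ∈ G.interval j, f j x = g j x) :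
    G.boundaryDeriv f = G.boundaryDeriv g := by
  ext a
  rcases a with e | i | i
  · exact h _ _ (G.zero_mem_interval (Sum.inl e))
  · exact h _ _ (G.zero_mem_interval (Sum.inr i))
  · exact congrArg Neg.neg (h (Sum.inr i) _ ⟨(G.len_pos i).le, le_rfl⟩)

variable [Fintype I] [Fintype E]

/-- A square integrable solution of `f'' = -k² f` is determined by its outgoing amplitudes. -/
lemma exists_outWave (hk : 0 < k.im) {f f₁ f₂ : Edge I E → ℝ → ℂ}
    (hf : ∀ j, IsSobolevTwo (G.interval j) (f j) (f₁ j) (f₂ j))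
    (heq : ∀ j, ∀ᵐ x ∂(volume.restrict (G.interval j)), f₂ j x = -k ^ 2 * f j x) :
    ∃ β : EdgeEnd I E → ℂ, ∀ j, ∀ x ∈ G.interval j,
      f j x = G.outWave k β j x ∧ f₁ j x = G.outWaveDeriv k β j x := by
  have hk0 : k ≠ 0 := by rintro rfl; simp at hk
  have h := fun j => (hf j).exists_exp (fun b hb => G.interval_nonneg hb)
    (fun b hb => G.Icc_subset_interval hb) hk0 (heq j)
  choose c c' h using h
  -- At a terminal end the amplitude refers to the distance `a_i - x`, hence the extra factor
  -- `e^{-ik a_i}`.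
  refine ⟨fun a => match a with
    | Sum.inl e => c (Sum.inl e)
    | Sum.inr (Sum.inl i) => c (Sum.inr i)
    | Sum.inr (Sum.inr i) => c' (Sum.inr i) * Complex.exp (-(Complex.I * k) * (G.len i : ℝ)), ?_⟩
  rintro (e | i) x hx
  · obtain ⟨h1, h2⟩ := h _ x hx
    have h0 := coeff_eq_zero_of_memLp hk (hf (Sum.inl e)).memLp fun x hx =>
      (h (Sum.inl e) x hx).1
    rw [h1, h2, h0]
    simp [outWave, outWaveDeriv]
  · obtain ⟨h1, h2⟩ := h _ x hx
    have e : c' (Sum.inr i) * Complex.exp (-(Complex.I * k) * (G.len i : ℝ)) * G.edgePhase k i =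
        c' (Sum.inr i) := by
      rw [mul_assoc, mul_comm (Complex.exp _), edgePhase_mul_exp_neg, mul_one]
    rw [h1, h2]
    simp only [outWave, outWaveDeriv, e, and_self]

variable {M : Submodule ℂ (Double (EdgeEnd I E))}
  {S : Matrix (EdgeEnd I E) (EdgeEnd I E) ℂ}

/-- Injectivity of `-Δ - k²`: a solution of the homogeneous equation is a sourceless outgoing wave,
so its amplitudes satisfy `β = S Tβ` and vanish. -/
lemma eq_zero_of_mem_laplacianGraph (hk : 0 < k.im)
    (hS : ∀ u, ∑ h, ‖S.mulVec u h‖ ^ 2 = ∑ h, ‖u h‖ ^ 2)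
    (hM : ∀ α β : EdgeEnd I E → ℂ,
      (α + β, (Complex.I * k) • (β - α)) ∈ M ↔ β = S.mulVec α)
    {p : G.HilbertSpace × G.HilbertSpace} (hp : p ∈ G.laplacianGraph M)
    (heq : p.2 = -k ^ 2 • p.1) : p.1 = 0 := by
  classical
  obtain ⟨f, f₁, f₂, hf, h1, h2, h3⟩ := hp
  have hode : ∀ j, ∀ᵐ x ∂(volume.restrict (G.interval j)), f₂ j x = -k ^ 2 * f j x := fun j => by
    have hsm : p.2 j = (-k ^ 2) • p.1 j := by rw [heq]; rfl
    have := Lp.coeFn_smul (-k ^ 2) (p.1 j)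
    rw [← hsm] at this
    filter_upwards [h1 j, h2 j, this] with x hx1 hx2 hx3
    rw [← hx1, ← hx2, hx3]
    rfl
  obtain ⟨β, hβ⟩ := G.exists_outWave hk hf hode
  rw [G.boundaryValue_congr fun j x hx => (hβ j x hx).1,
    G.boundaryDeriv_congr fun j x hx => (hβ j x hx).2, boundaryValue_outWave,
    boundaryDeriv_outWaveDeriv, hM] at h3
  have hβ0 := G.eq_zero_of_eq_mulVec_oppositeWave hS hk h3
  ext j : 1
  refine Lp.ext ((h1 j).trans ?_)
  refine Filter.EventuallyEq.trans ?_ (Lp.coeFn_zero _ _ _).symm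
  refine (ae_restrict_iff' (G.measurableSet_interval j)).mpr
    (Filter.Eventually.of_forall fun x hx => ?_)
  rw [(hβ j x hx).1, hβ0]
  rcases j with e | i <;> simp [outWave]

variable [DecidableEq I] [DecidableEq E]

/-- Surjectivity of `-Δ - k²`: the integral operator produces an element of the domain that solves
the inhomogeneous equation. -/
lemma mem_laplacianGraph_of_isIntegralKernel (hk : 0 < k.im)
    (hS : ∀ u, ∑ h, ‖S.mulVec u h‖ ^ 2 = ∑ h, ‖u h‖ ^ 2)
    (hM : ∀ α β : EdgeEnd I E → ℂ,
      (α + β, (Complex.I * k) • (β - α)) ∈ M ↔ β = S.mulVec α)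
    {K : G.HilbertSpace →L[ℂ] G.HilbertSpace}
    (hK : G.IsIntegralKernel K (G.greenKernel k (pathMatrix S (G.edgePhase k))))
    (φ : G.HilbertSpace) : (K φ, -φ - k ^ 2 • K φ) ∈ G.laplacianGraph M := by
  have hk0 : k ≠ 0 := by rintro rfl; simp at hk
  set X := pathMatrix S (G.edgePhase k) with hX
  have hφ : ∀ j, MemLp (φ j) 2 (volume.restrict (G.interval j)) := fun j => Lp.memLp _
  set f := G.resolventWave k X (fun j => φ j) with hf
  set f₁ := G.resolventWaveDeriv k X (fun j => φ j) with hf₁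
  have hloc := fun j => G.locallyIntegrable_indicator (hφ j)
  have hKf : ∀ j, K φ j =ᵐ[volume.restrict (G.interval j)] f j := fun j => by
    refine (hK.apply_eq φ j).trans ?_
    refine (ae_restrict_iff' (G.measurableSet_interval j)).mpr
      (Filter.Eventually.of_forall fun x hx => ?_)
    exact G.sum_integral_greenKernel hk X hφ hx
  -- Square integrability needs no estimate of the wave: it agrees a.e. with a component of the
  -- vector `K φ`.
  have hL : ∀ j, MemLp (f j) 2 (volume.restrict (G.interval j)) := fun j =>
    (Lp.memLp (K φ j)).ae_eq (hKf j)
  refine ⟨f, f₁, fun j => -(φ j : ℝ → ℂ) - k ^ 2 • f j, fun j => ?_, hKf, fun j => ?_, ?_⟩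
  · refine G.IsSobolevTwo_of_hasDerivAt ?_ ?_ ?_ ?_ (hL j) ((hφ j).neg.sub ((hL j).const_smul _))
    · exact fun a b => ((ac_freeWave (hloc j) a b).const_smul (Complex.I / (2 * k))).fun_add
        (G.ac_outWave j a b)
    · exact fun a b => ((ac_freeWaveDeriv (hloc j) a b).const_smul (Complex.I / (2 * k))).fun_add
        (G.ac_outWaveDeriv j a b)
    · exact fun x => ((hasDerivAt_freeWave (hloc j) x).const_smul (Complex.I / (2 * k))).add
        (G.hasDerivAt_outWave j x)
    · refine (ae_restrict_iff' (G.measurableSet_interval j)).mpr ?_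
      filter_upwards [ae_hasDerivAt_freeWaveDeriv (k := k)
        (W := ∫ y : ℝ in G.interval j, Complex.exp (Complex.I * k * y) * φ j y) (hloc j)]
        with x hx hxj
      refine ((hx.const_smul (Complex.I / (2 * k))).add
        (G.hasDerivAt_outWaveDeriv j x)).congr_deriv ?_
      -- The source term is `(i/2k) · 2ik φ = -φ`.
      rw [Set.indicator_of_mem hxj]
      simp only [hf, resolventWave, Pi.add_apply, Pi.smul_apply, Pi.sub_apply, Pi.neg_apply,
        smul_eq_mul, sourceWave]
      field_simp
      linear_combination (2 * φ j x) * Complex.I_sq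
  · refine (Lp.coeFn_sub _ _).trans ((Lp.coeFn_neg _).sub ?_)
    refine (Lp.coeFn_smul _ _).trans ?_
    filter_upwards [hKf j] with x hx
    exact congrArg (fun z : ℂ => k ^ 2 • z) hx
  · have hb := G.boundaryValue_sourceWave hk hφ
    have hb₁ := G.boundaryDeriv_sourceWaveDeriv hk hφ
    set a := (Complex.I / (2 * k)) • G.sourceAmplitude k (fun j => φ j) with ha
    have e1 : G.boundaryValue f = (a + G.oppositeWave k (X.mulVec a)) + X.mulVec a := by
      rw [hf, resolventWave, boundaryValue_add, boundaryValue_smul, hb, boundaryValue_outWave,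
        add_assoc]
    have e2 : G.boundaryDeriv f₁ =
        (Complex.I * k) • (X.mulVec a - (a + G.oppositeWave k (X.mulVec a))) := by
      rw [hf₁, resolventWaveDeriv, boundaryDeriv_add, boundaryDeriv_smul, hb₁,
        boundaryDeriv_outWaveDeriv, smul_neg, smul_comm, ← ha]
      module
    rw [e1, e2, hM]
    exact G.pathMatrix_mulVec hS hk a

lemma isResolventOf_of_isIntegralKernel (hk : 0 < k.im)
    (hS : ∀ u, ∑ h, ‖S.mulVec u h‖ ^ 2 = ∑ h, ‖u h‖ ^ 2)
    (hM : ∀ α β : EdgeEnd I E → ℂ,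
      (α + β, (Complex.I * k) • (β - α)) ∈ M ↔ β = S.mulVec α)
    {K : G.HilbertSpace →L[ℂ] G.HilbertSpace}
    (hK : G.IsIntegralKernel K (G.greenKernel k (pathMatrix S (G.edgePhase k)))) :
    IsResolventOf (-G.laplacian M) (k ^ 2) K := by
  have hex : ∀ φ, ∃ ψ : (G.laplacian M).domain, (ψ : G.HilbertSpace) = K φ ∧
      G.laplacian M ψ = -φ - k ^ 2 • K φ := fun φ => by
    have h := G.mem_laplacianGraph_of_isIntegralKernel hk hS hM hK φ
    rw [← laplacian_graph, LinearPMap.mem_graph_iff] at h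
    exact h
  constructor
  · intro ψ
    let ψ' : (G.laplacian M).domain := ψ
    have hneg : (-G.laplacian M) ψ = -(G.laplacian M ψ') := rfl
    -- The vectors `χ` and `ψ` solve the same inhomogeneous equation, so injectivity identifies
    -- them.
    obtain ⟨χ, hχ, hLχ⟩ := hex ((-G.laplacian M) ψ - k ^ 2 • (ψ : G.HilbertSpace))
    have hmem : ((χ - ψ' : (G.laplacian M).domain).1, G.laplacian M (χ - ψ')) ∈
        G.laplacianGraph M := by
      rw [← laplacian_graph]
      exact (G.laplacian M).mem_graph _
    have h0 := G.eq_zero_of_mem_laplacianGraph hk hS hM hmem (by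
      rw [LinearPMap.map_sub, hLχ, ← hχ, hneg]
      change _ = -k ^ 2 • ((χ : G.HilbertSpace) - (ψ : G.HilbertSpace))
      module)
    rw [← hχ]
    exact sub_eq_zero.mp h0
  · intro φ
    obtain ⟨χ, hχ, hLχ⟩ := hex φ
    refine ⟨χ, hχ, ?_⟩
    have hneg : (-G.laplacian M) χ = -(G.laplacian M χ) := rfl
    rw [hneg, hLχ, hχ]
    module

lemma isGreenFunction_greenKernel (hk : 0 < k.im)
    (hS : ∀ u, ∑ h, ‖S.mulVec u h‖ ^ 2 = ∑ h, ‖u h‖ ^ 2)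
    (hM : ∀ α β : EdgeEnd I E → ℂ,
      (α + β, (Complex.I * k) • (β - α)) ∈ M ↔ β = S.mulVec α) :
    G.IsGreenFunction M k (G.greenKernel k (pathMatrix S (G.edgePhase k))) := by
  obtain ⟨K, hK⟩ := G.exists_greenOperator hk (pathMatrix S (G.edgePhase k))
  exact ⟨⟨K, G.isResolventOf_of_isIntegralKernel hk hS hM hK, hK⟩,
    fun j j' => (G.continuous_greenKernel j j').continuousOn⟩

end MetricGraph

/-! ### Uniqueness of the resolvent and of its continuous kernel -/

lemma IsResolventOf.unique {H : Type*} [NormedAddCommGroup H] [NormedSpace ℂ H]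
    {T : H →ₗ.[ℂ] H} {z : ℂ} {R R' : H →L[ℂ] H} (h : IsResolventOf T z R)
    (h' : IsResolventOf T z R') : R = R' := by
  ext φ
  obtain ⟨ψ, hψ, hT⟩ := h.2 φ
  rw [← hψ, ← h'.1 ψ, hT]

namespace MetricGraph

variable {V I E : Type*} (G : MetricGraph V I E)

/-- The projection of the line to the interval of an edge. -/
def clamp : Edge I E → ℝ → ℝ
  | Sum.inl _, x => max 0 x
  | Sum.inr i, x => max 0 (min x (G.len i))

lemma continuous_clamp (j : Edge I E) : Continuous (G.clamp j) := by
  rcases j with e | i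
  · exact continuous_const.max continuous_id
  · exact continuous_const.max (continuous_id.min continuous_const)

lemma clamp_mem (j : Edge I E) (x : ℝ) : G.clamp j x ∈ G.interval j := by
  rcases j with e | i
  · exact le_max_left (0 : ℝ) x
  · exact ⟨le_max_left _ _, max_le (G.len_pos i).le (min_le_right _ _)⟩

lemma clamp_eq {j : Edge I E} {x : ℝ} (hx : x ∈ G.interval j) : G.clamp j x = x := by
  rcases j with e | i
  · exact max_eq_right hx
  · rw [clamp, min_eq_left hx.2, max_eq_right hx.1]

variable [Fintype I] [Fintype E]

/-- The operator is tested on the indicator function of `[0, t]`, placed on the edge `j'`. -/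
lemma setIntegral_kernel_ae_eq {K : G.HilbertSpace →L[ℂ] G.HilbertSpace}
    {r r' : Edge I E → Edge I E → ℝ → ℝ → ℂ} (h : G.IsIntegralKernel K r)
    (h' : G.IsIntegralKernel K r') (j j' : Edge I E) {t : ℝ} (ht : t ∈ G.interval j') :
    ∀ᵐ x ∂(volume.restrict (G.interval j)),
      ∫ y in Set.Icc 0 t, r j j' x y = ∫ y in Set.Icc 0 t, r' j j' x y := by
  classical
  have hfin : volume.restrict (G.interval j') (Set.Icc 0 t) ≠ ⊤ :=
    ((Measure.restrict_apply_le _ _).trans_lt (by simp)).ne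
  let φ : G.HilbertSpace := WithLp.toLp 2 (Pi.single j'
    (indicatorConstLp 2 measurableSet_Icc hfin (1 : ℂ)))
  have key : ∀ r : Edge I E → Edge I E → ℝ → ℝ → ℂ, ∀ x,
      ∑ j'', ∫ y in G.interval j'', r j j'' x y * φ j'' y = ∫ y in Set.Icc 0 t, r j j' x y := by
    intro r x
    rw [Finset.sum_eq_single j']
    · have e : φ j' = indicatorConstLp 2 measurableSet_Icc hfin (1 : ℂ) := by simp [φ]
      rw [e]
      have e2 : ∫ y in G.interval j', r j j' x y *
          (indicatorConstLp 2 measurableSet_Icc hfin (1 : ℂ)) y =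
          ∫ y in G.interval j', (Set.Icc 0 t).indicator (fun y => r j j' x y) y := by
        refine integral_congr_ae ?_
        filter_upwards [indicatorConstLp_coeFn (p := 2) (hs := measurableSet_Icc)
          (hμs := hfin) (c := (1 : ℂ))] with y hy
        rw [hy]
        by_cases hyt : y ∈ Set.Icc 0 t
        · rw [Set.indicator_of_mem hyt, Set.indicator_of_mem hyt, mul_one]
        · rw [Set.indicator_of_notMem hyt, Set.indicator_of_notMem hyt, mul_zero]
      rw [e2, setIntegral_indicator measurableSet_Icc,
        Set.inter_eq_self_of_subset_right (G.Icc_subset_interval ht)]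
    · intro j'' _ hne
      have e : φ j'' = 0 := by simp [φ, hne]
      rw [e]
      refine integral_eq_zero_of_ae ?_
      filter_upwards [Lp.coeFn_zero ℂ 2 (volume.restrict (G.interval j''))] with y hy
      rw [hy]
      simp
    · simp
  filter_upwards [h.apply_eq φ j, h'.apply_eq φ j] with x hx hx'
  rw [← key r, ← key r', ← hx, hx']

/-- The continuous integral kernel of an operator is unique. -/
lemma IsIntegralKernel.eq_of_continuousOn {K : G.HilbertSpace →L[ℂ] G.HilbertSpace}
    {r r' : Edge I E → Edge I E → ℝ → ℝ → ℂ} (h : G.IsIntegralKernel K r)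
    (h' : G.IsIntegralKernel K r') {j j' : Edge I E}
    (hc : ContinuousOn (Function.uncurry (r j j')) (G.interval j ×ˢ G.interval j'))
    (hc' : ContinuousOn (Function.uncurry (r' j j')) (G.interval j ×ˢ G.interval j'))
    {x y : ℝ} (hx : x ∈ G.interval j) (hy : y ∈ G.interval j') : r j j' x y = r' j j' x y := by
  -- Clamping the arguments to the edges extends the difference of the kernels to a continuous
  -- function on the plane.
  let d : ℝ → ℝ → ℂ := fun x y =>
    r j j' (G.clamp j x) (G.clamp j' y) - r' j j' (G.clamp j x) (G.clamp j' y)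
  have hd : Continuous (Function.uncurry d) := by
    have hp : Continuous fun p : ℝ × ℝ => (G.clamp j p.1, G.clamp j' p.2) :=
      ((G.continuous_clamp j).comp continuous_fst).prodMk
        ((G.continuous_clamp j').comp continuous_snd)
    have hm : ∀ p : ℝ × ℝ, (G.clamp j p.1, G.clamp j' p.2) ∈ G.interval j ×ˢ G.interval j' :=
      fun p => ⟨G.clamp_mem _ _, G.clamp_mem _ _⟩
    exact (hc.comp_continuous hp hm).sub (hc'.comp_continuous hp hm)
  have hslice : ∀ q : Edge I E → Edge I E → ℝ → ℝ → ℂ,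
      ContinuousOn (Function.uncurry (q j j')) (G.interval j ×ˢ G.interval j') →
      ∀ x ∈ G.interval j, ∀ t ∈ G.interval j',
        IntegrableOn (fun y => q j j' x y) (Set.Icc 0 t) := by
    intro q hq x hx t ht
    refine ContinuousOn.integrableOn_Icc ?_
    exact hq.comp (Continuous.prodMk_right x).continuousOn
      fun y hy => ⟨hx, G.Icc_subset_interval ht hy⟩
  -- For each `t` this is known for almost every `x`, with an exceptional set depending on `t`;
  -- continuity in `x` removes it.
  have hint : ∀ t ∈ G.interval j', ∀ x ∈ G.interval j, ∫ y in (0 : ℝ)..t, d x y = 0 := by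
    intro t ht
    refine Measure.eqOn_of_ae_eq (μ := volume) (f := fun x => ∫ y in (0 : ℝ)..t, d x y)
      (g := fun _ => 0) ?_
      (intervalIntegral.continuous_parametric_intervalIntegral_of_continuous' hd 0 t).continuousOn
      continuousOn_const (G.interval_subset j)
    filter_upwards [G.setIntegral_kernel_ae_eq h h' j j' ht,
      ae_restrict_mem (G.measurableSet_interval j)] with x hxe hxj
    rw [intervalIntegral.integral_of_le (G.interval_nonneg ht), ← integral_Icc_eq_integral_Ioc]
    have e : ∫ y in Set.Icc 0 t, d x y = ∫ y in Set.Icc 0 t, (r j j' x y - r' j j' x y) :=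
      setIntegral_congr_fun measurableSet_Icc fun y hy => by
        simp only [d, G.clamp_eq hxj, G.clamp_eq (G.Icc_subset_interval ht hy)]
    rw [e, integral_sub (hslice r hc x hxj t ht) (hslice r' hc' x hxj t ht), hxe, sub_self]
  have hdx : Continuous (d x) := hd.comp (Continuous.prodMk_right x)
  -- Differentiation of the vanishing integral in its upper limit; the ends of the edge follow by
  -- closure.
  have hzero : ∀ y ∈ interior (G.interval j'), d x y = 0 := fun y hy => by
    have h1 := intervalIntegral.integral_hasDerivAt_right (hdx.intervalIntegrable 0 y)
      hdx.stronglyMeasurable.stronglyMeasurableAtFilter hdx.continuousAt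
    refine h1.unique ((hasDerivAt_const y (0 : ℂ)).congr_of_eventuallyEq ?_)
    filter_upwards [isOpen_interior.mem_nhds hy] with t ht
      using hint t (interior_subset ht) x hx
  have hcl : d x y = 0 := by
    have : closure (interior (G.interval j')) ⊆ {y | d x y = 0} :=
      closure_minimal hzero (isClosed_singleton.preimage hdx)
    exact this (G.interval_subset j' hy)
  simp only [d, G.clamp_eq hx, G.clamp_eq hy] at hcl
  exact sub_eq_zero.mp hcl

lemma IsGreenFunction.unique {M : Submodule ℂ (Double (EdgeEnd I E))} {k : ℂ}
    {r r' : Edge I E → Edge I E → ℝ → ℝ → ℂ} (h : G.IsGreenFunction M k r)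
    (h' : G.IsGreenFunction M k r') {j j' : Edge I E} {x y : ℝ} (hx : x ∈ G.interval j)
    (hy : y ∈ G.interval j') : r j j' x y = r' j j' x y := by
  obtain ⟨⟨K, hK, hr⟩, hc⟩ := h
  obtain ⟨⟨K', hK', hr'⟩, hc'⟩ := h'
  obtain rfl := hK.unique hK'
  exact hr.eq_of_continuousOn G hr' (hc j j') (hc' j j') hx hy

end MetricGraph

end QuantumGraph

end

/-! ### The theorem -/

open QuantumGraph in
theorem mainTheorem5 {V I E : Type*} [Fintype V] [Fintype I] [Fintype E]
    [DecidableEq V] [DecidableEq I] [DecidableEq E]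
    (G : MetricGraph V I E) (htadpole : ∀ i, ¬ G.IsTadpole i)
    -- a maximal isotropic subspace `M = M(A, B)` satisfying any of the four conditions
    (M : Submodule ℂ (Double (EdgeEnd I E))) (hM : IsMaximalIsotropic M)
    (A B : Matrix (EdgeEnd I E) (EdgeEnd I E) ℂ) (hAB : M = pairKernel A B)
    (hindep : ScatteringConstant A B ∨ ScatteringSelfAdjoint A B ∨
      ScatteringReflection A B ∨ A * B.conjTranspose = 0)
    -- the conditions are local: `M` is the orthogonal sum of the `M(A(v), B(v))`
    (Av Bv : ∀ v, Matrix (G.EndsAt v) (G.EndsAt v) ℂ)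
    (hvertex : ∀ v, IsMaximalIsotropic (pairKernel (Av v) (Bv v)))
    (hlocal : M = G.vertexSum fun v => pairKernel (Av v) (Bv v))
    -- the weights may be computed from the values of the vertex matrices at any `κ > 0`
    (κ : ℝ) (hκ : 0 < κ)
    (k : ℂ) (hk : 0 < k.im) :
    (∃ r, G.IsGreenFunction M k r) ∧
    ∀ r, G.IsGreenFunction M k r →
      ∀ (j j' : Edge I E), ∀ x ∈ G.interval j, ∀ y ∈ G.interval j',
        -- absolutely convergent expansion, walks collected according to their score
        ((∀ n : I → ℕ, {w : G.Walk j j' | w.score = n}.Finite) ∧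
          Summable (fun n : I → ℕ =>
            ‖∑ᶠ w ∈ {w : G.Walk j j' | w.score = n}, G.walkTerm κ Av Bv k x y w‖) ∧
          r j j' x y =
            Complex.I / (2 * k) *
              (if j = j' then Complex.exp (Complex.I * k * (|x - y| : ℝ)) else 0) +
            Complex.I / (2 * k) *
              ∑' n : I → ℕ, ∑ᶠ w ∈ {w : G.Walk j j' | w.score = n},
                G.walkTerm κ Av Bv k x y w) ∧
        -- the same, walks collected according to their combinatorial length
        ((∀ n : ℕ, {w : G.Walk j j' | w.length = n}.Finite) ∧
          Summable (fun n : ℕ =>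
            ‖∑ᶠ w ∈ {w : G.Walk j j' | w.length = n}, G.walkTerm κ Av Bv k x y w‖) ∧
          r j j' x y =
            Complex.I / (2 * k) *
              (if j = j' then Complex.exp (Complex.I * k * (|x - y| : ℝ)) else 0) +
            Complex.I / (2 * k) *
              ∑' n : ℕ, ∑ᶠ w ∈ {w : G.Walk j j' | w.length = n},
                G.walkTerm κ Av Bv k x y w) ∧
        -- the same, walk by walk, when the imaginary part of `k` is large enough
        ((∀ i, (Fintype.card I : ℝ) * Real.exp (-(k.im * G.len i)) < 1) →
          Summable (fun w : G.Walk j j' => ‖G.walkTerm κ Av Bv k x y w‖) ∧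
          r j j' x y =
            Complex.I / (2 * k) *
              (if j = j' then Complex.exp (Complex.I * k * (|x - y| : ℝ)) else 0) +
            Complex.I / (2 * k) * ∑' w : G.Walk j j', G.walkTerm κ Av Bv k x y w) := by
  have hk0 : k ≠ 0 := by
    rintro rfl
    simp at hk
  have hκ0 : (κ : ℂ) ≠ 0 := Complex.ofReal_ne_zero.mpr hκ.ne'
  -- The same matrix describes `M` at every `c ≠ 0`. At `c = κ`, flux conservation shows that it is
  -- an isometry; at `c = k` it gives the boundary condition of the resolvent equation.
  have hw := fun (c : ℂ) (hc : c ≠ 0) => G.wave_mem_iff_of_scattering_condition hM.1 hAB hindep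
    (fun v => (hvertex v).1) hlocal hκ hc
  have hS : ∀ u, ∑ h, ‖(G.vertexScattering κ Av Bv).mulVec u h‖ ^ 2 = ∑ h, ‖u h‖ ^ 2 :=
    fun u => hM.1.sum_sq_eq hκ ((hw κ hκ0 u _).mpr rfl)
  have hG := G.isGreenFunction_greenKernel hk hS (hw k hk0)
  refine ⟨⟨_, hG⟩, fun r hr j j' x hx y hy => ?_⟩
  have hr0 := MetricGraph.IsGreenFunction.unique G hr hG hx hy
  obtain ⟨hs, hs'⟩ := MetricGraph.hasSum_score htadpole hS hk j j' x y
  obtain ⟨hl, hl'⟩ := MetricGraph.hasSum_length htadpole hS hk j j' x y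
  refine ⟨⟨fun n => MetricGraph.Walk.finite_score n, hs, ?_⟩,
    ⟨fun n => MetricGraph.Walk.finite_length n, hl, ?_⟩, fun hlen => ?_⟩
  · rw [hr0, hs'.tsum_eq, MetricGraph.greenKernel]
  · rw [hr0, hl'.tsum_eq, MetricGraph.greenKernel]
  · obtain ⟨hw, hw'⟩ := MetricGraph.hasSum_walkTerm htadpole hS hk hx hy hlen
    exact ⟨hw, by rw [hr0, hw'.tsum_eq, MetricGraph.greenKernel]⟩
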